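/- Let $X=(X_t)_{t\ge 0}$ be a real-valued Lévy process with càdlàg paths, started at $0$ under the probability measure $\mathbb P$, with characteristic exponent $\varPsi$, i.e. $\mathbb P[\mathrm e^{\mathrm i\lambda X_t}]=\mathrm e^{-t\varPsi(\lambda)}$ for all $t\ge 0$, $\lambda\in\mathbb R$. Assume that $X$ is recurrent, i.e. $\mathbb P\left[\int_0^\infty 1_{\{|X_t-a|<\varepsilon\}}\,\mathrm dt\right]=\infty$ for all $a\in\mathbb R$ and $\varepsilon>0$, and that (A) $\displaystyle\int_0^\infty\left|\frac{1}{q+\varPsi(\lambda)}\right|\mathrm d\lambda<\infty$ for every $q>0$. Let $m^2=\mathbb P[X_1^2]$, with $1/m^2:=0$ if $m^2=\infty$. For $q>0$ let $r_q$ be the bounded continuous $q$-resolvent density of $X$, i.e. the bounded continuous function $r_q\colon\mathbb R\to[0,\infty)$ such that $\int_{\mathbb R}f(x)r_q(x)\,\mathrm dx=\mathbb P\left[\int_0^\infty\mathrm e^{-qt}f(X_t)\,\mathrm dt\right]$ for all measurable $f\ge 0$; put $h_q(x)=r_q(0)-r_q(-x)$ and let $h(x)=\lim_{q\to0+}h_q(x)$,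 $x\in\mathbb R$, be the renormalized zero resolvent. Then $m^2\in(0,\infty]$, the density $r_q$ exists for every $q>0$, the limit $h(x)$ exists and is finite for every $x\in\mathbb R$, and: 1. $\displaystyle\lim_{x\to\infty}\frac{h(x)}{|x|}=\lim_{x\to-\infty}\frac{h(x)}{|x|}=\frac1{m^2}\in[0,\infty)$; 2. for every $x\in\mathbb R$, $\displaystyle\lim_{y\to\infty}\{h(x+y)-h(y)\}=\frac{x}{m^2}$ and $\displaystyle\lim_{y\to-\infty}\{h(x+y)-h(y)\}=-\frac{x}{m^2}$. -/

import Mathlib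

open MeasureTheory ProbabilityTheory Filter Topology Set
open scoped NNReal ENNReal

noncomputable section

namespace Levy

variable {Ω : Type*} [MeasurableSpace Ω]

/-- `X` is a real-valued Lévy process started at `0` under `P`: a process with càdlàg paths,
`X 0 = 0` almost surely, and independent and stationary increments. -/
structure IsLevyProcess (X : ℝ≥0 → Ω → ℝ) (P : Measure Ω) : Prop where
  measurable : ∀ t, Measurable (X t)
  right_continuous : ∀ ω t, ContinuousWithinAt (fun s => X s ω) (Ici t) t
  left_limits : ∀ ω t, ∃ l : ℝ, Tendsto (fun s => X s ω) (𝓝[<] t) (𝓝 l)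
  start_zero : ∀ᵐ ω ∂P, X 0 ω = 0
  indep_increments : HasIndepIncrements X P
  stationary_increments : ∀ s t, IdentDistrib (fun ω => X (s + t) ω - X s ω) (X t) P P

/-- Recurrence: the expected time spent in every interval `(a - ε, a + ε)` is infinite. -/
def IsRecurrent (X : ℝ≥0 → Ω → ℝ) (P : Measure Ω) : Prop :=
  ∀ a ε : ℝ, 0 < ε →
    ∫⁻ ω, (∫⁻ t in Ioi (0 : ℝ),
      {x : ℝ | |x - a| < ε}.indicator (fun _ => (1 : ℝ≥0∞)) (X t.toNNReal ω)) ∂P = ∞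

/-- The characteristic exponent `Ψ`: `Ψ ξ` is the unique complex number such that
`E[exp (i ξ X_t)] = exp (-t Ψ(ξ))` for all `t ≥ 0`. -/
def charExponent (X : ℝ≥0 → Ω → ℝ) (P : Measure Ω) (ξ : ℝ) : ℂ :=
  Classical.epsilon fun z : ℂ =>
    ∀ t : ℝ≥0, charFun (P.map (X t)) ξ = Complex.exp (-((t : ℝ) : ℂ) * z)

/-- Condition (A): `∫_0^∞ |1 / (q + Ψ(ξ))| dξ < ∞` for every `q > 0`. -/
def ConditionA (X : ℝ≥0 → Ω → ℝ) (P : Measure Ω) : Prop :=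
  ∀ q : ℝ, 0 < q → ∫⁻ ξ in Ioi (0 : ℝ), ‖1 / ((q : ℂ) + charExponent X P ξ)‖ₑ < ∞

/-- `r` is the bounded continuous `q`-resolvent density of the process:
`∫ f(x) r(x) dx = E[∫_0^∞ exp (-q t) f(X_t) dt]` for all measurable `f ≥ 0`. -/
structure IsResolventDensity (X : ℝ≥0 → Ω → ℝ) (P : Measure Ω) (q : ℝ) (r : ℝ → ℝ) : Prop where
  continuous : Continuous r
  nonneg : ∀ x, 0 ≤ r x
  bounded : ∃ C, ∀ x, r x ≤ C
  lintegral_eq : ∀ f : ℝ → ℝ≥0∞, Measurable f →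
    ∫⁻ x, f x * ENNReal.ofReal (r x) =
      ∫⁻ ω, (∫⁻ t in Ioi (0 : ℝ),
        ENNReal.ofReal (Real.exp (-q * t)) * f (X t.toNNReal ω)) ∂P

/-- The bounded continuous `q`-resolvent density `r_q` (unique when it exists). -/
def resolventDensity (X : ℝ≥0 → Ω → ℝ) (P : Measure Ω) (q : ℝ) : ℝ → ℝ :=
  Classical.epsilon fun r => IsResolventDensity X P q r

/-- `h_q(x) = r_q(0) - r_q(-x)`. -/
def hq (X : ℝ≥0 → Ω → ℝ) (P : Measure Ω) (q x : ℝ) : ℝ :=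
  resolventDensity X P q 0 - resolventDensity X P q (-x)

/-- The renormalized zero resolvent `h(x) = lim_{q → 0+} h_q(x)`. -/
def renormalizedZeroResolvent (X : ℝ≥0 → Ω → ℝ) (P : Measure Ω) (x : ℝ) : ℝ :=
  limUnder (𝓝[>] (0 : ℝ)) fun q => hq X P q x

/-- The second moment `m² = E[X_1²]`, possibly infinite. -/
def secondMoment (X : ℝ≥0 → Ω → ℝ) (P : Measure Ω) : ℝ≥0∞ :=
  ∫⁻ ω, ENNReal.ofReal (X 1 ω ^ 2) ∂P

/-- `1 / m²` as a real number, equal to `0` when `m² = ∞`. -/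
def invSecondMoment (X : ℝ≥0 → Ω → ℝ) (P : Measure Ω) : ℝ :=
  (secondMoment X P)⁻¹.toReal

end Levy

end

/-!
The density `r_q` is the inverse Fourier transform of `1 / (q + Ψ)`. An energy form of the maximum
principle gives `r_q(a) r_q(x) ≤ r_q(0) r_q(x + a)`, so `h_q` is nonnegative and subadditive, and
its increments over shifts by `x` are bounded, uniformly in `q` and in the position, by a multiple
of `∫ |exp(iξx) - 1|² / |Ψ(ξ)| dξ`, which grows at most linearly in `x`.

Second differences of `h_q` are Fourier integrals that converge as `q → 0` and whose limits vanish
at infinity by the Riemann–Lebesgue lemma. Hence `h_q - h_p` for small `p, q`, and the increments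
of `h` far out, are asymptotically additive functions of the shift, and everything comes down to
the unit increments `h(1 + y) - h(y)` as `y → ±∞`. Let `U` be the law of `X` at an independent
standard exponential time. Its second moment is `m²`, since both are read off from `Ψ` near `0`.

* If `m² = ∞`, then the bound on the increments is `o(|x|)`. This rules out any nonzero additive
  limit, so `h` exists and its increments vanish at infinity.
* If `m² < ∞`, then recurrence forces `U` to be centred, for otherwise `r_q(0)` would stay bounded
  as `q → 0`. The odd part of `h_q` is then a convergent Fourier integral as well, so `h` exists,
  and its increments at `+∞` and `-∞` are opposite. Their difference is found by integrating the
  Poisson equation `∫ (h(x + v) - h(x)) U(dv) = r_1(-x)` over a long interval: the right side has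
  total mass `1`, and the left side is a flux tending to `m² / 2` times that difference.
-/

namespace Levy

open Real
open scoped ComplexConjugate

/-! ### Fourier inversion of characteristic functions -/

section

open FourierTransform

/-- The inverse Fourier transform in the normalization inverse to `charFun`: if `φ` is the
characteristic function of a measure and is integrable, this is the density of the measure.
Only the real part is kept, the imaginary part vanishing when `φ (-ξ) = conj (φ ξ)`. -/
noncomputable def charFunInv (φ : ℝ → ℂ) (x : ℝ) : ℝ :=
  (2 * π)⁻¹ * (∫ ξ : ℝ, Complex.exp (-(ξ * x : ℝ) * Complex.I) * φ ξ).re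

theorem norm_exp_neg_ofReal_mul_I (y : ℝ) : ‖Complex.exp (-(y : ℝ) * Complex.I)‖ = 1 := by
  rw [← Complex.ofReal_neg, Complex.norm_exp_ofReal_mul_I]

theorem integrable_exp_mul {φ : ℝ → ℂ} (hφ : Integrable φ) (x : ℝ) :
    Integrable fun ξ : ℝ => Complex.exp (-(ξ * x : ℝ) * Complex.I) * φ ξ :=
  hφ.bdd_mul (c := 1) (by fun_prop) (.of_forall fun _ => (norm_exp_neg_ofReal_mul_I _).le)

theorem integral_exp_mul_eq_fourier (φ : ℝ → ℂ) (x : ℝ) :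
    ∫ ξ : ℝ, Complex.exp (-(ξ * x : ℝ) * Complex.I) * φ ξ =
      (2 * π : ℝ) * 𝓕 (fun ξ : ℝ => φ (2 * π * ξ)) x := by
  have h := Measure.integral_comp_mul_left
    (fun ξ : ℝ => Complex.exp (-(ξ * x : ℝ) * Complex.I) * φ ξ) (2 * π)
  rw [abs_of_pos (by positivity), Complex.real_smul, Complex.ofReal_inv,
    eq_inv_mul_iff_mul_eq₀ (by norm_cast; positivity)] at h
  rw [fourier_real_eq_integral_exp_smul, ← h]
  congr 2 with ξ
  rw [smul_eq_mul]
  congr 2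
  push_cast
  ring

theorem charFunInv_eq_fourier_re (φ : ℝ → ℂ) (x : ℝ) :
    charFunInv φ x = (𝓕 (fun ξ : ℝ => φ (2 * π * ξ)) x).re := by
  rw [charFunInv, integral_exp_mul_eq_fourier, Complex.re_ofReal_mul,
    inv_mul_cancel_left₀ (by positivity)]

theorem tendsto_charFunInv_cocompact (φ : ℝ → ℂ) :
    Tendsto (charFunInv φ) (cocompact ℝ) (𝓝 0) := by
  simp_rw [funext (charFunInv_eq_fourier_re φ)]
  exact (Complex.continuous_re.tendsto 0).comp (zero_at_infty_fourier _)

theorem abs_charFunInv_le (φ : ℝ → ℂ) (x : ℝ) :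
    |charFunInv φ x| ≤ (2 * π)⁻¹ * ∫ ξ, ‖φ ξ‖ := by
  rw [charFunInv, abs_mul, abs_of_pos (by positivity)]
  gcongr
  refine (Complex.abs_re_le_norm _).trans ((norm_integral_le_integral_norm _).trans_eq ?_)
  simp only [norm_mul, norm_exp_neg_ofReal_mul_I, one_mul]

theorem charFunInv_sub {φ ψ : ℝ → ℂ} (hφ : Integrable φ) (hψ : Integrable ψ) (x : ℝ) :
    charFunInv (fun ξ => φ ξ - ψ ξ) x = charFunInv φ x - charFunInv ψ x := by
  simp only [charFunInv, mul_sub, Complex.sub_re,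
    integral_sub (integrable_exp_mul hφ x) (integrable_exp_mul hψ x)]

theorem charFunInv_const_mul (c : ℝ) (φ : ℝ → ℂ) (x : ℝ) :
    charFunInv (fun ξ => c * φ ξ) x = c * charFunInv φ x := by
  simp only [charFunInv, mul_left_comm _ (c : ℂ), integral_const_mul, Complex.re_ofReal_mul]
  ring

theorem charFunInv_add_right (φ : ℝ → ℂ) (x y : ℝ) :
    charFunInv φ (x + y) =
      charFunInv (fun ξ => Complex.exp (-(ξ * x : ℝ) * Complex.I) * φ ξ) y := by
  simp only [charFunInv, ← mul_assoc, ← Complex.exp_add]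
  congr! 6
  push_cast
  ring

theorem tendsto_charFunInv_of_dominated {ι : Type*} {l : Filter ι} [l.IsCountablyGenerated]
    {F : ι → ℝ → ℂ} {f : ℝ → ℂ} {bound : ℝ → ℝ}
    (hF : ∀ᶠ i in l, AEStronglyMeasurable (F i)) (hle : ∀ᶠ i in l, ∀ᵐ ξ, ‖F i ξ‖ ≤ bound ξ)
    (hbound : Integrable bound) (hlim : ∀ᵐ ξ, Tendsto (fun i => F i ξ) l (𝓝 (f ξ))) (x : ℝ) :
    Tendsto (fun i => charFunInv (F i) x) l (𝓝 (charFunInv f x)) := by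
  refine .const_mul _ ((Complex.continuous_re.tendsto _).comp ?_)
  refine tendsto_integral_filter_of_dominated_convergence bound ?_ ?_ hbound ?_
  · filter_upwards [hF] with i hi
    exact .mul (by fun_prop) hi
  · filter_upwards [hle] with i hi
    filter_upwards [hi] with ξ hξ
    rwa [norm_mul, norm_exp_neg_ofReal_mul_I, one_mul]
  · filter_upwards [hlim] with ξ hξ
    exact hξ.const_mul _

theorem continuous_charFunInv {φ : ℝ → ℂ} (hφ : Integrable φ) : Continuous (charFunInv φ) := by
  refine continuous_const.mul (Complex.continuous_re.comp ?_)
  refine continuous_of_dominated (bound := fun ξ => ‖φ ξ‖)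
    (fun x => (integrable_exp_mul hφ x).aestronglyMeasurable) (fun x => .of_forall fun ξ => ?_)
    hφ.norm (.of_forall fun ξ => by fun_prop)
  rw [norm_mul, norm_exp_neg_ofReal_mul_I, one_mul]

theorem integral_charFunInv_sub (μ : Measure ℝ) [IsFiniteMeasure μ] {φ : ℝ → ℂ}
    (hφ : Integrable φ) (x : ℝ) :
    ∫ y, charFunInv φ (x - y) ∂μ = charFunInv (fun ξ => charFun μ ξ * φ ξ) x := by
  have hF : Integrable (Function.uncurry fun y ξ : ℝ =>
      Complex.exp (-(ξ * (x - y) : ℝ) * Complex.I) * φ ξ) (μ.prod volume) :=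
    (hφ.comp_snd μ).bdd_mul (c := 1) (by fun_prop)
      (.of_forall fun _ => (norm_exp_neg_ofReal_mul_I _).le)
  have hre := integral_re hF.integral_prod_left
  simp only [RCLike.re_to_complex, Function.uncurry_apply_pair] at hre
  simp only [charFunInv]
  rw [integral_const_mul, hre, integral_integral_swap hF]
  congr! 3
  funext ξ
  rw [charFun_apply_real, integral_mul_const, ← mul_assoc, ← integral_const_mul]
  congr! 2
  funext y
  rw [← Complex.exp_add]
  congr 1
  push_cast
  ring

theorem charFunInv_charFun_gaussianReal {v : ℝ≥0} (hv : v ≠ 0) :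
    charFunInv (charFun (gaussianReal 0 v)) = gaussianPDFReal 0 v := by
  have hv' : 0 < (v : ℝ) := by positivity
  funext x
  have h := fourierIntegral_gaussian (b := (v / 2 : ℝ)) (by simpa using hv') (-x)
  have hpow : (π / ((v / 2 : ℝ) : ℂ)) ^ (1 / 2 : ℂ) = (√(2 * π / v) : ℝ) := by
    rw [sqrt_eq_rpow, Complex.ofReal_cpow (by positivity)]
    congr 1 <;> push_cast <;> [field_simp; rfl]
  have hexp : Complex.exp (-(-x : ℂ) ^ 2 / (4 * ((v / 2 : ℝ) : ℂ))) =
      (rexp (-x ^ 2 / (2 * v)) : ℝ) := by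
    rw [Complex.ofReal_exp]
    congr 1
    push_cast
    field_simp
    ring
  rw [hpow, hexp, ← Complex.ofReal_mul] at h
  have hint : ∫ ξ : ℝ, Complex.exp (-(ξ * x : ℝ) * Complex.I) * charFun (gaussianReal 0 v) ξ =
      (√(2 * π / v) * rexp (-x ^ 2 / (2 * v)) : ℝ) := by
    rw [← h]
    congr! 2 with ξ
    rw [charFun_gaussianReal, ← Complex.exp_add, ← Complex.exp_add]
    congr 1
    push_cast
    ring
  have hconst : (2 * π)⁻¹ * √(2 * π / v) = (√(2 * π * v))⁻¹ := by
    rw [sqrt_div (by positivity), sqrt_mul (by positivity) (v : ℝ)]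
    field_simp
    rw [sq_sqrt (by positivity)]
  rw [charFunInv, hint, Complex.ofReal_re, gaussianPDFReal, ← mul_assoc, hconst, sub_zero]

theorem integrable_charFun_gaussianReal {v : ℝ≥0} (hv : v ≠ 0) :
    Integrable (charFun (gaussianReal 0 v)) := by
  have hv' : 0 < (v : ℝ) := by positivity
  refine (integrable_cexp_neg_mul_sq (b := (v / 2 : ℝ)) (by simpa using hv')).congr
    (.of_forall fun ξ => ?_)
  simp only [charFun_gaussianReal]
  congr 1
  push_cast
  ring

theorem tendsto_charFunInv_gaussian_mul {φ : ℝ → ℂ} (hφ : Integrable φ) (x : ℝ) :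
    Tendsto (fun n : ℕ => charFunInv (fun ξ => φ ξ *
      charFun (gaussianReal 0 (n + 1 : ℝ≥0)⁻¹) ξ) x) atTop (𝓝 (charFunInv φ x)) := by
  refine tendsto_charFunInv_of_dominated (bound := fun ξ => ‖φ ξ‖) (.of_forall fun n => ?_)
    (.of_forall fun n => .of_forall fun ξ => ?_) hφ.norm (.of_forall fun ξ => ?_) x
  · exact hφ.aestronglyMeasurable.mul measurable_charFun.aestronglyMeasurable
  · rw [norm_mul]
    exact mul_le_of_le_one_right (norm_nonneg _) (norm_charFun_le_one ξ)
  · simp only [charFun_gaussianReal]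
    have hn : Tendsto (fun n : ℕ => ((n : ℂ) + 1)⁻¹) atTop (𝓝 0) := by
      simpa using tendsto_one_div_add_atTop_nhds_zero_nat (𝕜 := ℂ)
    have h := ((Complex.continuous_exp.comp
      (by fun_prop : Continuous fun z : ℂ => -z * (ξ : ℂ) ^ 2 / 2)).tendsto 0).comp hn
    simpa [Function.comp_def, neg_div] using h.const_mul (φ ξ)

theorem charFunInv_charFun_mul_gaussianReal (μ : Measure ℝ) [IsFiniteMeasure μ] {v : ℝ≥0}
    (hv : v ≠ 0) (x : ℝ) :
    charFunInv (fun ξ => charFun μ ξ * charFun (gaussianReal 0 v) ξ) x =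
      ∫ y, gaussianPDFReal 0 v (x - y) ∂μ := by
  rw [← integral_charFunInv_sub μ (integrable_charFun_gaussianReal hv),
    charFunInv_charFun_gaussianReal hv]

theorem charFunInv_charFun_nonneg {μ : Measure ℝ} [IsFiniteMeasure μ]
    (hμ : Integrable (charFun μ)) (x : ℝ) : 0 ≤ charFunInv (charFun μ) x := by
  refine ge_of_tendsto' (tendsto_charFunInv_gaussian_mul hμ x) fun n => ?_
  rw [charFunInv_charFun_mul_gaussianReal μ (by positivity)]
  exact integral_nonneg fun y => gaussianPDFReal_nonneg _ _ _

theorem lintegral_charFunInv_charFun_le {μ : Measure ℝ} [IsFiniteMeasure μ]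
    (hμ : Integrable (charFun μ)) :
    ∫⁻ x, ENNReal.ofReal (charFunInv (charFun μ) x) ≤ μ univ := by
  set v : ℕ → ℝ≥0 := fun n => (n + 1 : ℝ≥0)⁻¹
  have hv (n : ℕ) : v n ≠ 0 := by positivity
  have hlim (x : ℝ) := (ENNReal.continuous_ofReal.tendsto _).comp
    (tendsto_charFunInv_gaussian_mul hμ x)
  have hmass (n : ℕ) : ∫⁻ x, ENNReal.ofReal
      (charFunInv (fun ξ => charFun μ ξ * charFun (gaussianReal 0 (v n)) ξ) x) = μ univ := by
    have hint (x : ℝ) : Integrable (fun y => gaussianPDFReal 0 (v n) (x - y)) μ := by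
      rw [← charFunInv_charFun_gaussianReal (hv n)]
      refine .of_bound (C := (2 * π)⁻¹ * ∫ ξ, ‖charFun (gaussianReal 0 (v n)) ξ‖) ?_ ?_
      · exact ((continuous_charFunInv (integrable_charFun_gaussianReal (hv n))).comp
          (by fun_prop)).aestronglyMeasurable
      · exact .of_forall fun y => abs_charFunInv_le _ _
    simp_rw [charFunInv_charFun_mul_gaussianReal μ (hv n), fun x =>
      ofReal_integral_eq_lintegral_ofReal (hint x)
        (.of_forall fun _ => gaussianPDFReal_nonneg _ _ _)]
    have hmeas : Measurable fun z : ℝ × ℝ => gaussianPDFReal 0 (v n) (z.1 - z.2) :=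
      (measurable_gaussianPDFReal 0 (v n)).comp (by fun_prop)
    rw [lintegral_lintegral_swap hmeas.ennreal_ofReal.aemeasurable]
    have hshift (y : ℝ) : ∫⁻ x, ENNReal.ofReal (gaussianPDFReal 0 (v n) (x - y)) = 1 :=
      (lintegral_sub_right_eq_self (fun x => ENNReal.ofReal (gaussianPDFReal 0 (v n) x)) y).trans
        (lintegral_gaussianPDFReal_eq_one 0 (hv n))
    simp_rw [hshift, lintegral_one]
  calc ∫⁻ x, ENNReal.ofReal (charFunInv (charFun μ) x)
      = ∫⁻ x, liminf (fun n => ENNReal.ofReal (charFunInv (fun ξ => charFun μ ξ *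
          charFun (gaussianReal 0 (v n)) ξ) x)) atTop :=
        lintegral_congr fun x => (hlim x).liminf_eq.symm
    _ ≤ liminf (fun n => ∫⁻ x, ENNReal.ofReal (charFunInv (fun ξ => charFun μ ξ *
          charFun (gaussianReal 0 (v n)) ξ) x)) atTop := by
        refine lintegral_liminf_le fun n => ?_
        refine (continuous_charFunInv ?_).measurable.ennreal_ofReal
        exact (integrable_charFun_gaussianReal (hv n)).bdd_mul (c := μ.real univ)
          measurable_charFun.aestronglyMeasurable (.of_forall fun ξ => norm_charFun_le ξ)
    _ = μ univ := by simp_rw [hmass, liminf_const]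

theorem integrable_charFunInv_charFun {μ : Measure ℝ} [IsFiniteMeasure μ]
    (hμ : Integrable (charFun μ)) : Integrable (charFunInv (charFun μ)) := by
  refine ⟨(continuous_charFunInv hμ).aestronglyMeasurable, ?_⟩
  rw [hasFiniteIntegral_iff_ofReal (.of_forall (charFunInv_charFun_nonneg hμ))]
  exact (lintegral_charFunInv_charFun_le hμ).trans_lt (measure_lt_top _ _)

theorem ofReal_charFunInv_charFun (μ : Measure ℝ) (x : ℝ) :
    (charFunInv (charFun μ) x : ℂ) = 𝓕 (fun ξ : ℝ => charFun μ (2 * π * ξ)) x := by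
  rw [charFunInv_eq_fourier_re]
  refine Complex.conj_eq_iff_re.1 ?_
  rw [fourier_real_eq_integral_exp_smul, ← integral_conj, ← integral_neg_eq_self]
  refine integral_congr_ae (.of_forall fun ξ => ?_)
  beta_reduce
  rw [smul_eq_mul, smul_eq_mul, map_mul, ← Complex.exp_conj, ← charFun_neg, map_mul,
    Complex.conj_ofReal, Complex.conj_I]
  congr 2
  · push_cast
    ring
  · ring

theorem withDensity_charFunInv_charFun {μ : Measure ℝ} [IsFiniteMeasure μ]
    (hμ : Integrable (charFun μ)) :
    volume.withDensity (fun x => ENNReal.ofReal (charFunInv (charFun μ) x)) = μ := by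
  have hint := integrable_charFunInv_charFun hμ
  have := isFiniteMeasure_withDensity_ofReal hint.2
  refine Measure.ext_of_charFun (funext fun ξ => ?_)
  set g : ℝ → ℂ := fun ξ => charFun μ (2 * π * ξ)
  have hg : Continuous g := continuous_charFun.comp (by fun_prop)
  have hgF : 𝓕 g = fun x => (charFunInv (charFun μ) x : ℂ) :=
    funext fun x => (ofReal_charFunInv_charFun μ x).symm
  have hinv := congrFun (hg.fourierInv_fourier_eq (hμ.comp_mul_left' (by positivity))
    (hgF ▸ hint.ofReal)) (ξ / (2 * π))
  rw [hgF, fourierInv_eq'] at hinv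
  rw [charFun_apply_real, integral_withDensity_eq_integral_toReal_smul
    (continuous_charFunInv hμ).measurable.ennreal_ofReal (by simp)]
  have hgξ : g (ξ / (2 * π)) = charFun μ ξ := by
    simp only [g, mul_div_cancel₀ ξ (by positivity : 2 * π ≠ 0)]
  rw [← hgξ, ← hinv]
  refine integral_congr_ae (.of_forall fun x => ?_)
  beta_reduce
  rw [ENNReal.toReal_ofReal (charFunInv_charFun_nonneg hμ x), Complex.real_smul, smul_eq_mul,
    mul_comm, real_inner_eq_re_inner]
  congr 3
  simp
  field_simp

end

/-! ### Resolvent families -/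

/-- `U q`, `q > 0`, are finite measures whose characteristic functions `1 / (q + Ψ)` are
integrable: the `q`-resolvent measures of a Lévy process with characteristic exponent `Ψ`. -/
structure ResolventFamily (Ψ : ℝ → ℂ) (U : ℝ → Measure ℝ) : Prop where
  re_nonneg : ∀ ξ, 0 ≤ (Ψ ξ).re
  zero : Ψ 0 = 0
  finite : ∀ q, 0 < q → IsFiniteMeasure (U q)
  charFun_eq : ∀ q, 0 < q → ∀ ξ, charFun (U q) ξ = ((q : ℂ) + Ψ ξ)⁻¹
  integrable_inv : ∀ q : ℝ, 0 < q → Integrable fun ξ => ((q : ℂ) + Ψ ξ)⁻¹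

/-- The continuous density of the `q`-resolvent measure with exponent `Ψ`. -/
noncomputable def resolventKernel (Ψ : ℝ → ℂ) (q : ℝ) : ℝ → ℝ :=
  charFunInv fun ξ => ((q : ℂ) + Ψ ξ)⁻¹

theorem integrable_integral_sub_right (μ : Measure ℝ) [IsFiniteMeasure μ] {g : ℝ → ℝ}
    (hg : Integrable g) : Integrable fun x => ∫ y, g (x - y) ∂μ := by
  simpa using (Integrable.convolution_integrand (ContinuousLinearMap.mul ℝ ℝ)
    (integrable_const (1 : ℝ) (μ := μ)) hg).integral_prod_left

theorem integral_integral_sub_right (μ : Measure ℝ) [IsFiniteMeasure μ] {g : ℝ → ℝ}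
    (hg : Integrable g) : ∫ x, ∫ y, g (x - y) ∂μ = μ.real univ * ∫ x, g x := by
  simpa [convolution] using integral_convolution (ContinuousLinearMap.mul ℝ ℝ)
    (integrable_const (1 : ℝ) (μ := μ)) hg

theorem two_mul_mul_integral_sub_le (μ : Measure ℝ) [IsFiniteMeasure μ] {v : ℝ → ℝ}
    (hv : Continuous v) {C : ℝ} (hC : ∀ x, |v x| ≤ C) (x : ℝ) :
    2 * (v x * ∫ y, v (x - y) ∂μ) ≤ μ.real univ * v x ^ 2 + ∫ y, v (x - y) ^ 2 ∂μ := by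
  have hint : Integrable (fun y => v (x - y)) μ :=
    .of_bound (by fun_prop) C (.of_forall fun y => hC _)
  have hint2 : Integrable (fun y => v (x - y) ^ 2) μ :=
    .of_bound (by fun_prop) (C ^ 2) (.of_forall fun y => by
      rw [norm_pow]
      exact pow_le_pow_left₀ (norm_nonneg _) (hC _) 2)
  calc 2 * (v x * ∫ y, v (x - y) ∂μ) = ∫ y, 2 * v x * v (x - y) ∂μ := by
        rw [integral_const_mul, mul_assoc]
    _ ≤ ∫ y, (v x ^ 2 + v (x - y) ^ 2) ∂μ :=
        integral_mono (hint.const_mul _) ((integrable_const _).add hint2)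
          fun y => two_mul_le_add_sq (v x) (v (x - y))
    _ = μ.real univ * v x ^ 2 + ∫ y, v (x - y) ^ 2 ∂μ := by
        rw [integral_add (integrable_const _) hint2, integral_const, smul_eq_mul]

theorem abs_negPart_le_abs (a : ℝ) : |a⁻| ≤ |a| := by
  rw [abs_of_nonneg (negPart_nonneg a)]
  exact max_le (neg_le_abs a) (abs_nonneg a)

theorem negPart_mul_self (a : ℝ) : a⁻ * a = -a⁻ ^ 2 := by
  rcases le_total a 0 with ha | ha
  · rw [negPart_eq_neg.2 ha]
    ring
  · simp [negPart_eq_zero.2 ha]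

theorem continuous_negPart {u : ℝ → ℝ} (hu : Continuous u) : Continuous fun x => (u x)⁻ :=
  hu.neg.max continuous_const

theorem integrable_negPart_sq {u : ℝ → ℝ} (hu : Continuous u) (hui : Integrable u) {C : ℝ}
    (hC : ∀ x, |u x| ≤ C) : Integrable fun x => (u x)⁻ ^ 2 := by
  simp_rw [sq]
  exact hui.neg_part.bdd_mul (continuous_negPart hu).aestronglyMeasurable
    (.of_forall fun x => (abs_negPart_le_abs _).trans (hC x))

theorem nonneg_of_integral_negPart_sq_nonpos {u : ℝ → ℝ} (hu : Continuous u)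
    (hint : Integrable fun x => (u x)⁻ ^ 2) (h : ∫ x, (u x)⁻ ^ 2 ≤ 0) (x : ℝ) : 0 ≤ u x := by
  have hae := (integral_eq_zero_iff_of_nonneg (fun x => sq_nonneg (u x)⁻) hint).1
    (h.antisymm (integral_nonneg fun x => sq_nonneg _))
  have hx : (u x)⁻ ^ 2 = 0 := congrFun
    ((((continuous_negPart hu).pow 2).ae_eq_iff_eq volume continuous_zero).1 hae) x
  exact negPart_eq_zero.1 ((pow_eq_zero_iff two_ne_zero).1 hx)

/-- An energy form of the maximum principle: test the hypothesis with the negative part `v` of `u`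
and use `2 v(x) v(x - y) ≤ v(x)² + v(x - y)²`. -/
theorem integral_negPart_sq_le (μ : Measure ℝ) [IsFiniteMeasure μ] {u g : ℝ → ℝ}
    (hu : Continuous u) (hui : Integrable u) {C : ℝ} (hC : ∀ x, |u x| ≤ C) (hg : Integrable g)
    {b : ℝ} (hb : 0 ≤ b) (h : ∀ x, b * ∫ y, u (x - y) ∂μ ≤ u x + g x) :
    (1 - b * μ.real univ) * ∫ x, (u x)⁻ ^ 2 ≤ ∫ x, (u x)⁻ * g x := by
  set v : ℝ → ℝ := fun x => (u x)⁻
  have hv : Continuous v := continuous_negPart hu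
  have hvC (x : ℝ) : |v x| ≤ C := (abs_negPart_le_abs _).trans (hC x)
  have hv2 : Integrable fun x => v x ^ 2 := integrable_negPart_sq hu hui hC
  have hvg : Integrable fun x => v x * g x :=
    hg.bdd_mul hv.aestronglyMeasurable (.of_forall hvC)
  have hconv := integrable_integral_sub_right μ hv2
  have hsum := ((hv2.const_mul (μ.real univ)).add hconv).const_mul (b / 2)
  have hpt (x : ℝ) : v x ^ 2 ≤
      b / 2 * (μ.real univ * v x ^ 2 + ∫ y, v (x - y) ^ 2 ∂μ) + v x * g x := by
    have hneg : -∫ y, v (x - y) ∂μ ≤ ∫ y, u (x - y) ∂μ := by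
      rw [← integral_neg]
      refine integral_mono (.of_bound (by fun_prop) C (.of_forall fun y => ?_))
        (.of_bound (by fun_prop) C (.of_forall fun y => hC _)) fun y => neg_le.1 (neg_le_negPart _)
      rw [norm_neg]
      exact hvC _
    have hx := mul_le_mul_of_nonneg_left
      ((mul_le_mul_of_nonneg_left hneg hb).trans (h x)) (negPart_nonneg (u x))
    linear_combination hx + negPart_mul_self (u x) + b / 2 * two_mul_mul_integral_sub_le μ hv hvC x
  have hint := integral_mono hv2 (hsum.add hvg) hpt
  simp only [Pi.add_apply] at hint hsum
  rw [integral_add hsum hvg, integral_const_mul, integral_add (hv2.const_mul _) hconv,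
    integral_const_mul, integral_integral_sub_right μ hv2] at hint
  linear_combination hint

namespace ResolventFamily

variable {Ψ : ℝ → ℂ} {U : ℝ → Measure ℝ} {p q : ℝ}

theorem le_norm_add (S : ResolventFamily Ψ U) (q ξ : ℝ) : q ≤ ‖(q : ℂ) + Ψ ξ‖ := by
  refine le_trans ?_ (Complex.re_le_norm _)
  simpa using S.re_nonneg ξ

theorem add_ne_zero (S : ResolventFamily Ψ U) (hq : 0 < q) (ξ : ℝ) : (q : ℂ) + Ψ ξ ≠ 0 :=
  norm_pos_iff.1 (hq.trans_le (S.le_norm_add q ξ))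

theorem norm_le_norm_add (S : ResolventFamily Ψ U) (hq : 0 ≤ q) (ξ : ℝ) :
    ‖Ψ ξ‖ ≤ ‖(q : ℂ) + Ψ ξ‖ := by
  refine le_of_sq_le_sq ?_ (norm_nonneg _)
  rw [Complex.sq_norm, Complex.sq_norm, Complex.normSq_apply, Complex.normSq_apply]
  simp only [Complex.add_re, Complex.ofReal_re, Complex.add_im, Complex.ofReal_im, zero_add]
  nlinarith [S.re_nonneg ξ]

theorem charFun_eq_inv (S : ResolventFamily Ψ U) (hq : 0 < q) :
    charFun (U q) = fun ξ => ((q : ℂ) + Ψ ξ)⁻¹ := funext (S.charFun_eq q hq)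

theorem integrable_charFun (S : ResolventFamily Ψ U) (hq : 0 < q) :
    Integrable (charFun (U q)) := by
  rw [S.charFun_eq_inv hq]
  exact S.integrable_inv q hq

theorem kernel_eq (S : ResolventFamily Ψ U) (hq : 0 < q) :
    resolventKernel Ψ q = charFunInv (charFun (U q)) := by
  rw [S.charFun_eq_inv hq, resolventKernel]

theorem continuous_kernel (S : ResolventFamily Ψ U) (hq : 0 < q) :
    Continuous (resolventKernel Ψ q) := continuous_charFunInv (S.integrable_inv q hq)

theorem kernel_nonneg (S : ResolventFamily Ψ U) (hq : 0 < q) (x : ℝ) :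
    0 ≤ resolventKernel Ψ q x := by
  have := S.finite q hq
  rw [S.kernel_eq hq]
  exact charFunInv_charFun_nonneg (S.integrable_charFun hq) x

theorem integrable_kernel (S : ResolventFamily Ψ U) (hq : 0 < q) :
    Integrable (resolventKernel Ψ q) := by
  have := S.finite q hq
  rw [S.kernel_eq hq]
  exact integrable_charFunInv_charFun (S.integrable_charFun hq)

theorem withDensity_kernel (S : ResolventFamily Ψ U) (hq : 0 < q) :
    volume.withDensity (fun x => ENNReal.ofReal (resolventKernel Ψ q x)) = U q := by
  have := S.finite q hq
  rw [S.kernel_eq hq]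
  exact withDensity_charFunInv_charFun (S.integrable_charFun hq)

theorem integral_eq_integral_mul_kernel (S : ResolventFamily Ψ U) (hq : 0 < q)
    (f : ℝ → ℝ) : ∫ x, f x ∂(U q) = ∫ x, f x * resolventKernel Ψ q x := by
  rw [← S.withDensity_kernel hq, integral_withDensity_eq_integral_toReal_smul
    (S.continuous_kernel hq).measurable.ennreal_ofReal (by simp)]
  simp only [smul_eq_mul, ENNReal.toReal_ofReal (S.kernel_nonneg hq _), mul_comm]

theorem measureReal_univ (S : ResolventFamily Ψ U) (hq : 0 < q) : (U q).real univ = q⁻¹ := by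
  have h := S.charFun_eq q hq 0
  rw [charFun_zero, S.zero, add_zero, ← Complex.ofReal_inv] at h
  exact_mod_cast h

theorem integral_kernel_sub (S : ResolventFamily Ψ U) (hp : 0 < p) (hq : 0 < q) (x : ℝ) :
    ∫ y, resolventKernel Ψ q (x - y) ∂(U p) =
      charFunInv (fun ξ => ((p : ℂ) + Ψ ξ)⁻¹ * ((q : ℂ) + Ψ ξ)⁻¹) x := by
  have := S.finite p hp
  rw [resolventKernel, integral_charFunInv_sub _ (S.integrable_inv q hq), S.charFun_eq_inv hp]

theorem resolvent_equation (S : ResolventFamily Ψ U) (hp : 0 < p) (hq : 0 < q) (x : ℝ) :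
    resolventKernel Ψ q x - resolventKernel Ψ p x =
      (p - q) * ∫ y, resolventKernel Ψ q (x - y) ∂(U p) := by
  rw [S.integral_kernel_sub hp hq, ← charFunInv_const_mul, resolventKernel, resolventKernel,
    ← charFunInv_sub (S.integrable_inv q hq) (S.integrable_inv p hp)]
  congr 1 with ξ
  have h1 := S.add_ne_zero hq ξ
  have h2 := S.add_ne_zero hp ξ
  push_cast
  field_simp
  ring

theorem tendsto_mul_integral_resolvent (S : ResolventFamily Ψ U) {f : ℝ → ℝ} (hf : Continuous f)
    {C : ℝ} (hC : ∀ x, |f x| ≤ C) :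
    Tendsto (fun n : ℕ => ((n : ℝ) + 1) * ∫ y, f y ∂(U (n + 1))) atTop (𝓝 (f 0)) := by
  have hpos (n : ℕ) : 0 < (n : ℝ) + 1 := by positivity
  have hprob (n : ℕ) : IsProbabilityMeasure (ENNReal.ofReal ((n : ℝ) + 1) • U (n + 1)) := by
    have := S.finite _ (hpos n)
    constructor
    rw [Measure.smul_apply, smul_eq_mul, ← ofReal_measureReal, S.measureReal_univ (hpos n),
      ← ENNReal.ofReal_mul (hpos n).le, mul_inv_cancel₀ (hpos n).ne', ENNReal.ofReal_one]
  set ν : ℕ → ProbabilityMeasure ℝ := fun n => ⟨_, hprob n⟩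
  have hcharFun (n : ℕ) (ξ : ℝ) :
      charFun (ν n : Measure ℝ) ξ = (1 + Ψ ξ * ((n : ℂ) + 1)⁻¹)⁻¹ := by
    have h := S.charFun_eq _ (hpos n) ξ
    have hn : ((n : ℂ) + 1) ≠ 0 := by exact_mod_cast (hpos n).ne'
    have h2 := S.add_ne_zero (hpos n) ξ
    push_cast at h h2
    rw [charFun_apply_real] at h ⊢
    simp only [ν, ProbabilityMeasure.coe_mk, integral_smul_measure]
    rw [h, ENNReal.toReal_ofReal (hpos n).le, Complex.real_smul]
    push_cast
    rw [← div_eq_mul_inv, ← div_eq_mul_inv, one_add_div hn, inv_div]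
  have hlim : Tendsto ν atTop (𝓝 ⟨Measure.dirac 0, inferInstance⟩) := by
    refine ProbabilityMeasure.tendsto_iff_tendsto_charFun.2 fun ξ => ?_
    simp_rw [hcharFun]
    have hn : Tendsto (fun n : ℕ => ((n : ℂ) + 1)⁻¹) atTop (𝓝 0) := by
      simpa using tendsto_one_div_add_atTop_nhds_zero_nat (𝕜 := ℂ)
    simpa [charFun_dirac] using ((hn.const_mul (Ψ ξ)).const_add 1).inv₀ (by simp)
  have h := ProbabilityMeasure.tendsto_iff_forall_integral_tendsto.1 hlim
    (.ofNormedAddCommGroup f hf C hC)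
  simpa [ν, integral_smul_measure, ENNReal.toReal_ofReal (hpos _).le] using h

theorem kernel_le_iSup (Ψ : ℝ → ℂ) (q x : ℝ) :
    resolventKernel Ψ q x ≤ ⨆ a, resolventKernel Ψ q a := by
  refine le_ciSup (f := resolventKernel Ψ q) ⟨(2 * π)⁻¹ * ∫ ξ, ‖((q : ℂ) + Ψ ξ)⁻¹‖, ?_⟩ x
  rintro _ ⟨a, rfl⟩
  exact (le_abs_self _).trans (abs_charFunInv_le _ a)

theorem abs_kernel_le (S : ResolventFamily Ψ U) (hq : 0 < q) (x : ℝ) :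
    |resolventKernel Ψ q x| ≤ ⨆ a, resolventKernel Ψ q a := by
  rw [abs_of_nonneg (S.kernel_nonneg hq x)]
  exact kernel_le_iSup Ψ q x

/-- The function `x ↦ r(0) r(x + a) - r(a) r(x)` with `r = resolventKernel Ψ q`. It is the
difference of the `q`-potentials of the measures `r(0) δ_{-a}` and `r(a) δ_0` and vanishes at `0`,
the only point charged by the second one; hence the energy form of the maximum principle applies
to it. -/
noncomputable def kernelDefect (Ψ : ℝ → ℂ) (q a x : ℝ) : ℝ :=
  resolventKernel Ψ q 0 * resolventKernel Ψ q (x + a) -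
    resolventKernel Ψ q a * resolventKernel Ψ q x

theorem continuous_kernelDefect (S : ResolventFamily Ψ U) (hq : 0 < q) (a : ℝ) :
    Continuous (kernelDefect Ψ q a) := by
  have := S.continuous_kernel hq
  unfold kernelDefect
  fun_prop

theorem integrable_kernelDefect (S : ResolventFamily Ψ U) (hq : 0 < q) (a : ℝ) :
    Integrable (kernelDefect Ψ q a) :=
  (((S.integrable_kernel hq).comp_add_right a).const_mul _).sub
    ((S.integrable_kernel hq).const_mul _)

theorem abs_kernelDefect_le (S : ResolventFamily Ψ U) (hq : 0 < q) (a x : ℝ) :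
    |kernelDefect Ψ q a x| ≤
      (resolventKernel Ψ q 0 + resolventKernel Ψ q a) * ⨆ b, resolventKernel Ψ q b := by
  rw [add_mul]
  refine (abs_sub _ _).trans (add_le_add ?_ ?_) <;>
    rw [abs_mul, abs_of_nonneg (S.kernel_nonneg hq _)] <;>
    exact mul_le_mul_of_nonneg_left (S.abs_kernel_le hq _) (S.kernel_nonneg hq _)

theorem mul_integral_negPart_kernelDefect_sq_le (S : ResolventFamily Ψ U) (hq : 0 < q)
    (hqp : q < p) (a : ℝ) :
    q * ∫ x, (kernelDefect Ψ q a x)⁻ ^ 2 ≤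
      resolventKernel Ψ q a * (p * ∫ x, (kernelDefect Ψ q a x)⁻ ∂(U p)) := by
  have hp := hq.trans hqp
  have := S.finite p hp
  have hr := S.continuous_kernel hq
  have hint (b : ℝ) : Integrable (fun y => resolventKernel Ψ q (b - y)) (U p) :=
    .of_bound (by fun_prop) _ (.of_forall fun y => S.abs_kernel_le hq (b - y))
  have henergy := integral_negPart_sq_le (U p) (S.continuous_kernelDefect hq a)
    (S.integrable_kernelDefect hq a) (S.abs_kernelDefect_le hq a)
    ((S.integrable_kernel hp).const_mul (resolventKernel Ψ q a)) (sub_pos.2 hqp).le fun x => by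
      simp only [kernelDefect, sub_add_eq_add_sub]
      rw [integral_sub ((hint _).const_mul _) ((hint _).const_mul _), integral_const_mul,
        integral_const_mul]
      linear_combination
        mul_nonneg (S.kernel_nonneg hq 0) (S.kernel_nonneg hp (x + a)) +
          resolventKernel Ψ q a * S.resolvent_equation hp hq x -
          resolventKernel Ψ q 0 * S.resolvent_equation hp hq (x + a)
  simp_rw [mul_left_comm _ (resolventKernel Ψ q a)] at henergy
  rw [integral_const_mul, ← S.integral_eq_integral_mul_kernel hp, S.measureReal_univ hp]
    at henergy
  have hmul := mul_le_mul_of_nonneg_left henergy hp.le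
  field_simp at hmul
  linear_combination hmul

theorem kernel_mul_kernel_le (S : ResolventFamily Ψ U) (hq : 0 < q) (x a : ℝ) :
    resolventKernel Ψ q a * resolventKernel Ψ q x ≤
      resolventKernel Ψ q 0 * resolventKernel Ψ q (x + a) := by
  have hcont := S.continuous_kernelDefect hq a
  have hbound := S.abs_kernelDefect_le hq a
  have hzero : (kernelDefect Ψ q a 0)⁻ = 0 := by simp [kernelDefect, mul_comm]
  -- As `p → ∞` the measures `p U p` tend to the Dirac mass at `0`, where the defect vanishes.
  have hsq : q * ∫ x, (kernelDefect Ψ q a x)⁻ ^ 2 ≤ 0 := by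
    rw [← mul_zero (resolventKernel Ψ q a), ← hzero]
    refine ge_of_tendsto ((S.tendsto_mul_integral_resolvent (continuous_negPart hcont)
      fun x => (abs_negPart_le_abs _).trans (hbound x)).const_mul (resolventKernel Ψ q a)) ?_
    filter_upwards [(tendsto_natCast_atTop_atTop (R := ℝ)).eventually_gt_atTop q] with n hn
    exact S.mul_integral_negPart_kernelDefect_sq_le hq (by linarith) a
  exact sub_nonneg.1 (nonneg_of_integral_negPart_sq_nonpos hcont
    (integrable_negPart_sq hcont (S.integrable_kernelDefect hq a) hbound)
    (nonpos_of_mul_nonpos_right hsq hq) x)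

theorem kernel_le_kernel_zero (S : ResolventFamily Ψ U) (hq : 0 < q) (x : ℝ) :
    resolventKernel Ψ q x ≤ resolventKernel Ψ q 0 := by
  set M := ⨆ a, resolventKernel Ψ q a
  have h0 := S.kernel_nonneg hq
  by_contra! hlt
  have hx : 0 < resolventKernel Ψ q x := (h0 0).trans_lt hlt
  have hM : M ≤ resolventKernel Ψ q 0 * M / resolventKernel Ψ q x := by
    refine ciSup_le fun a => ?_
    rw [le_div_iff₀ hx]
    exact (S.kernel_mul_kernel_le hq x a).trans
      (mul_le_mul_of_nonneg_left (kernel_le_iSup Ψ q _) (h0 0))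
  rw [le_div_iff₀ hx, mul_comm] at hM
  exact hlt.not_ge (le_of_mul_le_mul_right hM (hx.trans_le (kernel_le_iSup Ψ q x)))

theorem kernel_zero_pos (S : ResolventFamily Ψ U) (hq : 0 < q) : 0 < resolventKernel Ψ q 0 := by
  refine (S.kernel_nonneg hq 0).lt_of_ne' fun h0 => ?_
  have hzero (x : ℝ) : resolventKernel Ψ q x = 0 :=
    le_antisymm (h0 ▸ S.kernel_le_kernel_zero hq x) (S.kernel_nonneg hq x)
  have h := S.integral_eq_integral_mul_kernel hq fun _ => 1
  simp only [hzero, mul_zero, integral_zero, integral_const, smul_eq_mul, mul_one,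
    S.measureReal_univ hq] at h
  exact (inv_pos.2 hq).ne' h

theorem kernel_add_kernel_le (S : ResolventFamily Ψ U) (hq : 0 < q) (x y : ℝ) :
    resolventKernel Ψ q x + resolventKernel Ψ q y ≤
      resolventKernel Ψ q 0 + resolventKernel Ψ q (x + y) := by
  have hmul := S.kernel_mul_kernel_le hq x y
  have hprod := mul_nonneg (sub_nonneg.2 (S.kernel_le_kernel_zero hq x))
    (sub_nonneg.2 (S.kernel_le_kernel_zero hq y))
  refine le_of_mul_le_mul_left ?_ (S.kernel_zero_pos hq)
  linarith

end ResolventFamily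

/-! ### Asymptotically additive families -/

/-- The functions `k i` become additive in the limit along `l`. -/
def AsymptoticallyAdditive {ι : Type*} (k : ι → ℝ → ℝ) (l : Filter ι) : Prop :=
  ∀ x z, Tendsto (fun i => k i (x + z) - k i x - k i z) l (𝓝 0)

namespace AsymptoticallyAdditive

variable {ι : Type*} {l : Filter ι} {k : ι → ℝ → ℝ}

theorem sub_nsmul (hk : AsymptoticallyAdditive k l) (n : ℕ) (x : ℝ) :
    Tendsto (fun i => k i (n * x) - n * k i x) l (𝓝 0) := by
  induction n with
  | zero => simpa using (hk 0 0).neg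
  | succ n ih =>
    refine ((hk (n * x) x).add ih).congr' (.of_forall fun i => ?_) |>.trans (by simp)
    push_cast
    rw [add_one_mul, add_one_mul]
    ring

theorem sub_zsmul (hk : AsymptoticallyAdditive k l) (n : ℤ) (x : ℝ) :
    Tendsto (fun i => k i (n * x) - n * k i x) l (𝓝 0) := by
  obtain ⟨n, rfl | rfl⟩ := n.eq_nat_or_neg
  · simpa only [Int.cast_natCast] using hk.sub_nsmul n x
  · have hneg := ((hk (n * x) (-n * x)).add (hk.sub_nsmul n x)).sub (hk.sub_nsmul 0 x)
    simp only [add_zero, sub_zero] at hneg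
    refine (hneg.neg.congr fun i => ?_).trans (by simp)
    push_cast
    ring_nf

theorem tendsto_zero (hk : AsymptoticallyAdditive k l) {x : ℝ} {K : ℕ → ℝ}
    (hK : Tendsto (fun n : ℕ => K n / n) atTop (𝓝 0))
    (hle : ∀ n : ℕ, ∀ᶠ i in l, |k i (n * x)| ≤ K n) :
    Tendsto (fun i => k i x) l (𝓝 0) := by
  refine Metric.tendsto_nhds.2 fun ε hε => ?_
  obtain ⟨n, hKn, hn⟩ := ((hK.eventually_lt_const (half_pos hε)).and (eventually_gt_atTop 0)).exists
  have hn' : (0 : ℝ) < n := by exact_mod_cast hn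
  have hadd := Metric.tendsto_nhds.1 (hk.sub_nsmul n x) (n * (ε / 2)) (by positivity)
  filter_upwards [hle n, hadd] with i hi hi'
  rw [dist_zero_right, norm_eq_abs] at hi' ⊢
  rw [div_lt_iff₀ hn'] at hKn
  have h := abs_sub_abs_le_abs_sub (n * k i x) (k i (n * x))
  rw [abs_sub_comm, abs_mul, abs_of_pos hn'] at h
  refine lt_of_mul_lt_mul_left ?_ hn'.le
  linarith

theorem sub_mul_one (hk : AsymptoticallyAdditive k l) :
    AsymptoticallyAdditive (fun i x => k i x - x * k i 1) l := fun x z =>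
  (hk x z).congr fun i => by ring

theorem tendsto_sub_mul_one (hk : AsymptoticallyAdditive k l) {w : ℝ → ℝ}
    (hle : ∀ x, ∀ᶠ i in l, |k i x| ≤ w x) {C : ℝ} (hC : ∀ x, |x| ≤ 1 → w x ≤ C) (x : ℝ) :
    Tendsto (fun i => k i x - x * k i 1) l (𝓝 0) := by
  have he := hk.sub_mul_one
  have hK : Tendsto (fun n : ℕ => (2 * C + 1) / (n : ℝ)) atTop (𝓝 0) :=
    tendsto_const_nhds.div_atTop tendsto_natCast_atTop_atTop
  refine he.tendsto_zero (K := fun _ => 2 * C + 1) hK fun n => ?_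
  set m : ℤ := round (n * x)
  set s : ℝ := n * x - m
  have hs : |s| ≤ 1 := (abs_sub_round _).trans (by norm_num)
  have hm : Tendsto (fun i => k i m - m * k i 1) l (𝓝 0) := by
    simpa only [mul_one] using hk.sub_zsmul m 1
  have hadd := (he s m).add hm
  rw [sub_add_cancel, add_zero] at hadd
  filter_upwards [hle s, hle 1, Metric.tendsto_nhds.1 hadd 1 one_pos] with i his hi1 hi
  rw [dist_zero_right, norm_eq_abs, sub_add_cancel] at hi
  have hfrac : |k i s - s * k i 1| ≤ 2 * C :=
    calc |k i s - s * k i 1| ≤ |k i s| + |s| * |k i 1| := by rw [← abs_mul]; exact abs_sub _ _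
      _ ≤ C + 1 * C := by
        gcongr
        exacts [his.trans (hC s hs), hi1.trans (hC 1 (by simp))]
      _ = 2 * C := by ring
  linarith [abs_sub_abs_le_abs_sub (k i (n * x) - n * x * k i 1) (k i s - s * k i 1)]

end AsymptoticallyAdditive

/-! ### Characteristic functions near the origin -/

/-- The Fourier multiplier of the difference operator `f ↦ f (· - x) - f`. -/
noncomputable def expSubOne (x ξ : ℝ) : ℂ := Complex.exp ((ξ * x : ℝ) * Complex.I) - 1

@[fun_prop]
theorem continuous_expSubOne (x : ℝ) : Continuous (expSubOne x) := by
  unfold expSubOne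
  fun_prop

theorem norm_expSubOne_le_two (x ξ : ℝ) : ‖expSubOne x ξ‖ ≤ 2 := by
  refine (norm_sub_le _ _).trans_eq ?_
  rw [Complex.norm_exp_ofReal_mul_I, norm_one]
  norm_num

theorem norm_expSubOne_le_abs (x ξ : ℝ) : ‖expSubOne x ξ‖ ≤ |ξ * x| := by
  rw [expSubOne, mul_comm _ Complex.I]
  exact norm_exp_I_mul_ofReal_sub_one_le

theorem norm_expSubOne_sq (x ξ : ℝ) : ‖expSubOne x ξ‖ ^ 2 = 2 * (1 - cos (ξ * x)) := by
  rw [expSubOne, Complex.sq_norm, Complex.normSq_apply, Complex.sub_re, Complex.sub_im,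
    Complex.exp_ofReal_mul_I_re, Complex.exp_ofReal_mul_I_im, Complex.one_re, Complex.one_im]
  linear_combination sin_sq_add_cos_sq (ξ * x)

theorem norm_expSubOne_sq_le (x ξ : ℝ) : ‖expSubOne x ξ‖ ^ 2 ≤ (4 + x ^ 2) * min 1 (ξ ^ 2) := by
  have htwo : ‖expSubOne x ξ‖ ^ 2 ≤ 4 :=
    (pow_le_pow_left₀ (norm_nonneg _) (norm_expSubOne_le_two x ξ) 2).trans (by norm_num)
  have habs : ‖expSubOne x ξ‖ ^ 2 ≤ (ξ * x) ^ 2 := by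
    rw [← sq_abs (ξ * x)]
    exact pow_le_pow_left₀ (norm_nonneg _) (norm_expSubOne_le_abs x ξ) 2
  rcases le_total 1 (ξ ^ 2) with h | h
  · rw [min_eq_left h]
    nlinarith [sq_nonneg x]
  · rw [min_eq_right h]
    nlinarith [sq_nonneg ξ]

theorem integrable_expSubOne_mul {φ : ℝ → ℂ} (hφ : Integrable φ) (x : ℝ) :
    Integrable fun ξ => expSubOne x ξ * φ ξ :=
  hφ.bdd_mul (by fun_prop) (.of_forall (norm_expSubOne_le_two x))

theorem charFunInv_expSubOne_mul {φ : ℝ → ℂ} (hφ : Integrable φ) (x y : ℝ) :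
    charFunInv (fun ξ => expSubOne x ξ * φ ξ) y = charFunInv φ (y - x) - charFunInv φ y := by
  rw [sub_eq_neg_add y x, charFunInv_add_right, ← charFunInv_sub (integrable_exp_mul hφ _) hφ]
  congr 1 with ξ
  rw [expSubOne, sub_one_mul, mul_neg, Complex.ofReal_neg, neg_neg]

theorem sin_le_sub_cube {v : ℝ} (h0 : 0 ≤ v) (h1 : v ≤ 1) : sin v ≤ v - 3 / 20 * v ^ 3 := by
  have h := (abs_le.1 (sin_bound (abs_le.2 ⟨by linarith, h1⟩))).2
  rw [abs_of_nonneg h0] at h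
  linarith [pow_le_pow_of_le_one h0 h1 (show 3 ≤ 5 by norm_num), pow_nonneg h0 3]

theorem min_one_sq_le_one_sub_sinc (u : ℝ) : min 1 (u ^ 2) / 30 ≤ 1 - sinc u := by
  wlog hu : 0 ≤ u generalizing u
  · rw [← sinc_neg, ← neg_sq]
    exact this (-u) (by linarith)
  rcases hu.eq_or_lt with rfl | hpos
  · simp
  rw [sinc_of_ne_zero hpos.ne', le_sub_comm, div_le_iff₀ hpos]
  rcases le_or_gt u 2 with hle | hgt
  · have hsin : 0 ≤ sin (u / 2) :=
      sin_nonneg_of_nonneg_of_le_pi (by linarith) (by linarith [pi_gt_three])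
    have hdouble : sin u = 2 * sin (u / 2) * cos (u / 2) := by rw [← sin_two_mul]; ring_nf
    nlinarith [sin_le_sub_cube (half_pos hpos).le (by linarith), cos_le_one (u / 2),
      min_le_right 1 (u ^ 2), pow_pos hpos 3]
  · nlinarith [sin_le_one u, min_le_left 1 (u ^ 2)]

theorem integral_one_sub_cos_mul (δ ξ : ℝ) :
    ∫ x in (-δ)..δ, (1 - cos (ξ * x)) = 2 * δ * (1 - sinc (δ * ξ)) := by
  rcases eq_or_ne ξ 0 with rfl | hξ
  · simp
  rcases eq_or_ne δ 0 with rfl | hδ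
  · simp
  rw [intervalIntegral.integral_sub (by simp) (Continuous.intervalIntegrable (by fun_prop) _ _),
    intervalIntegral.integral_comp_mul_left _ hξ, integral_cos,
    sinc_of_ne_zero (mul_ne_zero hδ hξ)]
  simp only [intervalIntegral.integral_const, smul_eq_mul, mul_neg, sin_neg]
  rw [mul_comm δ ξ]
  field_simp
  ring

theorem exists_min_one_sq_le_mul_integral {r : ℝ → ℝ} (hr : Continuous r) (hnonneg : ∀ x, 0 ≤ r x)
    (hint : Integrable r) (hpos : 0 < r 0) :
    ∃ C, ∀ ξ : ℝ, min 1 (ξ ^ 2) ≤ C * ∫ x, (1 - cos (ξ * x)) * r x := by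
  obtain ⟨δ, hδ, hball⟩ := Metric.eventually_nhds_iff.1
    (hr.continuousAt.eventually (lt_mem_nhds (half_lt_self hpos)))
  obtain ⟨ε, hε, hε1, hεδ⟩ : ∃ ε : ℝ, 0 < ε ∧ ε ≤ 1 ∧ ε < δ :=
    ⟨min 1 (δ / 2), by positivity, min_le_left _ _, (min_le_right _ _).trans_lt (half_lt_self hδ)⟩
  have hmin (ξ : ℝ) : ε ^ 2 * min 1 (ξ ^ 2) ≤ min 1 ((ε * ξ) ^ 2) := by
    rw [mul_pow, mul_min_of_nonneg _ _ (sq_nonneg ε), mul_one]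
    exact min_le_min_right _ (pow_le_one₀ hε.le hε1)
  have hlower (ξ : ℝ) : r 0 / 2 * (2 * ε * (1 - sinc (ε * ξ))) ≤
      ∫ x, (1 - cos (ξ * x)) * r x := by
    have hcos (x : ℝ) : 0 ≤ 1 - cos (ξ * x) := sub_nonneg.2 (cos_le_one _)
    rw [← integral_one_sub_cos_mul, intervalIntegral.integral_of_le (by linarith),
      ← integral_const_mul]
    have hintξ : Integrable fun x => (1 - cos (ξ * x)) * r x :=
      hint.bdd_mul (c := 2) (by fun_prop) (.of_forall fun x => by
        rw [norm_of_nonneg (hcos x)]; linarith [neg_one_le_cos (ξ * x)])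
    refine le_trans (setIntegral_mono_on ?_ hintξ.integrableOn measurableSet_Ioc fun x hx => ?_)
      (setIntegral_le_integral hintξ (.of_forall fun x => mul_nonneg (hcos x) (hnonneg x)))
    · exact (Continuous.integrableOn_Icc (by fun_prop)).mono_set Ioc_subset_Icc_self
    · rw [mul_comm]
      refine mul_le_mul_of_nonneg_left (hball ?_).le (hcos x)
      rw [dist_zero_right, norm_eq_abs, abs_lt]
      exact ⟨by linarith [hx.1], hx.2.trans_lt hεδ⟩
  refine ⟨30 / (ε ^ 2 * (r 0 * ε)), fun ξ => ?_⟩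
  rw [div_mul_eq_mul_div, le_div_iff₀ (by positivity)]
  have h := mul_le_mul_of_nonneg_right ((hmin ξ).trans
    (by linarith [min_one_sq_le_one_sub_sinc (ε * ξ)] : _ ≤ 30 * (1 - sinc (ε * ξ))))
    (mul_pos hpos hε).le
  linarith [hlower ξ]

theorem integrable_cexp_mul_I (μ : Measure ℝ) [IsFiniteMeasure μ] (ξ : ℝ) :
    Integrable (fun x : ℝ => Complex.exp (ξ * x * Complex.I)) μ :=
  .of_bound (by fun_prop) 1 (.of_forall fun x => by
    rw [← Complex.ofReal_mul, Complex.norm_exp_ofReal_mul_I])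

theorem re_charFun (μ : Measure ℝ) [IsFiniteMeasure μ] (ξ : ℝ) :
    (charFun μ ξ).re = ∫ x, cos (ξ * x) ∂μ := by
  rw [charFun_apply_real]
  refine (integral_re (integrable_cexp_mul_I μ ξ)).symm.trans
    (integral_congr_ae (.of_forall fun x => ?_))
  simp only [RCLike.re_to_complex]
  rw [← Complex.ofReal_mul, Complex.exp_ofReal_mul_I_re]

theorem im_charFun (μ : Measure ℝ) [IsFiniteMeasure μ] (ξ : ℝ) :
    (charFun μ ξ).im = ∫ x, sin (ξ * x) ∂μ := by
  rw [charFun_apply_real]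
  refine (integral_im (integrable_cexp_mul_I μ ξ)).symm.trans
    (integral_congr_ae (.of_forall fun x => ?_))
  simp only [RCLike.im_to_complex]
  rw [← Complex.ofReal_mul, Complex.exp_ofReal_mul_I_im]

theorem integrable_one_sub_cos_mul (μ : Measure ℝ) [IsFiniteMeasure μ] (ξ : ℝ) :
    Integrable (fun x => 1 - cos (ξ * x)) μ :=
  (integrable_const 1).sub
    (.of_bound (by fun_prop) 1 (.of_forall fun x => abs_cos_le_one (ξ * x)))

theorem one_sub_re_charFun (μ : Measure ℝ) [IsProbabilityMeasure μ] (ξ : ℝ) :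
    1 - (charFun μ ξ).re = ∫ x, (1 - cos (ξ * x)) ∂μ := by
  rw [re_charFun, integral_sub (integrable_const 1)
    (.of_bound (by fun_prop) 1 (.of_forall fun x => abs_cos_le_one (ξ * x)))]
  simp

theorem two_mul_one_sub_cos_div_sq_le (ξ x : ℝ) : 2 * (1 - cos (ξ * x)) / ξ ^ 2 ≤ x ^ 2 := by
  rcases eq_or_ne ξ 0 with rfl | hξ
  · simp [sq_nonneg]
  rw [div_le_iff₀ (by positivity)]
  linarith [one_sub_sq_div_two_le_cos (x := ξ * x), mul_pow ξ x 2]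

theorem tendsto_two_mul_one_sub_cos_div_sq (x : ℝ) :
    Tendsto (fun ξ : ℝ => 2 * (1 - cos (ξ * x)) / ξ ^ 2) (𝓝[≠] 0) (𝓝 (x ^ 2)) := by
  have hsinc : Continuous fun ξ : ℝ => (x * sinc (ξ * x / 2)) ^ 2 := by fun_prop
  have hlim := hsinc.tendsto 0
  simp only [zero_mul, zero_div, sinc_zero, mul_one] at hlim
  refine (hlim.mono_left nhdsWithin_le_nhds).congr' ?_
  filter_upwards [self_mem_nhdsWithin] with ξ hξ
  rcases eq_or_ne x 0 with rfl | hx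
  · simp
  have hξ : ξ ≠ 0 := hξ
  rw [sinc_of_ne_zero (by simp [hξ, hx]), show cos (ξ * x) = 1 - 2 * sin (ξ * x / 2) ^ 2 by
    rw [sin_sq_eq_half_sub, mul_div_cancel₀ _ two_ne_zero]; ring]
  field_simp
  ring

/-- The second moment, finite or not, is read off from the characteristic function at the
origin. -/
theorem tendsto_two_mul_one_sub_re_charFun_div_sq (μ : Measure ℝ) [IsProbabilityMeasure μ] :
    Tendsto (fun ξ : ℝ => ENNReal.ofReal (2 * (1 - (charFun μ ξ).re) / ξ ^ 2)) (𝓝[≠] 0)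
      (𝓝 (∫⁻ x, ENNReal.ofReal (x ^ 2) ∂μ)) := by
  have heq (ξ : ℝ) : ENNReal.ofReal (2 * (1 - (charFun μ ξ).re) / ξ ^ 2) =
      ∫⁻ x, ENNReal.ofReal (2 * (1 - cos (ξ * x)) / ξ ^ 2) ∂μ := by
    rw [one_sub_re_charFun, ← integral_const_mul, ← integral_div,
      ofReal_integral_eq_lintegral_ofReal
        (((integrable_one_sub_cos_mul μ ξ).const_mul 2).div_const _)]
    exact .of_forall fun x => div_nonneg (by linarith [cos_le_one (ξ * x)]) (sq_nonneg ξ)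
  simp_rw [heq]
  refine tendsto_of_seq_tendsto fun u hu => tendsto_of_le_liminf_of_limsup_le ?_ ?_
  · refine le_trans (lintegral_mono fun x => ?_) (lintegral_liminf_le fun n => by fun_prop)
    exact ((ENNReal.continuous_ofReal.tendsto _).comp
      ((tendsto_two_mul_one_sub_cos_div_sq x).comp hu)).liminf_eq.ge
  · exact limsup_le_of_le (h := .of_forall fun n => lintegral_mono fun x =>
      ENNReal.ofReal_le_ofReal (two_mul_one_sub_cos_div_sq_le (u n) x))

theorem abs_sin_sub_self_div_cube_le (u : ℝ) : |(sin u - u) / u ^ 3| ≤ 4 * (1 + u ^ 2)⁻¹ := by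
  rcases eq_or_ne u 0 with rfl | hu
  · simp
  have hu' := abs_pos.2 hu
  rw [abs_div, abs_pow, div_le_iff₀ (by positivity), ← sq_abs u, mul_right_comm,
    ← div_eq_mul_inv, le_div_iff₀ (by positivity)]
  rcases le_or_gt |u| 1 with h | h
  · have hcube : |sin u - u| ≤ |u| ^ 3 := by
      have hsin := sin_bound h
      have hpow := pow_le_pow_of_le_one (abs_nonneg u) h (show 3 ≤ 5 by norm_num)
      have htri := abs_sub_abs_le_abs_sub (sin u - u) (-(u ^ 3 / 6))
      rw [abs_neg, abs_div, abs_pow, abs_of_pos (show (0 : ℝ) < 6 by norm_num),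
        show sin u - u - -(u ^ 3 / 6) = sin u - (u - u ^ 3 / 6) by ring] at htri
      linarith [pow_pos hu' 3]
    nlinarith [mul_le_mul hcube (by nlinarith : 1 + |u| ^ 2 ≤ 2) (by positivity) (by positivity),
      pow_pos hu' 3]
  · have hsin : |sin u - u| ≤ 2 * |u| := by
      linarith [abs_sub (sin u) u, abs_sin_le_one u]
    nlinarith [pow_pos hu' 3]

theorem integrable_im_charFun_div_cube {μ : Measure ℝ} [IsFiniteMeasure μ]
    (hsq : Integrable (fun x => x ^ 2) μ) (hmean : ∫ x, x ∂μ = 0) :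
    Integrable fun ξ : ℝ => (charFun μ ξ).im / ξ ^ 3 := by
  set g : ℝ → ℝ := fun u => (sin u - u) / u ^ 3
  have hg : Integrable g := (integrable_inv_one_add_sq.const_mul 4).mono'
    (by fun_prop) (.of_forall abs_sin_sub_self_div_cube_le)
  have hscale (x ξ : ℝ) : (sin (ξ * x) - ξ * x) / ξ ^ 3 = x ^ 3 * g (x * ξ) := by
    rcases eq_or_ne x 0 with rfl | hx
    · simp
    simp only [g]
    rw [mul_comm ξ x, mul_pow, mul_div_assoc', mul_div_mul_left _ _ (pow_ne_zero 3 hx)]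
  have hprod : Integrable (fun z : ℝ × ℝ => (sin (z.1 * z.2) - z.1 * z.2) / z.1 ^ 3)
      (volume.prod μ) := by
    refine (integrable_prod_iff' (Measurable.aestronglyMeasurable (by fun_prop))).2
      ⟨.of_forall fun x => ?_, ?_⟩
    · simp only [hscale]
      rcases eq_or_ne x 0 with rfl | hx
      · simp
      exact (hg.comp_mul_left' hx).const_mul _
    · refine (hsq.mul_const (∫ u, ‖g u‖)).congr (.of_forall fun x => ?_)
      simp only [hscale, norm_mul, integral_const_mul]
      rw [Measure.integral_comp_mul_left (fun u => ‖g u‖) x, smul_eq_mul, ← mul_assoc]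
      congr 1
      rcases eq_or_ne x 0 with rfl | hx
      · simp
      rw [norm_pow, norm_eq_abs, abs_inv, ← sq_abs, pow_succ _ 2, mul_inv_cancel_right₀ (by simpa)]
  refine hprod.integral_prod_left.congr (.of_forall fun ξ => ?_)
  have hid : Integrable (fun x : ℝ => ξ * x) μ :=
    (((memLp_two_iff_integrable_sq (by fun_prop)).2 hsq).integrable one_le_two).const_mul ξ
  dsimp only
  rw [integral_div, integral_sub
    (.of_bound (by fun_prop) 1 (.of_forall fun x => abs_sin_le_one (ξ * x))) hid,
    integral_const_mul, hmean, mul_zero, sub_zero, im_charFun]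

theorem integrable_sq_iff {μ : Measure ℝ} :
    Integrable (fun x => x ^ 2) μ ↔ ∫⁻ x, .ofReal (x ^ 2) ∂μ ≠ ∞ := by
  rw [← lt_top_iff_ne_top, ← hasFiniteIntegral_iff_ofReal (.of_forall fun x => sq_nonneg x)]
  exact and_iff_right (by fun_prop)

/-! ### The renormalized kernels -/

/-- The function `h_q(x) = r_q(0) - r_q(-x)`. -/
noncomputable def renormKernel (Ψ : ℝ → ℂ) (q x : ℝ) : ℝ :=
  resolventKernel Ψ q 0 - resolventKernel Ψ q (-x)

/-- The Fourier integral of `h_q(x) + h_q(-x)` at `q = 0`, with absolute values inside; it bounds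
the increments of `h_q` over shifts by `x` uniformly in `q`. -/
noncomputable def renormBound (Ψ : ℝ → ℂ) (x : ℝ) : ℝ :=
  (2 * π)⁻¹ * ∫ ξ, ‖expSubOne x ξ‖ ^ 2 * ‖Ψ ξ‖⁻¹

/-- The weight `min(1, ξ²) / |Ψ(ξ)|`, which controls all Fourier integrals at `q = 0`. -/
noncomputable def exponentWeight (Ψ : ℝ → ℂ) (ξ : ℝ) : ℝ := min 1 (ξ ^ 2) * ‖Ψ ξ‖⁻¹

theorem exponentWeight_nonneg (Ψ : ℝ → ℂ) (ξ : ℝ) : 0 ≤ exponentWeight Ψ ξ := by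
  unfold exponentWeight
  positivity

theorem expSubOne_zero_right (x : ℝ) : expSubOne x 0 = 0 := by simp [expSubOne]

theorem norm_expSubOne_neg (x ξ : ℝ) : ‖expSubOne (-x) ξ‖ = ‖expSubOne x ξ‖ := by
  rw [← sq_eq_sq₀ (norm_nonneg _) (norm_nonneg _), norm_expSubOne_sq, norm_expSubOne_sq, mul_neg,
    cos_neg]

theorem norm_expSubOne_mul_norm_expSubOne_le (x z ξ : ℝ) :
    ‖expSubOne x ξ‖ * ‖expSubOne z ξ‖ ≤ (8 + x ^ 2 + z ^ 2) / 2 * min 1 (ξ ^ 2) := by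
  linarith [two_mul_le_add_sq ‖expSubOne x ξ‖ ‖expSubOne z ξ‖, norm_expSubOne_sq_le x ξ,
    norm_expSubOne_sq_le z ξ]

theorem norm_expSubOne_one_div_sq_le (u : ℝ) :
    ‖expSubOne 1 u‖ ^ 2 / u ^ 2 ≤ 10 * (1 + u ^ 2)⁻¹ := by
  rcases eq_or_ne u 0 with rfl | hu
  · simp
  rw [← div_eq_mul_inv, div_le_div_iff₀ (by positivity) (by positivity)]
  have h := norm_expSubOne_sq_le 1 u
  have hmin : min 1 (u ^ 2) * (1 + u ^ 2) ≤ 2 * u ^ 2 := by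
    rcases le_total 1 (u ^ 2) with h1 | h1
    · rw [min_eq_left h1]
      linarith
    · rw [min_eq_right h1]
      nlinarith [sq_nonneg u]
  nlinarith [mul_le_mul_of_nonneg_right h (by positivity : 0 ≤ 1 + u ^ 2)]

theorem integrable_norm_expSubOne_one_div_sq : Integrable fun u => ‖expSubOne 1 u‖ ^ 2 / u ^ 2 :=
  (integrable_inv_one_add_sq.const_mul 10).mono'
    (Measurable.aestronglyMeasurable (by fun_prop)) (.of_forall fun u => by
      rw [norm_of_nonneg (by positivity)]
      exact norm_expSubOne_one_div_sq_le u)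

theorem renormBound_zero (Ψ : ℝ → ℂ) : renormBound Ψ 0 = 0 := by
  simp [renormBound, expSubOne]

namespace ResolventFamily

variable {Ψ : ℝ → ℂ} {U : ℝ → Measure ℝ} {q : ℝ}

theorem renormKernel_nonneg (S : ResolventFamily Ψ U) (hq : 0 < q) (x : ℝ) :
    0 ≤ renormKernel Ψ q x := sub_nonneg.2 (S.kernel_le_kernel_zero hq _)

theorem renormKernel_add_le (S : ResolventFamily Ψ U) (hq : 0 < q) (x y : ℝ) :
    renormKernel Ψ q (x + y) ≤ renormKernel Ψ q x + renormKernel Ψ q y := by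
  simp only [renormKernel, neg_add]
  linarith [S.kernel_add_kernel_le hq (-x) (-y)]

theorem abs_renormKernel_add_sub_le (S : ResolventFamily Ψ U) (hq : 0 < q) (x y : ℝ) :
    |renormKernel Ψ q (x + y) - renormKernel Ψ q y| ≤
      renormKernel Ψ q x + renormKernel Ψ q (-x) := by
  have hback := S.renormKernel_add_le hq (-x) (x + y)
  rw [neg_add_cancel_left] at hback
  exact abs_sub_le_iff.2 ⟨by linarith [S.renormKernel_add_le hq x y, S.renormKernel_nonneg hq (-x)],
    by linarith [S.renormKernel_nonneg hq x]⟩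

theorem renormKernel_mixed_eq (S : ResolventFamily Ψ U) (hq : 0 < q) (x z y : ℝ) :
    renormKernel Ψ q (x + z + y) - renormKernel Ψ q (x + y) - renormKernel Ψ q (z + y) +
      renormKernel Ψ q y =
    -charFunInv (fun ξ => expSubOne x ξ * (expSubOne z ξ * ((q : ℂ) + Ψ ξ)⁻¹)) (-y) := by
  have hψ := S.integrable_inv q hq
  rw [charFunInv_expSubOne_mul (integrable_expSubOne_mul hψ z), charFunInv_expSubOne_mul hψ,
    charFunInv_expSubOne_mul hψ]
  simp only [renormKernel, resolventKernel]
  ring_nf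

/-! ### Integrability of the reciprocal exponent away from the origin -/

theorem isProbabilityMeasure_one (S : ResolventFamily Ψ U) : IsProbabilityMeasure (U 1) := by
  have := S.finite 1 one_pos
  refine ⟨(ENNReal.toReal_eq_one_iff _).1 ?_⟩
  rw [← measureReal_def, S.measureReal_univ one_pos, inv_one]

theorem charFun_one_ne_zero (S : ResolventFamily Ψ U) (ξ : ℝ) : charFun (U 1) ξ ≠ 0 := by
  rw [S.charFun_eq 1 one_pos]
  exact inv_ne_zero (S.add_ne_zero one_pos ξ)

theorem exponent_eq (S : ResolventFamily Ψ U) (ξ : ℝ) :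
    Ψ ξ = (1 - charFun (U 1) ξ) / charFun (U 1) ξ := by
  rw [sub_div, div_self (S.charFun_one_ne_zero ξ), S.charFun_eq 1 one_pos]
  simp

theorem continuous_exponent (S : ResolventFamily Ψ U) : Continuous Ψ := by
  have := S.finite 1 one_pos
  rw [funext S.exponent_eq]
  exact (continuous_const.sub continuous_charFun).div continuous_charFun S.charFun_one_ne_zero

theorem exists_min_one_sq_le (S : ResolventFamily Ψ U) :
    ∃ C, 0 < C ∧ ∀ ξ, min 1 (ξ ^ 2) ≤ C * (1 - (charFun (U 1) ξ).re) := by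
  have := S.isProbabilityMeasure_one
  obtain ⟨C, hC⟩ := exists_min_one_sq_le_mul_integral (S.continuous_kernel one_pos)
    (S.kernel_nonneg one_pos) (S.integrable_kernel one_pos) (S.kernel_zero_pos one_pos)
  simp_rw [← S.integral_eq_integral_mul_kernel one_pos, ← one_sub_re_charFun] at hC
  refine ⟨C, ?_, hC⟩
  have hre : (charFun (U 1) 1).re ≤ 1 := (Complex.re_le_norm _).trans (norm_charFun_le_one 1)
  exact pos_of_mul_pos_left (zero_lt_one.trans_le (by simpa using hC 1)) (by linarith)

theorem exists_min_one_sq_le_norm_one_sub (S : ResolventFamily Ψ U) :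
    ∃ C, 0 < C ∧ ∀ ξ, min 1 (ξ ^ 2) ≤ C * ‖1 - charFun (U 1) ξ‖ := by
  obtain ⟨C, hC, hle⟩ := S.exists_min_one_sq_le
  refine ⟨C, hC, fun ξ => (hle ξ).trans (mul_le_mul_of_nonneg_left ?_ hC.le)⟩
  simpa using Complex.re_le_norm (1 - charFun (U 1) ξ)

theorem exponent_ne_zero (S : ResolventFamily Ψ U) {ξ : ℝ} (hξ : ξ ≠ 0) : Ψ ξ ≠ 0 := by
  obtain ⟨C, hC, hle⟩ := S.exists_min_one_sq_le_norm_one_sub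
  have hpos : 0 < C * ‖1 - charFun (U 1) ξ‖ := lt_of_lt_of_le (by positivity) (hle ξ)
  rw [S.exponent_eq]
  exact div_ne_zero (norm_pos_iff.1 (pos_of_mul_pos_right hpos hC.le)) (S.charFun_one_ne_zero ξ)

theorem exists_exponentWeight_le (S : ResolventFamily Ψ U) :
    ∃ C, 0 < C ∧ ∀ ξ, exponentWeight Ψ ξ ≤ C * ‖charFun (U 1) ξ‖ := by
  obtain ⟨C, hC, hle⟩ := S.exists_min_one_sq_le_norm_one_sub
  refine ⟨C, hC, fun ξ => ?_⟩
  rw [exponentWeight, S.exponent_eq, norm_div, inv_div]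
  rcases (norm_nonneg (1 - charFun (U 1) ξ)).eq_or_lt with h | h
  · rw [← h, div_zero, mul_zero]
    positivity
  rw [mul_div_assoc', div_le_iff₀ h, mul_right_comm]
  exact mul_le_mul_of_nonneg_right (hle ξ) (norm_nonneg _)

theorem exists_exponentWeight_le_const (S : ResolventFamily Ψ U) :
    ∃ C, ∀ ξ, exponentWeight Ψ ξ ≤ C := by
  have := S.isProbabilityMeasure_one
  obtain ⟨C, hC, hle⟩ := S.exists_exponentWeight_le
  exact ⟨C, fun ξ => (hle ξ).trans (mul_le_of_le_one_right hC.le (norm_charFun_le_one ξ))⟩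

theorem measurable_exponentWeight (S : ResolventFamily Ψ U) : Measurable (exponentWeight Ψ) := by
  have := S.continuous_exponent.measurable
  unfold exponentWeight
  fun_prop

theorem integrable_exponentWeight (S : ResolventFamily Ψ U) : Integrable (exponentWeight Ψ) := by
  obtain ⟨C, -, hle⟩ := S.exists_exponentWeight_le
  refine ((S.integrable_charFun one_pos).norm.const_mul C).mono'
    S.measurable_exponentWeight.aestronglyMeasurable (.of_forall fun ξ => ?_)
  rw [norm_of_nonneg (exponentWeight_nonneg Ψ ξ)]
  exact hle ξ

theorem integrable_norm_expSubOne_mul (S : ResolventFamily Ψ U) (x z : ℝ) :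
    Integrable fun ξ => ‖expSubOne x ξ‖ * ‖expSubOne z ξ‖ * ‖Ψ ξ‖⁻¹ := by
  have hΨ := S.continuous_exponent.measurable
  refine (S.integrable_exponentWeight.const_mul ((8 + x ^ 2 + z ^ 2) / 2)).mono'
    (Measurable.aestronglyMeasurable (by fun_prop)) (.of_forall fun ξ => ?_)
  rw [norm_of_nonneg (by positivity), exponentWeight, ← mul_assoc]
  exact mul_le_mul_of_nonneg_right (norm_expSubOne_mul_norm_expSubOne_le x z ξ) (by positivity)

/-! ### The limit at killing rate zero -/

theorem norm_expSubOne_mul_inv_le (S : ResolventFamily Ψ U) (hq : 0 ≤ q) (z ξ : ℝ) :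
    ‖expSubOne z ξ * ((q : ℂ) + Ψ ξ)⁻¹‖ ≤ ‖expSubOne z ξ‖ * ‖Ψ ξ‖⁻¹ := by
  rcases eq_or_ne ξ 0 with rfl | hξ
  · simp [expSubOne_zero_right]
  rw [norm_mul, norm_inv]
  have := norm_pos_iff.2 (S.exponent_ne_zero hξ)
  gcongr
  exact S.norm_le_norm_add hq ξ

theorem tendsto_expSubOne_mul_inv (S : ResolventFamily Ψ U) (z ξ : ℝ) :
    Tendsto (fun q : ℝ => expSubOne z ξ * ((q : ℂ) + Ψ ξ)⁻¹) (𝓝[>] 0)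
      (𝓝 (expSubOne z ξ * (Ψ ξ)⁻¹)) := by
  rcases eq_or_ne ξ 0 with rfl | hξ
  · simp [expSubOne_zero_right]
  have h : Tendsto (fun q : ℝ => (q : ℂ) + Ψ ξ) (𝓝[>] 0) (𝓝 (Ψ ξ)) := by
    have hc : Continuous fun q : ℝ => (q : ℂ) + Ψ ξ := by fun_prop
    simpa using (hc.tendsto 0).mono_left nhdsWithin_le_nhds
  exact (h.inv₀ (S.exponent_ne_zero hξ)).const_mul _

theorem tendsto_renormKernel_mixed (S : ResolventFamily Ψ U) (x z y : ℝ) :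
    Tendsto (fun q => renormKernel Ψ q (x + z + y) - renormKernel Ψ q (x + y) -
      renormKernel Ψ q (z + y) + renormKernel Ψ q y) (𝓝[>] 0)
      (𝓝 (-charFunInv (fun ξ => expSubOne x ξ * (expSubOne z ξ * (Ψ ξ)⁻¹)) (-y))) := by
  have h := tendsto_charFunInv_of_dominated (l := 𝓝[>] (0 : ℝ))
    (F := fun q ξ => expSubOne x ξ * (expSubOne z ξ * ((q : ℂ) + Ψ ξ)⁻¹))
    (bound := fun ξ => ‖expSubOne x ξ‖ * ‖expSubOne z ξ‖ * ‖Ψ ξ‖⁻¹) ?_ ?_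
    (S.integrable_norm_expSubOne_mul x z)
    (.of_forall fun ξ => (S.tendsto_expSubOne_mul_inv z ξ).const_mul _) (-y)
  · exact h.neg.congr' (eventually_mem_nhdsWithin.mono fun q hq =>
      (S.renormKernel_mixed_eq hq x z y).symm)
  · filter_upwards [self_mem_nhdsWithin] with q hq
    exact (integrable_expSubOne_mul (integrable_expSubOne_mul (S.integrable_inv q hq) z) x).1
  · filter_upwards [self_mem_nhdsWithin] with q hq
    refine .of_forall fun ξ => ?_
    rw [norm_mul, mul_assoc]
    gcongr
    exact S.norm_expSubOne_mul_inv_le (le_of_lt hq) z ξ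

theorem asymptoticallyAdditive_renormKernel_sub (S : ResolventFamily Ψ U) :
    AsymptoticallyAdditive (fun p : ℝ × ℝ => fun x => renormKernel Ψ p.1 x - renormKernel Ψ p.2 x)
      (𝓝[>] 0 ×ˢ 𝓝[>] 0) := fun x z => by
  have h := S.tendsto_renormKernel_mixed x z 0
  refine ((h.comp tendsto_fst).sub (h.comp tendsto_snd)).congr (fun p => ?_) |>.trans (by simp)
  simp only [Function.comp_apply, renormKernel, add_zero]
  ring_nf

theorem asymptoticallyAdditive_increment (S : ResolventFamily Ψ U) {h : ℝ → ℝ}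
    (hh : ∀ x, Tendsto (fun q => renormKernel Ψ q x) (𝓝[>] 0) (𝓝 (h x))) :
    AsymptoticallyAdditive (fun y x => h (x + y) - h y) (cocompact ℝ) := fun x z => by
  have hmixed (y : ℝ) : -charFunInv (fun ξ => expSubOne x ξ * (expSubOne z ξ * (Ψ ξ)⁻¹)) (-y) =
      h (x + z + y) - h y - (h (x + y) - h y) - (h (z + y) - h y) := by
    refine (tendsto_nhds_unique (S.tendsto_renormKernel_mixed x z y)
      ((((hh _).sub (hh _)).sub (hh _)).add (hh _))).trans ?_
    ring
  have hneg : Tendsto (fun y : ℝ => -y) (cocompact ℝ) (cocompact ℝ) :=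
    (Homeomorph.neg ℝ).isClosedEmbedding.tendsto_cocompact
  exact (((tendsto_charFunInv_cocompact _).comp hneg).neg.congr hmixed).trans (by simp)

/-! ### Growth of the increments -/

theorem renormKernel_add_renormKernel_neg_le (S : ResolventFamily Ψ U) (hq : 0 < q) (x : ℝ) :
    renormKernel Ψ q x + renormKernel Ψ q (-x) ≤ renormBound Ψ x := by
  have hmixed := S.renormKernel_mixed_eq hq x (-x) 0
  have hzero : renormKernel Ψ q 0 = 0 := by simp [renormKernel]
  simp only [add_neg_cancel, add_zero, hzero] at hmixed
  calc renormKernel Ψ q x + renormKernel Ψ q (-x)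
      ≤ |charFunInv (fun ξ => expSubOne x ξ * (expSubOne (-x) ξ * ((q : ℂ) + Ψ ξ)⁻¹)) (-0)| :=
        (by linarith : _ = _).trans_le (le_abs_self _)
    _ ≤ renormBound Ψ x := by
      refine (abs_charFunInv_le _ _).trans (mul_le_mul_of_nonneg_left ?_ (by positivity))
      refine integral_mono (integrable_expSubOne_mul
        (integrable_expSubOne_mul (S.integrable_inv q hq) _) x).norm
        (by simpa only [sq] using S.integrable_norm_expSubOne_mul x x) fun ξ => ?_
      have h := S.norm_expSubOne_mul_inv_le hq.le (-x) ξ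
      rw [norm_expSubOne_neg] at h
      simp only [norm_mul _ (_ * _), sq, mul_assoc]
      gcongr

theorem abs_renormKernel_add_sub_le_renormBound (S : ResolventFamily Ψ U) (hq : 0 < q) (x y : ℝ) :
    |renormKernel Ψ q (x + y) - renormKernel Ψ q y| ≤ renormBound Ψ x :=
  (S.abs_renormKernel_add_sub_le hq x y).trans (S.renormKernel_add_renormKernel_neg_le hq x)

theorem renormKernel_le_renormBound (S : ResolventFamily Ψ U) (hq : 0 < q) (x : ℝ) :
    renormKernel Ψ q x ≤ renormBound Ψ x :=
  (le_add_of_nonneg_right (S.renormKernel_nonneg hq (-x))).trans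
    (S.renormKernel_add_renormKernel_neg_le hq x)

theorem integrable_norm_expSubOne_div_sq_mul (S : ResolventFamily Ψ U) (x : ℝ) :
    Integrable fun ξ => ‖expSubOne x ξ‖ ^ 2 / ξ ^ 2 * exponentWeight Ψ ξ := by
  refine S.integrable_exponentWeight.bdd_mul (c := x ^ 2)
    (Measurable.aestronglyMeasurable (by fun_prop)) (.of_forall fun ξ => ?_)
  rw [norm_of_nonneg (by positivity)]
  refine div_le_of_le_mul₀ (sq_nonneg ξ) (sq_nonneg x) ?_
  rw [← mul_pow, mul_comm x, ← sq_abs (ξ * x)]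
  exact pow_le_pow_left₀ (norm_nonneg _) (norm_expSubOne_le_abs x ξ) 2

theorem integral_norm_expSubOne_div_sq_mul (w : ℝ → ℝ) {x : ℝ} (hx : x ≠ 0) :
    ∫ ξ, ‖expSubOne x ξ‖ ^ 2 / ξ ^ 2 * w ξ =
      |x| * ∫ u, ‖expSubOne 1 u‖ ^ 2 / u ^ 2 * w (u / x) := by
  have hscale := Measure.integral_comp_div (fun ξ => ‖expSubOne x ξ‖ ^ 2 / ξ ^ 2 * w ξ) x
  have hpt (u : ℝ) : ‖expSubOne x (u / x)‖ ^ 2 / (u / x) ^ 2 * w (u / x) =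
      x ^ 2 * (‖expSubOne 1 u‖ ^ 2 / u ^ 2 * w (u / x)) := by
    rw [expSubOne, div_mul_cancel₀ u hx, expSubOne, mul_one, div_pow]
    field_simp
  simp only [hpt, integral_const_mul, smul_eq_mul] at hscale
  rw [← sq_abs, sq, mul_assoc] at hscale
  exact (mul_left_cancel₀ (abs_ne_zero.2 hx) hscale).symm

/-- From `1 ≤ min(1, ξ²) (1 + ξ⁻²)` and the substitution `u = x ξ` in the second summand. -/
theorem renormBound_le (S : ResolventFamily Ψ U) {x : ℝ} (hx : x ≠ 0) :
    renormBound Ψ x ≤ (2 * π)⁻¹ * (4 * (∫ ξ, exponentWeight Ψ ξ) +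
      |x| * ∫ u, ‖expSubOne 1 u‖ ^ 2 / u ^ 2 * exponentWeight Ψ (u / x)) := by
  have hw := S.integrable_exponentWeight.const_mul 4
  have hG := S.integrable_norm_expSubOne_div_sq_mul x
  rw [← integral_norm_expSubOne_div_sq_mul _ hx, ← integral_const_mul, ← integral_add hw hG]
  refine mul_le_mul_of_nonneg_left (integral_mono
    (by simpa only [sq] using S.integrable_norm_expSubOne_mul x x) (hw.add hG) fun ξ => ?_)
    (by positivity)
  rcases eq_or_ne ξ 0 with rfl | hξ
  · simp [expSubOne_zero_right, exponentWeight]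
  have hone : 1 ≤ min 1 (ξ ^ 2) + min 1 (ξ ^ 2) / ξ ^ 2 := by
    rcases le_total 1 (ξ ^ 2) with h | h
    · rw [min_eq_left h]
      exact le_add_of_nonneg_right (by positivity)
    · rw [min_eq_right h, div_self (by positivity)]
      exact le_add_of_nonneg_left (by positivity)
  have hfour : ‖expSubOne x ξ‖ ^ 2 ≤ 4 :=
    (pow_le_pow_left₀ (norm_nonneg _) (norm_expSubOne_le_two x ξ) 2).trans (by norm_num)
  calc ‖expSubOne x ξ‖ ^ 2 * ‖Ψ ξ‖⁻¹
      ≤ ‖expSubOne x ξ‖ ^ 2 * ‖Ψ ξ‖⁻¹ * (min 1 (ξ ^ 2) + min 1 (ξ ^ 2) / ξ ^ 2) :=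
        le_mul_of_one_le_right (by positivity) hone
    _ = ‖expSubOne x ξ‖ ^ 2 * exponentWeight Ψ ξ +
          ‖expSubOne x ξ‖ ^ 2 / ξ ^ 2 * exponentWeight Ψ ξ := by
        rw [exponentWeight]
        ring
    _ ≤ 4 * exponentWeight Ψ ξ + ‖expSubOne x ξ‖ ^ 2 / ξ ^ 2 * exponentWeight Ψ ξ := by
        gcongr
        exact exponentWeight_nonneg Ψ ξ

theorem exists_renormBound_le (S : ResolventFamily Ψ U) :
    ∃ K, ∀ x, renormBound Ψ x ≤ K * (1 + |x|) := by
  obtain ⟨C, hC⟩ := S.exists_exponentWeight_le_const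
  set J : ℝ → ℝ := fun u => ‖expSubOne 1 u‖ ^ 2 / u ^ 2
  have hJ : Integrable J := integrable_norm_expSubOne_one_div_sq
  have hJnonneg (u : ℝ) : 0 ≤ J u := by positivity
  have hC0 : 0 ≤ C := (exponentWeight_nonneg Ψ 0).trans (hC 0)
  have hw : 0 ≤ ∫ ξ, exponentWeight Ψ ξ := integral_nonneg (exponentWeight_nonneg Ψ)
  have hJC : 0 ≤ ∫ u, J u * C := integral_nonneg fun u => mul_nonneg (hJnonneg u) hC0
  refine ⟨(2 * π)⁻¹ * (4 * (∫ ξ, exponentWeight Ψ ξ) + ∫ u, J u * C), fun x => ?_⟩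
  rcases eq_or_ne x 0 with rfl | hx
  · rw [renormBound_zero]
    positivity
  have hle : ∫ u, J u * exponentWeight Ψ (u / x) ≤ ∫ u, J u * C :=
    integral_mono_of_nonneg (.of_forall fun u => mul_nonneg (hJnonneg u)
      (exponentWeight_nonneg _ _)) (hJ.mul_const C)
      (.of_forall fun u => mul_le_mul_of_nonneg_left (hC _) (hJnonneg u))
  refine (S.renormBound_le hx).trans ?_
  rw [mul_assoc]
  refine mul_le_mul_of_nonneg_left ?_ (by positivity)
  nlinarith [mul_le_mul_of_nonneg_left hle (abs_nonneg x), mul_nonneg hw (abs_nonneg x)]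

theorem tendsto_integral_mul_exponentWeight (S : ResolventFamily Ψ U)
    (hzero : Tendsto (exponentWeight Ψ) (𝓝[≠] 0) (𝓝 0)) :
    Tendsto (fun x => ∫ u, ‖expSubOne 1 u‖ ^ 2 / u ^ 2 * exponentWeight Ψ (u / x)) (cocompact ℝ)
      (𝓝 0) := by
  obtain ⟨C, hC⟩ := S.exists_exponentWeight_le_const
  have hw := S.measurable_exponentWeight
  have hgen : (cocompact ℝ).IsCountablyGenerated := by
    rw [cocompact_eq_atBot_atTop]
    infer_instance
  have hne : ∀ᶠ x : ℝ in cocompact ℝ, x ≠ 0 := (isCompact_singleton (x := 0)).compl_mem_cocompact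
  have h := tendsto_integral_filter_of_dominated_convergence (l := cocompact ℝ)
    (F := fun x u => ‖expSubOne 1 u‖ ^ 2 / u ^ 2 * exponentWeight Ψ (u / x)) (f := fun _ => 0)
    (fun u => ‖expSubOne 1 u‖ ^ 2 / u ^ 2 * C)
    (.of_forall fun x => Measurable.aestronglyMeasurable (by fun_prop))
    (.of_forall fun x => .of_forall fun u => ?_)
    (integrable_norm_expSubOne_one_div_sq.mul_const C) (.of_forall fun u => ?_)
  · simpa using h
  · rw [norm_of_nonneg (mul_nonneg (by positivity) (exponentWeight_nonneg _ _))]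
    gcongr
    exact hC _
  · rcases eq_or_ne u 0 with rfl | hu
    · simp [expSubOne_zero_right]
    have hdiv : Tendsto (fun x : ℝ => u / x) (cocompact ℝ) (𝓝[≠] 0) := by
      refine tendsto_nhdsWithin_iff.2 ⟨?_, ?_⟩
      · simpa [div_eq_mul_inv] using tendsto_inv₀_cobounded.const_mul u
      · exact hne.mono fun x hx => div_ne_zero hu hx
    simpa using (hzero.comp hdiv).const_mul (‖expSubOne 1 u‖ ^ 2 / u ^ 2)

theorem tendsto_renormBound_div_abs (S : ResolventFamily Ψ U)
    (hzero : Tendsto (exponentWeight Ψ) (𝓝[≠] 0) (𝓝 0)) :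
    Tendsto (fun x => renormBound Ψ x / |x|) (cocompact ℝ) (𝓝 0) := by
  have hne : ∀ᶠ x : ℝ in cocompact ℝ, x ≠ 0 := (isCompact_singleton (x := 0)).compl_mem_cocompact
  have hbound := ((tendsto_norm_cocompact_atTop (E := ℝ)).const_div_atTop
    (4 * ∫ ξ, exponentWeight Ψ ξ)).add (S.tendsto_integral_mul_exponentWeight hzero)
    |>.const_mul (2 * π)⁻¹
  rw [add_zero, mul_zero] at hbound
  refine squeeze_zero' (.of_forall fun x => ?_) (hne.mono fun x hx => ?_) hbound
  · unfold renormBound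
    positivity
  · have := abs_pos.2 hx
    rw [div_le_iff₀ this, norm_eq_abs, mul_assoc, add_mul, div_mul_cancel₀ _ this.ne']
    simpa only [mul_comm |x|] using S.renormBound_le hx

theorem tendsto_renormBound_natCast_mul_div (S : ResolventFamily Ψ U)
    (hzero : Tendsto (exponentWeight Ψ) (𝓝[≠] 0) (𝓝 0)) (x : ℝ) :
    Tendsto (fun n : ℕ => renormBound Ψ (n * x) / n) atTop (𝓝 0) := by
  rcases eq_or_ne x 0 with rfl | hx
  · simp [renormBound_zero]
  have hn : Tendsto (fun n : ℕ => n * x) atTop (cocompact ℝ) := by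
    rw [← Metric.cobounded_eq_cocompact, ← comap_norm_atTop, tendsto_comap_iff]
    simpa [Function.comp_def] using
      (tendsto_natCast_atTop_atTop (R := ℝ)).atTop_mul_const (abs_pos.2 hx)
  have h := ((S.tendsto_renormBound_div_abs hzero).comp hn).mul_const |x|
  rw [zero_mul] at h
  refine h.congr fun n => ?_
  rw [Function.comp_apply, abs_mul, Nat.abs_cast, ← div_div, div_mul_cancel₀ _ (abs_ne_zero.2 hx)]

end ResolventFamily

/-! ### Limits of the renormalized kernels -/

theorem exists_tendsto_of_tendsto_sub {ι : Type*} {l : Filter ι} [l.NeBot] {f : ι → ℝ}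
    (h : Tendsto (fun p : ι × ι => f p.1 - f p.2) (l ×ˢ l) (𝓝 0)) : ∃ a, Tendsto f l (𝓝 a) := by
  refine cauchy_map_iff_exists_tendsto.1 (cauchy_map_iff.2 ⟨inferInstance, ?_⟩)
  rw [uniformity_eq_comap_nhds_zero_swapped, tendsto_comap_iff]
  exact h

theorem tendsto_div_atTop_of_tendsto_increment {h : ℝ → ℝ} {c C : ℝ}
    (hC : ∀ x y, |x| ≤ 1 → |h (x + y) - h y| ≤ C)
    (hc : Tendsto (fun y => h (1 + y) - h y) atTop (𝓝 c)) :
    Tendsto (fun y => h y / y) atTop (𝓝 c) := by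
  have hnat : Tendsto (fun n : ℕ => (n : ℝ)⁻¹ * (h n - h 0)) atTop (𝓝 c) := by
    refine (hc.comp tendsto_natCast_atTop_atTop).cesaro.congr fun n => ?_
    have hsum := Finset.sum_range_sub (fun i : ℕ => h i) n
    simp only [Nat.cast_add, Nat.cast_one, Nat.cast_zero, add_comm _ (1 : ℝ)] at hsum
    simp only [Function.comp_apply, hsum]
  have hfloor := (hnat.comp tendsto_nat_floor_atTop).mul (tendsto_nat_floor_div_atTop (R := ℝ))
  have herror : Tendsto (fun y : ℝ => (h y - h ⌊y⌋₊ + h 0) / y) atTop (𝓝 0) := by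
    refine squeeze_zero_norm' (a := fun y : ℝ => (C + |h 0|) / y) ?_
      (tendsto_const_nhds.div_atTop tendsto_id)
    filter_upwards [eventually_gt_atTop 0] with y hy
    have hfract : |y - ⌊y⌋₊| ≤ 1 :=
      abs_le.2 ⟨by linarith [Nat.floor_le hy.le], by linarith [Nat.lt_floor_add_one y]⟩
    have hle := hC (y - ⌊y⌋₊) ⌊y⌋₊ hfract
    rw [sub_add_cancel] at hle
    rw [norm_div, norm_of_nonneg hy.le, norm_eq_abs]
    gcongr
    exact (abs_add_le _ _).trans (add_le_add_left hle _)
  refine ((hfloor.add herror).congr' ?_).trans (by simp)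
  filter_upwards [eventually_ge_atTop 1] with y hy
  have hn : (0 : ℝ) < ⌊y⌋₊ := by exact_mod_cast Nat.floor_pos.2 hy
  simp only [Function.comp_apply]
  field_simp
  ring

namespace ResolventFamily

variable {Ψ : ℝ → ℂ} {U : ℝ → Measure ℝ} {h : ℝ → ℝ}

theorem abs_limit_add_sub_le (S : ResolventFamily Ψ U)
    (hh : ∀ x, Tendsto (fun q => renormKernel Ψ q x) (𝓝[>] 0) (𝓝 (h x))) (x y : ℝ) :
    |h (x + y) - h y| ≤ renormBound Ψ x :=
  le_of_tendsto ((hh _).sub (hh _)).abs (eventually_mem_nhdsWithin.mono fun _ hq =>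
    S.abs_renormKernel_add_sub_le_renormBound hq x y)

theorem exists_renormBound_le_of_abs_le_one (S : ResolventFamily Ψ U) :
    ∃ C, ∀ x, |x| ≤ 1 → renormBound Ψ x ≤ C := by
  obtain ⟨K, hK⟩ := S.exists_renormBound_le
  have hK0 : 0 ≤ K := by simpa [renormBound_zero] using hK 0
  exact ⟨K * (1 + 1), fun x hx => (hK x).trans (by gcongr)⟩

theorem tendsto_increment_sub_mul_one (S : ResolventFamily Ψ U)
    (hh : ∀ x, Tendsto (fun q => renormKernel Ψ q x) (𝓝[>] 0) (𝓝 (h x))) (x : ℝ) :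
    Tendsto (fun y => h (x + y) - h y - x * (h (1 + y) - h y)) (cocompact ℝ) (𝓝 0) := by
  obtain ⟨C, hC⟩ := S.exists_renormBound_le_of_abs_le_one
  exact (S.asymptoticallyAdditive_increment hh).tendsto_sub_mul_one
    (fun x => .of_forall (S.abs_limit_add_sub_le hh x)) hC x

theorem tendsto_increment (S : ResolventFamily Ψ U)
    (hh : ∀ x, Tendsto (fun q => renormKernel Ψ q x) (𝓝[>] 0) (𝓝 (h x))) {l : Filter ℝ}
    (hl : l ≤ cocompact ℝ) {c : ℝ} (hc : Tendsto (fun y => h (1 + y) - h y) l (𝓝 c)) (x : ℝ) :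
    Tendsto (fun y => h (x + y) - h y) l (𝓝 (x * c)) := by
  simpa using ((S.tendsto_increment_sub_mul_one hh x).mono_left hl).add (hc.const_mul x)

theorem tendsto_limit_div_atTop (S : ResolventFamily Ψ U)
    (hh : ∀ x, Tendsto (fun q => renormKernel Ψ q x) (𝓝[>] 0) (𝓝 (h x))) {c : ℝ}
    (hc : Tendsto (fun y => h (1 + y) - h y) atTop (𝓝 c)) :
    Tendsto (fun y => h y / |y|) atTop (𝓝 c) := by
  obtain ⟨C, hC⟩ := S.exists_renormBound_le_of_abs_le_one
  refine (tendsto_div_atTop_of_tendsto_increment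
    (fun x y hx => (S.abs_limit_add_sub_le hh x y).trans (hC x hx)) hc).congr' ?_
  filter_upwards [eventually_ge_atTop 0] with y hy
  rw [abs_of_nonneg hy]

theorem tendsto_limit_div_atBot (S : ResolventFamily Ψ U)
    (hh : ∀ x, Tendsto (fun q => renormKernel Ψ q x) (𝓝[>] 0) (𝓝 (h x))) {c : ℝ}
    (hc : Tendsto (fun y => h (1 + y) - h y) atBot (𝓝 (-c))) :
    Tendsto (fun y => h y / |y|) atBot (𝓝 c) := by
  obtain ⟨C, hC⟩ := S.exists_renormBound_le_of_abs_le_one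
  have hback : Tendsto (fun y => h (-1 + -y) - h (-y)) atTop (𝓝 c) := by
    have hneg := (S.tendsto_increment hh atBot_le_cocompact hc (-1)).comp tendsto_neg_atTop_atBot
    simpa [Function.comp_def] using hneg
  have hdiv := (tendsto_div_atTop_of_tendsto_increment (h := fun y => h (-y)) (C := C)
    (fun x y hx => ?_) (by simpa only [neg_add] using hback)).comp tendsto_neg_atBot_atTop
  · refine hdiv.congr' ?_
    filter_upwards [eventually_le_atBot 0] with y hy
    simp [abs_of_nonpos hy]
  · rw [neg_add]
    exact (S.abs_limit_add_sub_le hh (-x) (-y)).trans (hC _ (by rwa [abs_neg]))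

/-! ### Infinite variance -/

theorem tendsto_exponentWeight (S : ResolventFamily Ψ U)
    (hvar : ∫⁻ x, ENNReal.ofReal (x ^ 2) ∂U 1 = ∞) :
    Tendsto (exponentWeight Ψ) (𝓝[≠] 0) (𝓝 0) := by
  have := S.isProbabilityMeasure_one
  have htop := tendsto_two_mul_one_sub_re_charFun_div_sq (U 1)
  rw [hvar] at htop
  have hdiv := ENNReal.tendsto_ofReal_nhds_top.1 htop
  refine squeeze_zero' (.of_forall (exponentWeight_nonneg Ψ)) ?_ (hdiv.const_div_atTop 2)
  filter_upwards [hdiv.eventually_gt_atTop 0, eventually_mem_nhdsWithin] with ξ hpos hξ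
  have hξ2 : 0 < ξ ^ 2 := sq_pos_of_ne_zero hξ
  have hre : 0 < 1 - (charFun (U 1) ξ).re := by
    linarith [(div_pos_iff_of_pos_right hξ2).1 hpos]
  have hre_le : 1 - (charFun (U 1) ξ).re ≤ ‖1 - charFun (U 1) ξ‖ := by
    simpa using Complex.re_le_norm (1 - charFun (U 1) ξ)
  calc exponentWeight Ψ ξ ≤ ξ ^ 2 * (1 / (1 - (charFun (U 1) ξ).re)) := by
        rw [exponentWeight, S.exponent_eq, norm_div, inv_div]
        gcongr
        exacts [min_le_right _ _, norm_charFun_le_one ξ]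
    _ = 2 / (2 * (1 - (charFun (U 1) ξ).re) / ξ ^ 2) := by field_simp

theorem exists_limit_of_lintegral_sq_eq_top (S : ResolventFamily Ψ U)
    (hvar : ∫⁻ x, ENNReal.ofReal (x ^ 2) ∂U 1 = ∞) :
    ∃ h : ℝ → ℝ, (∀ x, Tendsto (fun q => renormKernel Ψ q x) (𝓝[>] 0) (𝓝 (h x))) ∧
      Tendsto (fun y => h (1 + y) - h y) (cocompact ℝ) (𝓝 0) := by
  have hbound := S.tendsto_renormBound_natCast_mul_div (S.tendsto_exponentWeight hvar)
  have hpos : ∀ᶠ p : ℝ × ℝ in 𝓝[>] 0 ×ˢ 𝓝[>] 0, 0 < p.1 ∧ 0 < p.2 :=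
    eventually_mem_nhdsWithin.prod_mk eventually_mem_nhdsWithin
  have hcauchy (x : ℝ) := exists_tendsto_of_tendsto_sub (f := fun q => renormKernel Ψ q x) <|
    S.asymptoticallyAdditive_renormKernel_sub.tendsto_zero (hbound x) fun n =>
      hpos.mono fun p hp => abs_sub_le_of_nonneg_of_le
        (S.renormKernel_nonneg hp.1 _) (S.renormKernel_le_renormBound hp.1 _)
        (S.renormKernel_nonneg hp.2 _) (S.renormKernel_le_renormBound hp.2 _)
  choose h hh using hcauchy
  exact ⟨h, hh, (S.asymptoticallyAdditive_increment hh).tendsto_zero (hbound 1) fun n =>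
    .of_forall (S.abs_limit_add_sub_le hh _)⟩

end ResolventFamily

/-! ### The odd part of the renormalized kernels -/

theorem charFunInv_conj (φ : ℝ → ℂ) (x : ℝ) :
    charFunInv (fun ξ => conj (φ ξ)) x = charFunInv φ (-x) := by
  have hconj (ξ : ℝ) : Complex.exp (-(ξ * x : ℝ) * Complex.I) * conj (φ ξ) =
      conj (Complex.exp (-(ξ * -x : ℝ) * Complex.I) * φ ξ) := by
    simp [← Complex.exp_conj]
  simp only [charFunInv, hconj, integral_conj, Complex.conj_re]

/-- The Fourier transform `2 i Im (1 / (q + Ψ))` of the odd function `h_q(x) - h_q(-x)`. -/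
noncomputable def oddSymbol (Ψ : ℝ → ℂ) (q ξ : ℝ) : ℂ :=
  ((q : ℂ) + Ψ ξ)⁻¹ - conj ((q : ℂ) + Ψ ξ)⁻¹

theorem norm_oddSymbol (Ψ : ℝ → ℂ) (q ξ : ℝ) :
    ‖oddSymbol Ψ q ξ‖ = 2 * (|(Ψ ξ).im| / ‖(q : ℂ) + Ψ ξ‖ ^ 2) := by
  rw [oddSymbol, Complex.sub_conj, Complex.inv_im, norm_mul, Complex.norm_I, mul_one,
    Complex.norm_real, norm_mul, Complex.sq_norm]
  simp [abs_of_nonneg (Complex.normSq_nonneg _)]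

namespace ResolventFamily

variable {Ψ : ℝ → ℂ} {U : ℝ → Measure ℝ} {q : ℝ}

theorem integrable_conj_inv (S : ResolventFamily Ψ U) (hq : 0 < q) :
    Integrable fun ξ => conj ((q : ℂ) + Ψ ξ)⁻¹ :=
  Complex.conjLIE.integrable_comp_iff.2 (S.integrable_inv q hq)

theorem charFunInv_oddSymbol (S : ResolventFamily Ψ U) (hq : 0 < q) (x : ℝ) :
    charFunInv (oddSymbol Ψ q) x = renormKernel Ψ q x - renormKernel Ψ q (-x) := by
  unfold oddSymbol
  rw [charFunInv_sub (S.integrable_inv q hq) (S.integrable_conj_inv hq), charFunInv_conj]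
  simp [renormKernel, resolventKernel]

theorem integrable_oddSymbol (S : ResolventFamily Ψ U) (hq : 0 < q) :
    Integrable (oddSymbol Ψ q) :=
  (S.integrable_inv q hq).sub (S.integrable_conj_inv hq)

theorem norm_oddSymbol_le (S : ResolventFamily Ψ U) (hq : 0 ≤ q) {ξ : ℝ} (hξ : ξ ≠ 0) :
    ‖oddSymbol Ψ q ξ‖ ≤ ‖oddSymbol Ψ 0 ξ‖ := by
  have hpos := norm_pos_iff.2 (S.exponent_ne_zero hξ)
  rw [norm_oddSymbol, norm_oddSymbol, Complex.ofReal_zero, zero_add]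
  gcongr
  exact S.norm_le_norm_add hq ξ

theorem tendsto_oddSymbol (S : ResolventFamily Ψ U) {ξ : ℝ} (hξ : ξ ≠ 0) :
    Tendsto (fun q : ℝ => oddSymbol Ψ q ξ) (𝓝[>] 0) (𝓝 (oddSymbol Ψ 0 ξ)) := by
  have hne : ((0 : ℝ) : ℂ) + Ψ ξ ≠ 0 := by simpa using S.exponent_ne_zero hξ
  have hc : ContinuousAt (fun q : ℝ => oddSymbol Ψ q ξ) 0 := by
    unfold oddSymbol
    fun_prop (disch := exact hne)
  exact hc.mono_left nhdsWithin_le_nhds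

theorem norm_oddSymbol_zero_eq (S : ResolventFamily Ψ U) (ξ : ℝ) :
    ‖oddSymbol Ψ 0 ξ‖ = 2 * (|(charFun (U 1) ξ).im| / ‖1 - charFun (U 1) ξ‖ ^ 2) := by
  have hφ := norm_ne_zero_iff.2 (S.charFun_one_ne_zero ξ)
  rw [norm_oddSymbol, Complex.ofReal_zero, zero_add, S.exponent_eq, norm_div, div_pow,
    sub_div, div_self (S.charFun_one_ne_zero ξ), Complex.sub_im, one_div, Complex.inv_im,
    Complex.one_im, sub_zero, neg_div, abs_neg, abs_div, Complex.normSq_eq_norm_sq,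
    abs_of_nonneg (sq_nonneg ‖_‖)]
  field_simp

theorem integrable_norm_expSubOne_mul_oddSymbol (S : ResolventFamily Ψ U)
    (hsq : Integrable (fun x => x ^ 2) (U 1)) (hmean : ∫ x, x ∂U 1 = 0) (x : ℝ) :
    Integrable fun ξ => ‖expSubOne x ξ‖ * ‖oddSymbol Ψ 0 ξ‖ := by
  have := S.isProbabilityMeasure_one
  have hΨ := S.continuous_exponent.measurable
  obtain ⟨C, hC, hle⟩ := S.exists_min_one_sq_le_norm_one_sub
  have hdom := ((integrable_im_charFun_div_cube hsq hmean).norm.const_mul (2 * C ^ 2 * |x|)).add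
    (S.integrable_exponentWeight.const_mul 4)
  refine hdom.mono' (Measurable.aestronglyMeasurable (by unfold oddSymbol; fun_prop))
    (.of_forall fun ξ => ?_)
  rw [norm_of_nonneg (by positivity), Pi.add_apply]
  rcases eq_or_ne ξ 0 with rfl | hξ0
  · simpa [expSubOne_zero_right] using exponentWeight_nonneg Ψ 0
  have : 0 < |ξ| := abs_pos.2 hξ0
  rcases le_or_gt |ξ| 1 with hξ | hξ
  · refine le_add_of_le_of_nonneg ?_ (mul_nonneg zero_le_four (exponentWeight_nonneg Ψ ξ))
    have hsq_le : |ξ| ^ 2 ≤ C * ‖1 - charFun (U 1) ξ‖ := by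
      simpa [min_eq_right ((sq_le_one_iff_abs_le_one ξ).2 hξ)] using hle ξ
    have hpos : 0 < ‖1 - charFun (U 1) ξ‖ :=
      pos_of_mul_pos_right (lt_of_lt_of_le (by positivity) hsq_le) hC.le
    calc ‖expSubOne x ξ‖ * ‖oddSymbol Ψ 0 ξ‖
        ≤ (|ξ| * |x|) * (2 * (|(charFun (U 1) ξ).im| / (|ξ| ^ 2 / C) ^ 2)) := by
          rw [S.norm_oddSymbol_zero_eq, ← abs_mul]
          gcongr
          · exact norm_expSubOne_le_abs x ξ
          · rwa [div_le_iff₀' hC]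
      _ = 2 * C ^ 2 * |x| * ‖(charFun (U 1) ξ).im / ξ ^ 3‖ := by
          rw [norm_div, norm_pow, norm_eq_abs, norm_eq_abs]
          field_simp
  · refine le_add_of_nonneg_of_le (by positivity) ?_
    have := norm_pos_iff.2 (S.exponent_ne_zero hξ0)
    calc ‖expSubOne x ξ‖ * ‖oddSymbol Ψ 0 ξ‖ ≤ 2 * (2 * (‖Ψ ξ‖ / ‖Ψ ξ‖ ^ 2)) := by
          rw [norm_oddSymbol, Complex.ofReal_zero, zero_add]
          gcongr
          exacts [norm_expSubOne_le_two x ξ, Complex.abs_im_le_norm _]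
      _ = 4 * exponentWeight Ψ ξ := by
          rw [exponentWeight, min_eq_left ((one_lt_sq_iff_one_lt_abs ξ).2 hξ).le]
          field_simp
          norm_num

theorem tendsto_odd_increment (S : ResolventFamily Ψ U)
    (hsq : Integrable (fun x => x ^ 2) (U 1)) (hmean : ∫ x, x ∂U 1 = 0) (x y : ℝ) :
    Tendsto (fun q => renormKernel Ψ q (x + y) - renormKernel Ψ q (-(x + y)) -
      (renormKernel Ψ q y - renormKernel Ψ q (-y))) (𝓝[>] 0)
      (𝓝 (charFunInv (fun ξ => expSubOne (-x) ξ * oddSymbol Ψ 0 ξ) y)) := by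
  refine (tendsto_charFunInv_of_dominated (F := fun q ξ => expSubOne (-x) ξ * oddSymbol Ψ q ξ) ?_ ?_
    (S.integrable_norm_expSubOne_mul_oddSymbol hsq hmean (-x)) (.of_forall fun ξ => ?_) y).congr' ?_
  · filter_upwards [self_mem_nhdsWithin] with q hq
    exact (integrable_expSubOne_mul (S.integrable_oddSymbol hq) _).1
  · filter_upwards [self_mem_nhdsWithin] with q hq
    refine .of_forall fun ξ => ?_
    rcases eq_or_ne ξ 0 with rfl | hξ
    · simp [expSubOne_zero_right]
    rw [norm_mul]
    gcongr
    exact S.norm_oddSymbol_le (le_of_lt hq) hξ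
  · rcases eq_or_ne ξ 0 with rfl | hξ
    · simp [expSubOne_zero_right]
    exact (S.tendsto_oddSymbol hξ).const_mul _
  · filter_upwards [self_mem_nhdsWithin] with q hq
    rw [charFunInv_expSubOne_mul (S.integrable_oddSymbol hq), sub_neg_eq_add, add_comm y,
      S.charFunInv_oddSymbol hq, S.charFunInv_oddSymbol hq]

theorem exists_limit_of_integrable_sq (S : ResolventFamily Ψ U)
    (hsq : Integrable (fun x => x ^ 2) (U 1)) (hmean : ∫ x, x ∂U 1 = 0) :
    ∃ h : ℝ → ℝ, ∀ x, Tendsto (fun q => renormKernel Ψ q x) (𝓝[>] 0) (𝓝 (h x)) := by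
  have hlim (x : ℝ) : ∃ a, Tendsto (fun q => renormKernel Ψ q x) (𝓝[>] 0) (𝓝 a) := by
    have heven := S.tendsto_renormKernel_mixed x (-x) 0
    have hodd := S.tendsto_odd_increment hsq hmean x 0
    refine ⟨_, ((hodd.sub heven).const_mul (1 / 2)).congr fun q => ?_⟩
    have hzero : renormKernel Ψ q 0 = 0 := by simp [renormKernel]
    simp only [add_zero, neg_zero, add_neg_cancel, hzero]
    ring
  exact ⟨_, fun x => (hlim x).choose_spec⟩

theorem tendsto_increment_add_increment_reflect (S : ResolventFamily Ψ U)
    (hsq : Integrable (fun x => x ^ 2) (U 1)) (hmean : ∫ x, x ∂U 1 = 0) {h : ℝ → ℝ}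
    (hh : ∀ x, Tendsto (fun q => renormKernel Ψ q x) (𝓝[>] 0) (𝓝 (h x))) (x : ℝ) :
    Tendsto (fun y => (h (x + y) - h y) + (h (-y) - h (-(x + y)))) (cocompact ℝ) (𝓝 0) := by
  refine (tendsto_charFunInv_cocompact fun ξ => expSubOne (-x) ξ * oddSymbol Ψ 0 ξ).congr
    fun y => ?_
  refine (tendsto_nhds_unique (S.tendsto_odd_increment hsq hmean x y)
    (((hh _).sub (hh _)).sub ((hh _).sub (hh _)))).trans ?_
  ring

end ResolventFamily

/-! ### The Poisson equation -/

/-- The expected integral of `k` over a jump with law `μ`. For the increments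
`k = h(· + b) - h(b)` of a solution `h` of the Poisson equation of a centred random walk it is the
flux through `b`, whose variation over an interval is the mass of the source there. -/
noncomputable def jumpIntegral (μ : Measure ℝ) (k : ℝ → ℝ) : ℝ := ∫ v, (∫ u in 0..v, k u) ∂μ

section JumpIntegral

variable {μ : Measure ℝ} [IsFiniteMeasure μ] {k k' h r : ℝ → ℝ} {K : ℝ}

theorem integrable_one_add_abs (hsq : Integrable (fun x => x ^ 2) μ) (a : ℝ) :
    Integrable (fun x => 1 + |a + x|) μ := by
  refine ((integrable_const (2 + |a|)).add hsq).mono' (by fun_prop) (.of_forall fun x => ?_)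
  rw [norm_of_nonneg (by positivity), Pi.add_apply]
  nlinarith [abs_add_le a x, sq_nonneg (|x| - 1), sq_abs x]

theorem abs_primitive_le (hk : ∀ u, |k u| ≤ K * (1 + |u|)) (v : ℝ) :
    |∫ u in 0..v, k u| ≤ 2 * K * (1 + v ^ 2) := by
  have hK : 0 ≤ K := by simpa using (abs_nonneg _).trans (hk 0)
  have hle (u : ℝ) (hu : u ∈ uIoc 0 v) : ‖k u‖ ≤ K * (1 + |v|) := by
    refine (hk u).trans ?_
    gcongr K * (1 + ?_)
    simpa using abs_sub_left_of_mem_uIcc (uIoc_subset_uIcc hu)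
  refine (intervalIntegral.norm_integral_le_of_norm_le_const hle).trans ?_
  rw [sub_zero, mul_assoc, mul_comm 2, mul_assoc]
  refine mul_le_mul_of_nonneg_left ?_ hK
  nlinarith [sq_nonneg (|v| - 1), sq_abs v]

theorem continuous_primitive (hc : Continuous k) : Continuous fun v => ∫ u in 0..v, k u :=
  intervalIntegral.continuous_primitive (fun _ _ => hc.intervalIntegrable _ _) 0

theorem integrable_primitive (hsq : Integrable (fun x => x ^ 2) μ) (hc : Continuous k)
    (hk : ∀ u, |k u| ≤ K * (1 + |u|)) : Integrable (fun v => ∫ u in 0..v, k u) μ :=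
  (((integrable_const 1).add hsq).const_mul (2 * K)).mono'
    (continuous_primitive hc).aestronglyMeasurable (.of_forall (abs_primitive_le hk))

theorem jumpIntegral_mul_const (μ : Measure ℝ) (c : ℝ) :
    jumpIntegral μ (fun u => u * c) = (∫ x, x ^ 2 ∂μ) / 2 * c := by
  simp [jumpIntegral, integral_mul_const, integral_div]

theorem jumpIntegral_sub (hsq : Integrable (fun x => x ^ 2) μ) (hc : Continuous k)
    (hk : ∀ u, |k u| ≤ K * (1 + |u|)) (hc' : Continuous k') (hk' : ∀ u, |k' u| ≤ K * (1 + |u|)) :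
    jumpIntegral μ (fun u => k u - k' u) = jumpIntegral μ k - jumpIntegral μ k' := by
  simp only [jumpIntegral, intervalIntegral.integral_sub (hc.intervalIntegrable _ _)
    (hc'.intervalIntegrable _ _)]
  exact integral_sub (integrable_primitive hsq hc hk) (integrable_primitive hsq hc' hk')

theorem tendsto_jumpIntegral {ι : Type*} {l : Filter ι} [l.IsCountablyGenerated] {F : ι → ℝ → ℝ}
    (hsq : Integrable (fun x => x ^ 2) μ) (hc : ∀ i, Continuous (F i))
    (hF : ∀ i u, |F i u| ≤ K * (1 + |u|)) (hlim : ∀ u, Tendsto (fun i => F i u) l (𝓝 (k u))) :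
    Tendsto (fun i => jumpIntegral μ (F i)) l (𝓝 (jumpIntegral μ k)) := by
  refine tendsto_integral_filter_of_dominated_convergence (fun v => 2 * K * (1 + v ^ 2))
    (.of_forall fun i => (continuous_primitive (hc i)).aestronglyMeasurable)
    (.of_forall fun i => .of_forall (abs_primitive_le (hF i)))
    (((integrable_const 1).add hsq).const_mul (2 * K)) (.of_forall fun v => ?_)
  exact intervalIntegral.tendsto_integral_filter_of_dominated_convergence
    (fun u => K * (1 + |u|)) (.of_forall fun i => (hc i).aestronglyMeasurable)
    (.of_forall fun i => .of_forall fun u _ => hF i u)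
    (Continuous.intervalIntegrable (by fun_prop) _ _) (.of_forall fun u _ => hlim u)

theorem integral_intervalIntegral_increment (hsq : Integrable (fun x => x ^ 2) μ)
    (hc : Continuous h) (hK : ∀ x y, |h (x + y) - h y| ≤ K * (1 + |x|)) {a b : ℝ} (hab : a ≤ b) :
    ∫ v, (∫ x in a..b, (h (v + x) - h x)) ∂μ = ∫ x in a..b, (∫ v, (h (v + x) - h x) ∂μ) := by
  simp only [intervalIntegral.integral_of_le hab]
  refine integral_integral_swap ?_
  have hdom := ((integrable_one_add_abs hsq 0).const_mul K).comp_fst (volume.restrict (Ioc a b))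
  refine hdom.mono' (Continuous.aestronglyMeasurable (by fun_prop)) (.of_forall fun p => ?_)
  simpa [Function.uncurry_def] using hK p.1 p.2

theorem intervalIntegral_increment_sub (hc : Continuous h) (a b v : ℝ) :
    (∫ u in 0..v, (h (u + b) - h b)) - ∫ u in 0..v, (h (u + a) - h a) =
      (∫ x in a..b, (h (v + x) - h x)) - v * (h b - h a) := by
  have hint (a b : ℝ) : IntervalIntegrable h volume a b := hc.intervalIntegrable a b
  have hint' (c a b : ℝ) : IntervalIntegrable (fun x => h (x + c)) volume a b :=
    Continuous.intervalIntegrable (by fun_prop) a b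
  simp only [add_comm v]
  rw [intervalIntegral.integral_sub (hint' b 0 v) (by simp),
    intervalIntegral.integral_sub (hint' a 0 v) (by simp),
    intervalIntegral.integral_sub (hint' v a b) (hint a b)]
  simp only [intervalIntegral.integral_comp_add_right, intervalIntegral.integral_const, zero_add,
    add_comm v, smul_eq_mul, sub_zero]
  linarith [intervalIntegral.integral_interval_sub_interval_comm' (hint b (b + v))
    (hint a (a + v)) (hint b a), add_comm v a, add_comm v b]

theorem jumpIntegral_increment_sub (hsq : Integrable (fun x => x ^ 2) μ)
    (hmean : ∫ x, x ∂μ = 0) (hc : Continuous h)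
    (hK : ∀ x y, |h (x + y) - h y| ≤ K * (1 + |x|))
    (hpoisson : ∀ x, ∫ v, (h (v + x) - h x) ∂μ = r x) {a b : ℝ} (hab : a ≤ b) :
    jumpIntegral μ (fun u => h (u + b) - h b) - jumpIntegral μ (fun u => h (u + a) - h a) =
      ∫ x in a..b, r x := by
  have hid : Integrable (fun v => v) μ :=
    (integrable_one_add_abs hsq 0).mono' (by fun_prop) (.of_forall fun v => by simp)
  have hprim (b : ℝ) : Integrable (fun v => ∫ u in 0..v, (h (u + b) - h b)) μ :=
    integrable_primitive hsq (by fun_prop) fun u => hK u b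
  have hprim_sub : Integrable (fun v => (∫ u in 0..v, (h (u + b) - h b)) -
      ∫ u in 0..v, (h (u + a) - h a)) μ := (hprim b).sub (hprim a)
  have hshift (v : ℝ) : ∫ x in a..b, (h (v + x) - h x) = (∫ u in 0..v, (h (u + b) - h b)) -
      (∫ u in 0..v, (h (u + a) - h a)) + v * (h b - h a) := by
    rw [intervalIntegral_increment_sub hc, sub_add_cancel]
  have hfubini := integral_intervalIntegral_increment hsq hc hK hab
  simp only [hpoisson, hshift] at hfubini
  rw [← hfubini, integral_add hprim_sub (hid.mul_const _),
    integral_sub (hprim b) (hprim a), integral_mul_const, hmean, zero_mul, add_zero]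
  rfl

theorem tendsto_jumpIntegral_increment (hsq : Integrable (fun x => x ^ 2) μ)
    (hc : Continuous h) (hK : ∀ x y, |h (x + y) - h y| ≤ K * (1 + |x|))
    (hadd : ∀ x, Tendsto (fun y => h (x + y) - h y - x * (h (1 + y) - h y)) (cocompact ℝ) (𝓝 0)) :
    Tendsto (fun y => jumpIntegral μ (fun u => h (u + y) - h y) -
      (∫ x, x ^ 2 ∂μ) / 2 * (h (1 + y) - h y)) (cocompact ℝ) (𝓝 0) := by
  have : (cocompact ℝ).IsCountablyGenerated := by
    rw [cocompact_eq_atBot_atTop]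
    infer_instance
  have hK0 : 0 ≤ K := by simpa using (abs_nonneg _).trans (hK 0 0)
  have hslope (y u : ℝ) : |u * (h (1 + y) - h y)| ≤ 2 * K * (1 + |u|) := by
    have hone : |h (1 + y) - h y| ≤ 2 * K := (hK 1 y).trans (by norm_num [mul_comm])
    rw [abs_mul]
    nlinarith [mul_le_mul_of_nonneg_left hone (abs_nonneg u)]
  have hincr (y u : ℝ) : |h (u + y) - h y| ≤ 2 * K * (1 + |u|) :=
    (hK u y).trans (by gcongr; linarith)
  have hlim := tendsto_jumpIntegral (μ := μ) (K := 4 * K)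
    (F := fun y u => h (u + y) - h y - u * (h (1 + y) - h y)) hsq (fun y => by fun_prop)
    (fun y u => (abs_sub _ _).trans (by linarith [hslope y u, hincr y u])) hadd
  have hzero : jumpIntegral μ (fun _ => 0) = 0 := by simp [jumpIntegral]
  rw [hzero] at hlim
  refine hlim.congr fun y => ?_
  rw [jumpIntegral_sub hsq (by fun_prop) (hincr y) (by fun_prop) (hslope y),
    jumpIntegral_mul_const]

theorem tendsto_mul_increment_of_poisson (hsq : Integrable (fun x => x ^ 2) μ)
    (hmean : ∫ x, x ∂μ = 0) (hc : Continuous h) (hK : ∀ x y, |h (x + y) - h y| ≤ K * (1 + |x|))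
    (hpoisson : ∀ x, ∫ v, (h (v + x) - h x) ∂μ = r x) (hr : Integrable r)
    (hadd : ∀ x, Tendsto (fun y => h (x + y) - h y - x * (h (1 + y) - h y)) (cocompact ℝ) (𝓝 0))
    (hreflect : Tendsto (fun y => (h (1 + y) - h y) + (h (-y) - h (-(1 + y)))) (cocompact ℝ)
      (𝓝 0)) :
    Tendsto (fun y => (∫ x, x ^ 2 ∂μ) * (h (1 + y) - h y)) atTop (𝓝 (∫ x, r x)) := by
  have hbot : Tendsto (fun y : ℝ => -(1 + y)) atTop atBot :=
    tendsto_neg_atTop_atBot.comp (tendsto_atTop_add_const_left _ 1 tendsto_id)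
  have hsource := intervalIntegral_tendsto_integral hr hbot tendsto_id
  have hflux := tendsto_jumpIntegral_increment hsq hc hK hadd
  have hlim := ((hsource.sub (hflux.mono_left atTop_le_cocompact)).add
    ((hflux.mono_left atBot_le_cocompact).comp hbot)).add
    ((hreflect.mono_left atTop_le_cocompact).const_mul ((∫ x, x ^ 2 ∂μ) / 2))
  refine (hlim.congr' ?_).trans (by simp)
  filter_upwards [eventually_ge_atTop 0] with y hy
  have hsub := jumpIntegral_increment_sub hsq hmean hc hK hpoisson (a := -(1 + y)) (b := y)
    (by linarith)
  rw [id, ← hsub, Function.comp_apply, show 1 + -(1 + y) = -y by ring]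
  ring

end JumpIntegral

namespace ResolventFamily

variable {Ψ : ℝ → ℂ} {U : ℝ → Measure ℝ} {h : ℝ → ℝ}

theorem norm_mul_inv_le (S : ResolventFamily Ψ U) {q : ℝ} (hq : 0 < q) (hq1 : q ≤ 1) (ξ : ℝ) :
    ‖(q : ℂ) * ((q : ℂ) + Ψ ξ)⁻¹‖ ≤ 2 * ‖(((1 : ℝ) : ℂ) + Ψ ξ)⁻¹‖ := by
  have hq' : 0 < ‖(q : ℂ) + Ψ ξ‖ := hq.trans_le (S.le_norm_add q ξ)
  have h1 : 0 < ‖((1 : ℝ) : ℂ) + Ψ ξ‖ := one_pos.trans_le (S.le_norm_add 1 ξ)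
  have htri : ‖((1 : ℝ) : ℂ) + Ψ ξ‖ ≤ ‖(q : ℂ) + Ψ ξ‖ + (1 - q) := by
    have hsplit : ((1 : ℝ) : ℂ) + Ψ ξ = ((q : ℂ) + Ψ ξ) + ((1 - q : ℝ) : ℂ) := by
      push_cast
      ring
    rw [hsplit]
    refine (norm_add_le _ _).trans_eq ?_
    rw [Complex.norm_real, norm_of_nonneg (sub_nonneg.2 hq1)]
  rw [norm_mul, norm_inv, norm_inv, Complex.norm_real, norm_of_nonneg hq.le, ← div_eq_mul_inv,
    ← div_eq_mul_inv, div_le_div_iff₀ hq' h1]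
  nlinarith [S.le_norm_add q ξ]

theorem tendsto_mul_kernel (S : ResolventFamily Ψ U) (x : ℝ) :
    Tendsto (fun q => q * resolventKernel Ψ q x) (𝓝[>] 0) (𝓝 0) := by
  have hsmall : ∀ᶠ q : ℝ in 𝓝[>] 0, 0 < q ∧ q ≤ 1 :=
    Ioc_mem_nhdsGT one_pos
  have hlim := tendsto_charFunInv_of_dominated (l := 𝓝[>] (0 : ℝ)) (f := fun _ => 0)
    (F := fun q ξ => (q : ℂ) * ((q : ℂ) + Ψ ξ)⁻¹)
    (hsmall.mono fun q hq => ((S.integrable_inv q hq.1).const_mul _).1)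
    (hsmall.mono fun q hq => .of_forall (S.norm_mul_inv_le hq.1 hq.2))
    ((S.integrable_inv 1 one_pos).norm.const_mul 2) ?_ x
  · have hzero : charFunInv (fun _ => 0) x = 0 := by simp [charFunInv]
    rw [hzero] at hlim
    exact hlim.congr fun q => charFunInv_const_mul q _ x
  · filter_upwards [Measure.ae_ne volume 0] with ξ hξ
    have hne : ((0 : ℝ) : ℂ) + Ψ ξ ≠ 0 := by simpa using S.exponent_ne_zero hξ
    have hc : ContinuousAt (fun q : ℝ => (q : ℂ) * ((q : ℂ) + Ψ ξ)⁻¹) 0 := by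
      fun_prop (disch := exact hne)
    simpa using hc.tendsto.mono_left nhdsWithin_le_nhds

theorem integral_renormKernel_increment (S : ResolventFamily Ψ U) {q : ℝ} (hq : 0 < q)
    (hq1 : q < 1) (x : ℝ) :
    ∫ v, (renormKernel Ψ q (v + x) - renormKernel Ψ q x) ∂U 1 =
      (1 - q)⁻¹ * (resolventKernel Ψ 1 (-x) - q * resolventKernel Ψ q (-x)) := by
  have := S.isProbabilityMeasure_one
  have hres := S.resolvent_equation one_pos hq (-x)
  have hint : Integrable (fun v => resolventKernel Ψ q (-x - v)) (U 1) :=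
    .of_bound ((S.continuous_kernel hq).comp (by fun_prop)).aestronglyMeasurable _
      (.of_forall fun v => S.abs_kernel_le hq _)
  have hneg (v : ℝ) : -(v + x) = -x - v := by ring
  simp only [renormKernel, sub_sub_sub_cancel_left, hneg]
  rw [integral_sub (integrable_const _) hint, integral_const, probReal_univ, one_smul]
  have : 1 - q ≠ 0 := (sub_pos.2 hq1).ne'
  field_simp
  linarith

theorem integral_limit_increment (S : ResolventFamily Ψ U)
    (hsq : Integrable (fun x => x ^ 2) (U 1))
    (hh : ∀ x, Tendsto (fun q => renormKernel Ψ q x) (𝓝[>] 0) (𝓝 (h x))) (x : ℝ) :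
    ∫ v, (h (v + x) - h x) ∂U 1 = resolventKernel Ψ 1 (-x) := by
  have := S.isProbabilityMeasure_one
  obtain ⟨K, hK⟩ := S.exists_renormBound_le
  have hpos : ∀ᶠ q : ℝ in 𝓝[>] 0, 0 < q := self_mem_nhdsWithin
  have hlim := tendsto_integral_filter_of_dominated_convergence (μ := U 1) (l := 𝓝[>] 0)
    (F := fun q v => renormKernel Ψ q (v + x) - renormKernel Ψ q x)
    (fun v => K * (1 + |0 + v|)) (hpos.mono fun q hq => ?_)
    (hpos.mono fun q hq => .of_forall fun v => ?_)
    ((integrable_one_add_abs hsq 0).const_mul K) (.of_forall fun v => (hh _).sub (hh _))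
  · refine tendsto_nhds_unique hlim ?_
    have hq : Tendsto (fun q : ℝ => (1 - q)⁻¹) (𝓝[>] 0) (𝓝 1) := by
      have hc : ContinuousAt (fun q : ℝ => (1 - q)⁻¹) 0 := by fun_prop (disch := norm_num)
      simpa using hc.tendsto.mono_left nhdsWithin_le_nhds
    have hmul := hq.mul ((S.tendsto_mul_kernel (-x)).const_sub (resolventKernel Ψ 1 (-x)))
    rw [one_mul, sub_zero] at hmul
    refine hmul.congr' ?_
    filter_upwards [Ioo_mem_nhdsGT one_pos] with q hq
    exact (S.integral_renormKernel_increment hq.1 hq.2 x).symm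
  · have := S.continuous_kernel hq
    unfold renormKernel
    exact Continuous.aestronglyMeasurable (by fun_prop)
  · rw [zero_add]
    exact (S.abs_renormKernel_add_sub_le_renormBound hq v x).trans (hK v)

theorem tendsto_renormBound_zero (S : ResolventFamily Ψ U) :
    Tendsto (renormBound Ψ) (𝓝 0) (𝓝 0) := by
  have hΨ := S.continuous_exponent.measurable
  have hlim := tendsto_integral_filter_of_dominated_convergence (l := 𝓝 (0 : ℝ))
    (F := fun x ξ => ‖expSubOne x ξ‖ ^ 2 * ‖Ψ ξ‖⁻¹) (f := fun _ => 0)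
    (fun ξ => 5 * exponentWeight Ψ ξ)
    (.of_forall fun x => Measurable.aestronglyMeasurable (by fun_prop)) ?_
    (S.integrable_exponentWeight.const_mul 5) (.of_forall fun ξ => ?_)
  · simp only [integral_zero] at hlim
    exact (hlim.const_mul _).trans (by rw [mul_zero])
  · filter_upwards [Metric.closedBall_mem_nhds 0 one_pos] with x hx
    refine .of_forall fun ξ => ?_
    rw [mem_closedBall_zero_iff, norm_eq_abs, ← sq_le_one_iff_abs_le_one] at hx
    rw [norm_of_nonneg (by positivity), exponentWeight, ← mul_assoc]
    gcongr
    exact (norm_expSubOne_sq_le x ξ).trans (by gcongr; linarith)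
  · have hc : Continuous fun x => ‖expSubOne x ξ‖ ^ 2 * ‖Ψ ξ‖⁻¹ := by
      unfold expSubOne
      fun_prop
    simpa [expSubOne] using hc.tendsto 0

theorem continuous_limit (S : ResolventFamily Ψ U)
    (hh : ∀ x, Tendsto (fun q => renormKernel Ψ q x) (𝓝[>] 0) (𝓝 (h x))) : Continuous h := by
  refine continuous_iff_continuousAt.2 fun y => tendsto_iff_norm_sub_tendsto_zero.2 ?_
  have hsub : Tendsto (fun x => x - y) (𝓝 y) (𝓝 0) := by
    simpa using (continuous_sub_right y).tendsto y
  refine squeeze_zero (fun _ => norm_nonneg _) (fun x => ?_) (S.tendsto_renormBound_zero.comp hsub)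
  simpa using S.abs_limit_add_sub_le hh (x - y) y

theorem tendsto_secondMoment_mul_increment (S : ResolventFamily Ψ U)
    (hsq : Integrable (fun x => x ^ 2) (U 1)) (hmean : ∫ x, x ∂U 1 = 0)
    (hh : ∀ x, Tendsto (fun q => renormKernel Ψ q x) (𝓝[>] 0) (𝓝 (h x))) :
    Tendsto (fun y => (∫ x, x ^ 2 ∂U 1) * (h (1 + y) - h y)) atTop (𝓝 1) := by
  have := S.isProbabilityMeasure_one
  obtain ⟨K, hK⟩ := S.exists_renormBound_le
  have hmass : ∫ x, resolventKernel Ψ 1 (-x) = 1 := by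
    have h := S.integral_eq_integral_mul_kernel one_pos fun _ => 1
    rw [integral_neg_eq_self]
    simpa using h.symm
  simpa only [hmass] using tendsto_mul_increment_of_poisson hsq hmean (S.continuous_limit hh)
    (fun x y => (S.abs_limit_add_sub_le hh x y).trans (hK x))
    (S.integral_limit_increment hsq hh) (S.integrable_kernel one_pos).comp_neg
    (S.tendsto_increment_sub_mul_one hh)
    (S.tendsto_increment_add_increment_reflect hsq hmean hh 1)

theorem integral_sq_ne_zero (S : ResolventFamily Ψ U)
    (hsq : Integrable (fun x => x ^ 2) (U 1)) (hmean : ∫ x, x ∂U 1 = 0) :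
    ∫ x, x ^ 2 ∂U 1 ≠ 0 := by
  obtain ⟨h, hh⟩ := S.exists_limit_of_integrable_sq hsq hmean
  intro hzero
  have hlim := S.tendsto_secondMoment_mul_increment hsq hmean hh
  simp only [hzero, zero_mul] at hlim
  exact zero_ne_one (tendsto_nhds_unique tendsto_const_nhds hlim)

theorem tendsto_increment_atTop (S : ResolventFamily Ψ U)
    (hsq : Integrable (fun x => x ^ 2) (U 1)) (hmean : ∫ x, x ∂U 1 = 0)
    (hh : ∀ x, Tendsto (fun q => renormKernel Ψ q x) (𝓝[>] 0) (𝓝 (h x))) :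
    Tendsto (fun y => h (1 + y) - h y) atTop (𝓝 (∫ x, x ^ 2 ∂U 1)⁻¹) := by
  have hlim := (S.tendsto_secondMoment_mul_increment hsq hmean hh).const_mul (∫ x, x ^ 2 ∂U 1)⁻¹
  simpa only [inv_mul_cancel_left₀ (S.integral_sq_ne_zero hsq hmean), mul_one] using hlim

theorem tendsto_increment_atBot (S : ResolventFamily Ψ U)
    (hsq : Integrable (fun x => x ^ 2) (U 1)) (hmean : ∫ x, x ∂U 1 = 0)
    (hh : ∀ x, Tendsto (fun q => renormKernel Ψ q x) (𝓝[>] 0) (𝓝 (h x))) :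
    Tendsto (fun y => h (1 + y) - h y) atBot (𝓝 (-(∫ x, x ^ 2 ∂U 1)⁻¹)) := by
  have hreflect : Tendsto (fun y : ℝ => -(1 + y)) atBot atTop :=
    tendsto_neg_atBot_atTop.comp (tendsto_atBot_add_const_left _ 1 tendsto_id)
  have hsum := (S.tendsto_increment_add_increment_reflect hsq hmean hh 1).mono_left
    atBot_le_cocompact
  have hlim := hsum.sub ((S.tendsto_increment_atTop hsq hmean hh).comp hreflect)
  refine (hlim.congr fun y => ?_).trans (by rw [zero_sub])
  rw [Function.comp_apply, show 1 + -(1 + y) = -y by ring]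
  ring

theorem exists_limit_of_mean_zero (S : ResolventFamily Ψ U)
    (hmean : Integrable (fun x => x ^ 2) (U 1) → ∫ x, x ∂U 1 = 0) :
    ∃ h : ℝ → ℝ, (∀ x, Tendsto (fun q => renormKernel Ψ q x) (𝓝[>] 0) (𝓝 (h x))) ∧
      Tendsto (fun y => h (1 + y) - h y) atTop
        (𝓝 ((∫⁻ x, .ofReal (x ^ 2) ∂U 1)⁻¹).toReal) ∧
      Tendsto (fun y => h (1 + y) - h y) atBot
        (𝓝 (-((∫⁻ x, .ofReal (x ^ 2) ∂U 1)⁻¹).toReal)) := by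
  by_cases hvar : ∫⁻ x, .ofReal (x ^ 2) ∂U 1 = ∞
  · obtain ⟨h, hh, hlim⟩ := S.exists_limit_of_lintegral_sq_eq_top hvar
    rw [hvar, ENNReal.inv_top, ENNReal.toReal_zero, neg_zero]
    exact ⟨h, hh, hlim.mono_left atTop_le_cocompact, hlim.mono_left atBot_le_cocompact⟩
  · have hsq := integrable_sq_iff.2 hvar
    obtain ⟨h, hh⟩ := S.exists_limit_of_integrable_sq hsq (hmean hsq)
    rw [ENNReal.toReal_inv, ← integral_eq_lintegral_of_nonneg_ae
      (.of_forall fun x => sq_nonneg x) hsq.1]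
    exact ⟨h, hh, S.tendsto_increment_atTop hsq (hmean hsq) hh,
      S.tendsto_increment_atBot hsq (hmean hsq) hh⟩

end ResolventFamily

/-! ### Recurrence forces mean zero -/

theorem isBigO_sub_of_hasDerivAt {𝕜 F : Type*} [NontriviallyNormedField 𝕜]
    [NormedAddCommGroup F] [NormedSpace 𝕜 F] {f : 𝕜 → F} {f' : F} {x : 𝕜}
    (hf : HasDerivAt f f' x) (hf' : f' ≠ 0) :
    (fun y => y - x) =O[𝓝 x] fun y => f y - f x :=
  (hf.isTheta_sub hf').2.comp_tendsto (tendsto_id.prodMk (tendsto_pure.2 (.of_forall fun _ => rfl)))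

theorem hasDerivAt_charFun_zero {μ : Measure ℝ} [IsFiniteMeasure μ]
    (hsq : Integrable (fun x => x ^ 2) μ) :
    HasDerivAt (charFun μ) (Complex.I * (∫ x, x ∂μ : ℝ)) 0 := by
  have hmem : MemLp id ((1 : ℕ) : ℝ≥0∞) μ :=
    ((memLp_two_iff_integrable_sq (by fun_prop)).2 hsq).mono_exponent (by norm_num)
  have h := ((contDiff_charFun hmem).differentiable (by norm_num) 0).hasDerivAt
  rw [← iteratedDeriv_one, iteratedDeriv_charFun_zero hmem, pow_one] at h
  simpa only [pow_one] using h

theorem two_mul_one_sub_re_charFun_le {μ : Measure ℝ} [IsProbabilityMeasure μ]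
    (hsq : Integrable (fun x => x ^ 2) μ) (ξ : ℝ) :
    2 * (1 - (charFun μ ξ).re) ≤ ξ ^ 2 * ∫ x, x ^ 2 ∂μ := by
  rw [one_sub_re_charFun, ← integral_const_mul, ← integral_const_mul]
  refine integral_mono ((integrable_one_sub_cos_mul μ ξ).const_mul 2) (hsq.const_mul _) fun x => ?_
  linarith [one_sub_sq_div_two_le_cos (x := ξ * x), mul_pow ξ x 2]

theorem re_div_one_sub {w : ℂ} (hw : 1 - w ≠ 0) :
    (w / (1 - w)).re = (1 - w.re) / ‖1 - w‖ ^ 2 - 1 := by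
  have h : w / (1 - w) = (1 - w)⁻¹ - 1 := by field_simp; ring
  rw [h, Complex.sub_re, Complex.inv_re, Complex.sq_norm, Complex.sub_re, Complex.one_re]

theorem re_inv_add_le {w : ℂ} (hw : 0 ≤ w.re) (h0 : w ≠ 0) {q : ℝ} (hq : 0 < q) :
    ((q : ℂ) + w)⁻¹.re ≤ q / (q ^ 2 + ‖w‖ ^ 2) + w⁻¹.re := by
  have hpos := Complex.normSq_pos.2 h0
  have hle : q ^ 2 + Complex.normSq w ≤ Complex.normSq (q + w) := by
    simp only [Complex.normSq_apply, Complex.add_re, Complex.ofReal_re, Complex.add_im,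
      Complex.ofReal_im, zero_add]
    linarith [mul_nonneg hq.le hw]
  rw [Complex.inv_re, Complex.inv_re, Complex.add_re, Complex.ofReal_re, add_div, Complex.sq_norm]
  gcongr
  exact (le_add_of_nonneg_left (sq_nonneg q)).trans hle

theorem div_sq_add_sq_eq {c q : ℝ} (hq : q ≠ 0) (ξ : ℝ) :
    q / (q ^ 2 + (c * ξ) ^ 2) = q⁻¹ * (1 + (c / q * ξ) ^ 2)⁻¹ := by
  field_simp

theorem integrable_div_sq_add_sq {c q : ℝ} (hc : c ≠ 0) (hq : q ≠ 0) :
    Integrable fun ξ : ℝ => q / (q ^ 2 + (c * ξ) ^ 2) := by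
  simp only [div_sq_add_sq_eq hq]
  exact (integrable_inv_one_add_sq.comp_mul_left' (div_ne_zero hc hq)).const_mul _

theorem integral_div_sq_add_sq {c q : ℝ} (hc : 0 < c) (hq : 0 < q) :
    ∫ ξ : ℝ, q / (q ^ 2 + (c * ξ) ^ 2) = π / c := by
  simp only [div_sq_add_sq_eq hq.ne']
  rw [integral_const_mul, Measure.integral_comp_mul_left (fun u : ℝ => (1 + u ^ 2)⁻¹),
    integral_univ_inv_one_add_sq, abs_of_pos (by positivity), smul_eq_mul]
  field_simp

theorem norm_inv_of_one_le_abs (Ψ : ℝ → ℂ) {ξ : ℝ} (hξ : 1 ≤ |ξ|) :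
    ‖Ψ ξ‖⁻¹ = exponentWeight Ψ ξ := by
  rw [exponentWeight, min_eq_left ((one_le_sq_iff_one_le_abs ξ).2 hξ), one_mul]

namespace ResolventFamily

variable {Ψ : ℝ → ℂ} {U : ℝ → Measure ℝ} {q : ℝ}

theorem norm_one_sub_charFun_le (S : ResolventFamily Ψ U) (ξ : ℝ) :
    ‖1 - charFun (U 1) ξ‖ ≤ ‖Ψ ξ‖ := by
  have := S.isProbabilityMeasure_one
  rw [S.exponent_eq, norm_div]
  exact le_div_self (norm_nonneg _) (norm_pos_iff.2 (S.charFun_one_ne_zero ξ))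
    (norm_charFun_le_one ξ)

theorem exists_mul_abs_le_norm_one_sub (S : ResolventFamily Ψ U)
    (hsq : Integrable (fun x => x ^ 2) (U 1)) (hmean : ∫ x, x ∂U 1 ≠ 0) :
    ∃ c, 0 < c ∧ ∀ ξ, |ξ| ≤ 1 → c * |ξ| ≤ ‖1 - charFun (U 1) ξ‖ := by
  have := S.isProbabilityMeasure_one
  obtain ⟨A, hA, hbound⟩ :=
    (isBigO_sub_of_hasDerivAt (hasDerivAt_charFun_zero hsq) (by simpa using hmean)).exists_pos
  obtain ⟨δ, hδ, hnear⟩ := Metric.eventually_nhds_iff.1 hbound.bound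
  obtain ⟨B, hB, hfar⟩ := S.exists_min_one_sq_le_norm_one_sub
  simp only [dist_zero_right, norm_eq_abs, sub_zero, charFun_zero, probReal_univ,
    Complex.ofReal_one, norm_sub_rev _ (1 : ℂ)] at hnear
  refine ⟨(A + B / δ ^ 2)⁻¹, by positivity, fun ξ hξ => (inv_mul_le_iff₀ (by positivity)).2 ?_⟩
  rw [add_mul]
  rcases lt_or_ge |ξ| δ with hlt | hge
  · exact (hnear hlt).trans (le_add_of_nonneg_right (by positivity))
  · refine le_add_of_nonneg_of_le (by positivity) ?_
    have hB := hfar ξ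
    rw [min_eq_right ((sq_le_one_iff_abs_le_one ξ).2 hξ), ← sq_abs] at hB
    rw [div_mul_eq_mul_div, le_div_iff₀ (by positivity)]
    calc |ξ| * δ ^ 2 ≤ 1 * |ξ| ^ 2 := by gcongr
      _ ≤ B * ‖1 - charFun (U 1) ξ‖ := by rwa [one_mul]

theorem re_inv_exponent_le (S : ResolventFamily Ψ U) (hsq : Integrable (fun x => x ^ 2) (U 1))
    {c : ℝ} (hc : 0 < c) (hlower : ∀ ξ, |ξ| ≤ 1 → c * |ξ| ≤ ‖1 - charFun (U 1) ξ‖) {ξ : ℝ}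
    (hξ : ξ ≠ 0) :
    (Ψ ξ)⁻¹.re ≤ (∫ x, x ^ 2 ∂U 1) / c ^ 2 * (1 + ξ ^ 2)⁻¹ + exponentWeight Ψ ξ := by
  have := S.isProbabilityMeasure_one
  have : 0 ≤ ∫ x, x ^ 2 ∂U 1 := integral_nonneg fun x => sq_nonneg x
  rcases le_total |ξ| 1 with hsmall | hlarge
  · refine le_add_of_le_of_nonneg ?_ (exponentWeight_nonneg Ψ ξ)
    have hcpos : 0 < c * |ξ| := by positivity
    have hdpos : 0 < ‖1 - charFun (U 1) ξ‖ := hcpos.trans_le (hlower ξ hsmall)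
    have hξ1 := (sq_le_one_iff_abs_le_one ξ).2 hsmall
    have hre := two_mul_one_sub_re_charFun_le hsq ξ
    calc (Ψ ξ)⁻¹.re ≤ ((∫ x, x ^ 2 ∂U 1) / 2 * ξ ^ 2) / (c * |ξ|) ^ 2 := by
          rw [S.exponent_eq, inv_div, re_div_one_sub (norm_pos_iff.1 hdpos)]
          refine (sub_le_self _ zero_le_one).trans ?_
          gcongr
          · linarith
          · exact hlower ξ hsmall
      _ = (∫ x, x ^ 2 ∂U 1) / c ^ 2 * 2⁻¹ := by rw [mul_pow, sq_abs]; field_simp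
      _ ≤ _ := by gcongr; linarith
  · refine le_add_of_nonneg_of_le (by positivity) ?_
    rw [← norm_inv_of_one_le_abs Ψ hlarge, ← norm_inv]
    exact Complex.re_le_norm _

theorem div_sq_add_norm_exponent_sq_le (S : ResolventFamily Ψ U) {c : ℝ} (hc : 0 < c)
    (hlower : ∀ ξ, |ξ| ≤ 1 → c * |ξ| ≤ ‖1 - charFun (U 1) ξ‖) (hq : 0 < q) {ξ : ℝ} (hξ : ξ ≠ 0) :
    q / (q ^ 2 + ‖Ψ ξ‖ ^ 2) ≤ q / (q ^ 2 + (c * ξ) ^ 2) + exponentWeight Ψ ξ := by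
  rcases le_total |ξ| 1 with hsmall | hlarge
  · refine le_add_of_le_of_nonneg ?_ (exponentWeight_nonneg Ψ ξ)
    rw [← sq_abs (c * ξ), abs_mul, abs_of_pos hc]
    have := (hlower ξ hsmall).trans (S.norm_one_sub_charFun_le ξ)
    gcongr
  · refine le_add_of_nonneg_of_le (by positivity) ?_
    have hΨ := norm_pos_iff.2 (S.exponent_ne_zero hξ)
    rw [← norm_inv_of_one_le_abs Ψ hlarge, inv_eq_one_div, div_le_div_iff₀ (by positivity) hΨ]
    nlinarith [sq_nonneg (q - ‖Ψ ξ‖)]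

theorem exists_kernel_zero_le (S : ResolventFamily Ψ U)
    (hsq : Integrable (fun x => x ^ 2) (U 1)) (hmean : ∫ x, x ∂U 1 ≠ 0) :
    ∃ K, ∀ q, 0 < q → resolventKernel Ψ q 0 ≤ K := by
  obtain ⟨c, hc, hlower⟩ := S.exists_mul_abs_le_norm_one_sub hsq hmean
  set K : ℝ := (∫ x, x ^ 2 ∂U 1) / c ^ 2
  refine ⟨(2 * π)⁻¹ * (π / c + (K * π + 2 * ∫ ξ, exponentWeight Ψ ξ)), fun q hq => ?_⟩
  have hPoisson := integrable_div_sq_add_sq hc.ne' hq.ne'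
  have hCauchy := integrable_inv_one_add_sq.const_mul K
  have hweight := S.integrable_exponentWeight.const_mul 2
  have hsum : Integrable fun ξ : ℝ => K * (1 + ξ ^ 2)⁻¹ + 2 * exponentWeight Ψ ξ :=
    hCauchy.add hweight
  have hdom : ∀ᵐ ξ : ℝ, ((q : ℂ) + Ψ ξ)⁻¹.re ≤
      q / (q ^ 2 + (c * ξ) ^ 2) + (K * (1 + ξ ^ 2)⁻¹ + 2 * exponentWeight Ψ ξ) := by
    filter_upwards [Measure.ae_ne volume 0] with ξ hξ
    linarith [re_inv_add_le (S.re_nonneg ξ) (S.exponent_ne_zero hξ) hq,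
      S.re_inv_exponent_le hsq hc hlower hξ, S.div_sq_add_norm_exponent_sq_le hc hlower hq hξ]
  have hint := integral_mono_ae (S.integrable_inv q hq).re (hPoisson.add hsum) hdom
  simp only [Pi.add_apply] at hint
  rw [integral_add hPoisson hsum, integral_add hCauchy hweight,
    integral_const_mul, integral_const_mul, integral_univ_inv_one_add_sq,
    integral_div_sq_add_sq hc hq] at hint
  simp only [resolventKernel, charFunInv, mul_zero, Complex.ofReal_zero, neg_zero, zero_mul,
    Complex.exp_zero, one_mul]
  gcongr
  exact (integral_re (S.integrable_inv q hq)).symm.trans_le hint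

theorem integral_eq_zero_of_tendsto_kernel_zero (S : ResolventFamily Ψ U)
    (hrec : Tendsto (fun q => resolventKernel Ψ q 0) (𝓝[>] 0) atTop)
    (hsq : Integrable (fun x => x ^ 2) (U 1)) : ∫ x, x ∂U 1 = 0 := by
  by_contra hmean
  obtain ⟨K, hK⟩ := S.exists_kernel_zero_le hsq hmean
  obtain ⟨q, hlarge, hq⟩ := ((hrec.eventually_gt_atTop K).and self_mem_nhdsWithin).exists
  exact (hK q hq).not_gt hlarge

end ResolventFamily

/-! ### The second moment as a limit of frequencies -/

theorem exp_neg_sub_inv_isBigO :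
    (fun w : ℂ => Complex.exp (-w) - (1 + w)⁻¹) =O[𝓝 0] fun w => w ^ 2 := by
  have hexp : (fun w : ℂ => Complex.exp (-w) - (1 - w)) =O[𝓝 0] fun w => w ^ 2 := by
    have h := (Complex.exp_sub_sum_range_isBigO_pow 2).comp_tendsto
      (continuous_neg.tendsto' (0 : ℂ) 0 neg_zero)
    simpa [Function.comp_def, Finset.sum_range_succ, ← sub_eq_add_neg] using h
  have hinv : (fun w : ℂ => (1 + w)⁻¹ * w ^ 2) =O[𝓝 0] fun w => w ^ 2 := by
    have hc : ContinuousAt (fun w : ℂ => (1 + w)⁻¹) 0 :=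
      ContinuousAt.inv₀ (by fun_prop) (by simp)
    simpa only [one_mul] using
      (hc.isBigO_one ℂ).mul (Asymptotics.isBigO_refl (fun w => w ^ 2) (𝓝 0))
  refine (hexp.sub hinv).congr' ?_ .rfl
  have hne : ∀ᶠ w : ℂ in 𝓝 0, 1 + w ≠ 0 :=
    (continuous_const_add 1).continuousAt.eventually_ne (by simp)
  filter_upwards [hne] with w hw
  field_simp
  ring

theorem isBigO_exp_neg_sub_one :
    (fun w : ℂ => w) =O[𝓝 0] fun w => Complex.exp (-w) - 1 := by
  have hderiv : HasDerivAt (fun w : ℂ => Complex.exp (-w)) (-1) 0 := by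
    simpa using (hasDerivAt_neg (0 : ℂ)).cexp
  simpa using isBigO_sub_of_hasDerivAt hderiv (by simp)

theorem lintegral_sq_le_add {μ ν : Measure ℝ} [IsProbabilityMeasure μ] [IsProbabilityMeasure ν]
    {b : ℝ} (h : ∀ᶠ ξ in 𝓝 0, ‖charFun μ ξ - charFun ν ξ‖ ≤ b * ‖ξ ^ 2‖) :
    ∫⁻ x, .ofReal (x ^ 2) ∂μ ≤ ∫⁻ x, .ofReal (x ^ 2) ∂ν + .ofReal (2 * b) := by
  refine le_of_tendsto_of_tendsto (tendsto_two_mul_one_sub_re_charFun_div_sq μ)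
    ((tendsto_two_mul_one_sub_re_charFun_div_sq ν).add_const (.ofReal (2 * b))) ?_
  filter_upwards [nhdsWithin_le_nhds h, self_mem_nhdsWithin] with ξ hle hξ
  have hpos : 0 < ξ ^ 2 := by have : ξ ≠ 0 := hξ; positivity
  refine (ENNReal.ofReal_le_ofReal ?_).trans ENNReal.ofReal_add_le
  rw [div_add' _ _ _ hpos.ne', div_le_div_iff_of_pos_right hpos]
  rw [norm_of_nonneg hpos.le] at hle
  have hre := (abs_le.1 ((Complex.abs_re_le_norm _).trans hle)).1
  rw [Complex.sub_re] at hre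
  linarith

theorem lintegral_sq_ne_top_of_isBigO {μ ν : Measure ℝ} [IsProbabilityMeasure μ]
    [IsProbabilityMeasure ν]
    (h : (fun ξ => charFun μ ξ - charFun ν ξ) =O[𝓝 0] fun ξ => ξ ^ 2)
    (hν : ∫⁻ x, .ofReal (x ^ 2) ∂ν ≠ ∞) : ∫⁻ x, .ofReal (x ^ 2) ∂μ ≠ ∞ := by
  obtain ⟨b, hb⟩ := h.bound
  exact ne_top_of_le_ne_top (ENNReal.add_ne_top.2 ⟨hν, ENNReal.ofReal_ne_top⟩)
    (lintegral_sq_le_add hb)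

theorem lintegral_sq_le_of_isLittleO {μ ν : Measure ℝ} [IsProbabilityMeasure μ]
    [IsProbabilityMeasure ν]
    (h : (fun ξ => charFun μ ξ - charFun ν ξ) =o[𝓝 0] fun ξ => ξ ^ 2) :
    ∫⁻ x, .ofReal (x ^ 2) ∂μ ≤ ∫⁻ x, .ofReal (x ^ 2) ∂ν := by
  refine ENNReal.le_of_forall_pos_le_add fun ε hε _ => ?_
  have hle := lintegral_sq_le_add (h.bound (half_pos (NNReal.coe_pos.2 hε)))
  rwa [mul_div_cancel₀ _ two_ne_zero, ENNReal.ofReal_coe_nnreal] at hle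

namespace ResolventFamily

variable {Ψ : ℝ → ℂ} {U : ℝ → Measure ℝ} {μ : Measure ℝ}

theorem tendsto_exponent_zero (S : ResolventFamily Ψ U) : Tendsto Ψ (𝓝 0) (𝓝 0) :=
  S.continuous_exponent.tendsto' 0 0 S.zero

theorem charFun_sub_charFun_isBigO (S : ResolventFamily Ψ U)
    (hμ : ∀ ξ, charFun μ ξ = Complex.exp (-Ψ ξ)) :
    (fun ξ => charFun μ ξ - charFun (U 1) ξ) =O[𝓝 0] fun ξ => Ψ ξ ^ 2 := by
  simpa [Function.comp_def, hμ, S.charFun_eq 1 one_pos] using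
    exp_neg_sub_inv_isBigO.comp_tendsto S.tendsto_exponent_zero

theorem exponent_isLittleO (S : ResolventFamily Ψ U)
    (hsq : Integrable (fun x => x ^ 2) (U 1)) (hmean : ∫ x, x ∂U 1 = 0) :
    Ψ =o[𝓝 0] fun ξ : ℝ => ξ := by
  have := S.isProbabilityMeasure_one
  have hderiv := (hasDerivAt_charFun_zero hsq).fun_inv (S.charFun_one_ne_zero 0)
  simpa [hmean, S.charFun_eq 1 one_pos, S.zero] using hderiv.isLittleO

theorem exponent_isBigO (S : ResolventFamily Ψ U) [IsProbabilityMeasure μ]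
    (hμ : ∀ ξ, charFun μ ξ = Complex.exp (-Ψ ξ)) (hsq : Integrable (fun x => x ^ 2) μ) :
    Ψ =O[𝓝 0] fun ξ : ℝ => ξ := by
  have hderiv := (hasDerivAt_charFun_zero hsq).isBigO_sub
  simp only [sub_zero, hμ, S.zero, neg_zero, Complex.exp_zero] at hderiv
  exact (isBigO_exp_neg_sub_one.comp_tendsto S.tendsto_exponent_zero).trans hderiv

theorem lintegral_sq_eq (S : ResolventFamily Ψ U) [IsProbabilityMeasure μ]
    (hμ : ∀ ξ, charFun μ ξ = Complex.exp (-Ψ ξ))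
    (hmean : Integrable (fun x => x ^ 2) (U 1) → ∫ x, x ∂U 1 = 0) :
    ∫⁻ x, .ofReal (x ^ 2) ∂μ = ∫⁻ x, .ofReal (x ^ 2) ∂U 1 := by
  have := S.isProbabilityMeasure_one
  have hdiff := S.charFun_sub_charFun_isBigO hμ
  by_cases hU : Integrable (fun x => x ^ 2) (U 1)
  · have hsmall := hdiff.trans_isLittleO ((S.exponent_isLittleO hU (hmean hU)).pow two_pos)
    exact (lintegral_sq_le_of_isLittleO hsmall).antisymm
      (lintegral_sq_le_of_isLittleO (by simpa only [neg_sub] using hsmall.neg_left))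
  · suffices ¬ Integrable (fun x => x ^ 2) μ by
      rw [not_not.1 (mt integrable_sq_iff.2 hU), not_not.1 (mt integrable_sq_iff.2 this)]
    intro hsq
    have hsmall := hdiff.trans ((S.exponent_isBigO hμ hsq).pow 2)
    exact hU (integrable_sq_iff.2 (lintegral_sq_ne_top_of_isBigO
      (by simpa only [neg_sub] using hsmall.neg_left) (integrable_sq_iff.1 hsq)))

theorem lintegral_sq_pos (S : ResolventFamily Ψ U)
    (hmean : Integrable (fun x => x ^ 2) (U 1) → ∫ x, x ∂U 1 = 0) :
    0 < ∫⁻ x, .ofReal (x ^ 2) ∂U 1 := by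
  by_cases hU : Integrable (fun x => x ^ 2) (U 1)
  · refine pos_iff_ne_zero.2 fun hzero => S.integral_sq_ne_zero hU (hmean hU) ?_
    rw [integral_eq_lintegral_of_nonneg_ae (.of_forall fun x => sq_nonneg x) hU.1, hzero,
      ENNReal.toReal_zero]
  · rw [not_not.1 (mt integrable_sq_iff.2 hU)]
    exact ENNReal.zero_lt_top

end ResolventFamily

/-! ### The Lévy process -/

theorem eq_exp_of_hasDerivWithinAt {g : ℝ → ℂ} {z : ℂ} (hzero : g 0 = 1)
    (hcont : ContinuousOn g (Ici 0))
    (hderiv : ∀ t, 0 ≤ t → HasDerivWithinAt g (-z * g t) (Ici t) t) {t : ℝ} (ht : 0 ≤ t) :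
    g t = Complex.exp (-(t : ℂ) * z) := by
  have hprod : ContinuousOn (fun s : ℝ => g s * Complex.exp (s * z)) (Icc 0 t) :=
    (hcont.mono Icc_subset_Ici_self).mul (by fun_prop)
  have hconst := constant_of_has_deriv_right_zero hprod (fun s hs => by
    have hexp := ((Complex.ofRealCLM.hasDerivAt (x := s)).mul_const z).cexp
    refine ((hderiv s hs.1).mul hexp.hasDerivWithinAt).congr_deriv ?_
    simp only [Complex.ofRealCLM_apply, Complex.ofReal_one]
    ring) t ⟨ht, le_rfl⟩
  rw [hzero, Complex.ofReal_zero, zero_mul, Complex.exp_zero, mul_one] at hconst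
  rw [neg_mul, Complex.exp_neg]
  exact eq_inv_of_mul_eq_one_left hconst

section Multiplicative

variable {g : ℝ → ℂ} {δ t : ℝ}

theorem hasDerivWithinAt_primitive (hmeas : Measurable g)
    (hint : ∀ a b, IntervalIntegrable g volume a b) (hright : ContinuousWithinAt g (Ici t) t) :
    HasDerivWithinAt (fun u => ∫ s in (0 : ℝ)..u, g s) (g t) (Ici t) t :=
  intervalIntegral.integral_hasDerivWithinAt_right (hint 0 t)
    hmeas.stronglyMeasurable.stronglyMeasurableAtFilter (hright.mono Ioi_subset_Ici_self)

theorem mul_integral_of_multiplicative (hint : ∀ a b, IntervalIntegrable g volume a b)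
    (hmul : ∀ s t, 0 ≤ s → 0 ≤ t → g (s + t) = g s * g t) (hδ : 0 ≤ δ) (ht : 0 ≤ t) :
    g t * ∫ s in (0 : ℝ)..δ, g s = (∫ s in (0 : ℝ)..t + δ, g s) - ∫ s in (0 : ℝ)..t, g s := by
  have hshift := intervalIntegral.integral_comp_add_left (a := 0) (b := δ) g t
  rw [add_zero] at hshift
  rw [intervalIntegral.integral_interval_sub_left (hint 0 _) (hint 0 t), ← hshift,
    ← intervalIntegral.integral_const_mul]
  refine intervalIntegral.integral_congr fun s hs => ?_
  rw [uIcc_of_le hδ] at hs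
  exact (hmul t s ht hs.1).symm

-- Multiplicativity expresses `g` through its continuous primitive.
theorem exists_hasDerivWithinAt_of_multiplicative (hmeas : Measurable g)
    (hint : ∀ a b, IntervalIntegrable g volume a b) (hzero : g 0 = 1)
    (hmul : ∀ s t, 0 ≤ s → 0 ≤ t → g (s + t) = g s * g t)
    (hright : ∀ t, 0 ≤ t → ContinuousWithinAt g (Ici t) t) :
    ContinuousOn g (Ici 0) ∧
      ∃ z, ∀ t, 0 ≤ t → HasDerivWithinAt g (-z * g t) (Ici t) t := by
  set G : ℝ → ℂ := fun u => ∫ s in (0 : ℝ)..u, g s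
  have hGderiv (t : ℝ) (ht : 0 ≤ t) : HasDerivWithinAt G (g t) (Ici t) t :=
    hasDerivWithinAt_primitive hmeas hint (hright t ht)
  obtain ⟨δ, hGδ, hδ⟩ : ∃ δ, G δ ≠ 0 ∧ 0 < δ := by
    have hne := (hGderiv 0 le_rfl).eventually_ne (c := 0) (by simp [hzero])
    rw [Ici_sdiff_left] at hne
    exact (hne.and self_mem_nhdsWithin).exists
  have hrep (t : ℝ) (ht : 0 ≤ t) : g t = (G (t + δ) - G t) / G δ :=
    eq_div_of_mul_eq hGδ (mul_integral_of_multiplicative hint hmul hδ.le ht)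
  have hGc : Continuous G := intervalIntegral.continuous_primitive hint 0
  refine ⟨ContinuousOn.congr (f := fun s => (G (s + δ) - G s) / G δ) (by fun_prop) hrep,
    (1 - g δ) / G δ, fun t ht => ?_⟩
  have hshift : HasDerivWithinAt (fun s => G (s + δ)) (g (t + δ)) (Ici t) t := by
    simpa [Function.comp_def] using (hGderiv (t + δ) (by positivity)).scomp t
      ((hasDerivWithinAt_id t (Ici t)).add_const δ) fun s hs => add_le_add_left hs δ
  refine (((hshift.sub (hGderiv t ht)).div_const (G δ)).congr
    (fun s hs => hrep s (ht.trans hs)) (hrep t ht)).congr_deriv ?_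
  rw [hmul t δ ht hδ.le]
  ring

theorem exists_eq_exp_of_multiplicative (hmeas : Measurable g) (hbdd : ∀ t, ‖g t‖ ≤ 1)
    (hzero : g 0 = 1) (hmul : ∀ s t, 0 ≤ s → 0 ≤ t → g (s + t) = g s * g t)
    (hright : ∀ t, 0 ≤ t → ContinuousWithinAt g (Ici t) t) :
    ∃ z : ℂ, ∀ t : ℝ, 0 ≤ t → g t = Complex.exp (-(t : ℂ) * z) := by
  have hint (a b : ℝ) : IntervalIntegrable g volume a b :=
    (intervalIntegrable_const (c := (1 : ℝ))).mono_fun hmeas.aestronglyMeasurable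
      (.of_forall fun t => by simpa using hbdd t)
  obtain ⟨hcont, z, hderiv⟩ :=
    exists_hasDerivWithinAt_of_multiplicative hmeas hint hzero hmul hright
  exact ⟨z, fun t ht => eq_exp_of_hasDerivWithinAt hzero hcont hderiv ht⟩

end Multiplicative

/-! ### Exponent and resolvents of a Lévy process -/

theorem tendsto_floor_add_one_div_nhdsGE (t : ℝ≥0) :
    Tendsto (fun n : ℕ => ((⌊t * ((n : ℝ≥0) + 1)⌋₊ : ℝ≥0) + 1) / ((n : ℝ≥0) + 1)) atTop
      (𝓝[≥] t) := by
  have hge (n : ℕ) : t ≤ ((⌊t * ((n : ℝ≥0) + 1)⌋₊ : ℝ≥0) + 1) / ((n : ℝ≥0) + 1) :=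
    (le_div_iff₀ (by positivity)).2 (Nat.lt_floor_add_one _).le
  have hle (n : ℕ) : ((⌊t * ((n : ℝ≥0) + 1)⌋₊ : ℝ≥0) + 1) / ((n : ℝ≥0) + 1) ≤
      t + 1 / ((n : ℝ≥0) + 1) := by
    rw [add_div]
    gcongr
    exact (div_le_iff₀ (by positivity)).2 (Nat.floor_le (by positivity))
  have hlim : Tendsto (fun n : ℕ => t + 1 / ((n : ℝ≥0) + 1)) atTop (𝓝 t) := by
    simpa using (tendsto_one_div_add_atTop_nhds_zero_nat (𝕜 := ℝ≥0)).const_add t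
  exact tendsto_nhdsWithin_iff.2
    ⟨tendsto_of_tendsto_of_tendsto_of_le_of_le tendsto_const_nhds hlim hge hle, .of_forall hge⟩

theorem measurable_uncurry_of_right_continuous {Ω E : Type*} [MeasurableSpace Ω]
    [TopologicalSpace E] [TopologicalSpace.PseudoMetrizableSpace E] [MeasurableSpace E]
    [BorelSpace E] {X : ℝ≥0 → Ω → E} (hmeas : ∀ t, Measurable (X t))
    (hright : ∀ ω t, ContinuousWithinAt (fun s => X s ω) (Ici t) t) :
    Measurable (Function.uncurry X) := by
  have hlim (p : ℝ≥0 × Ω) : Tendsto (fun n : ℕ =>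
      X (((⌊p.1 * ((n : ℝ≥0) + 1)⌋₊ : ℝ≥0) + 1) / ((n : ℝ≥0) + 1)) p.2) atTop (𝓝 (X p.1 p.2)) :=
    (hright p.2 p.1).tendsto.comp (tendsto_floor_add_one_div_nhdsGE p.1)
  refine measurable_of_tendsto_metrizable (fun n => ?_) (tendsto_pi_nhds.2 hlim)
  have hgrid : Measurable fun p : ℕ × Ω => X (((p.1 : ℝ≥0) + 1) / ((n : ℝ≥0) + 1)) p.2 :=
    measurable_from_prod_countable_right fun k => hmeas (((k : ℝ≥0) + 1) / ((n : ℝ≥0) + 1))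
  have hfloor : Measurable fun p : ℝ≥0 × Ω => (⌊p.1 * ((n : ℝ≥0) + 1)⌋₊, p.2) :=
    (Nat.measurable_floor.comp (by fun_prop)).prodMk measurable_snd
  simpa only [Function.comp_def] using hgrid.comp hfloor

theorem IsResolventDensity.unique {Ω : Type*} [MeasurableSpace Ω] {P : Measure Ω}
    {X : ℝ≥0 → Ω → ℝ} {q : ℝ} {r s : ℝ → ℝ} (hr : IsResolventDensity X P q r)
    (hs : IsResolventDensity X P q s) : r = s := by
  have hae : (fun x => ENNReal.ofReal (r x)) =ᵐ[volume] fun x => ENNReal.ofReal (s x) := by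
    refine ae_eq_of_forall_setLIntegral_eq_of_sigmaFinite hr.continuous.measurable.ennreal_ofReal
      hs.continuous.measurable.ennreal_ofReal fun A hA _ => ?_
    have hind := (hr.lintegral_eq _ (measurable_one.indicator hA)).trans
      (hs.lintegral_eq _ (measurable_one.indicator hA)).symm
    have hset (f : ℝ → ℝ≥0∞) : ∫⁻ x, A.indicator 1 x * f x = ∫⁻ x in A, f x := by
      simp_rw [← indicator_mul_left, Pi.one_apply, one_mul, lintegral_indicator hA]
    rwa [hset, hset] at hind
  refine (Continuous.ae_eq_iff_eq volume hr.continuous hs.continuous).1 (hae.mono fun x hx => ?_)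
  exact (ENNReal.ofReal_eq_ofReal_iff (hr.nonneg x) (hs.nonneg x)).1 hx

namespace IsLevyProcess

variable {Ω : Type*} [MeasurableSpace Ω] {P : Measure Ω} {X : ℝ≥0 → Ω → ℝ}

theorem measurable_eval (hX : IsLevyProcess X P) :
    Measurable fun p : Ω × ℝ => X p.2.toNNReal p.1 :=
  (measurable_uncurry_of_right_continuous hX.measurable hX.right_continuous).comp
    (by fun_prop : Measurable fun p : Ω × ℝ => (p.2.toNNReal, p.1))

theorem charFun_eq_integral (hX : IsLevyProcess X P) (t : ℝ≥0) (ξ : ℝ) :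
    charFun (P.map (X t)) ξ = ∫ ω, Complex.exp (ξ * X t ω * Complex.I) ∂P := by
  rw [charFun_apply_real, integral_map (hX.measurable t).aemeasurable (by fun_prop)]

variable [IsProbabilityMeasure P]

theorem isProbabilityMeasure_map (hX : IsLevyProcess X P) (t : ℝ≥0) :
    IsProbabilityMeasure (P.map (X t)) :=
  Measure.isProbabilityMeasure_map (hX.measurable t).aemeasurable

theorem charFun_time_zero (hX : IsLevyProcess X P) (ξ : ℝ) : charFun (P.map (X 0)) ξ = 1 := by
  rw [hX.charFun_eq_integral, integral_congr_ae (g := fun _ => 1)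
    (hX.start_zero.mono fun ω hω => by simp [hω])]
  simp

theorem charFun_add (hX : IsLevyProcess X P) (s t : ℝ≥0) (ξ : ℝ) :
    charFun (P.map (X (s + t))) ξ = charFun (P.map (X s)) ξ * charFun (P.map (X t)) ξ := by
  have hindep := hX.indep_increments.indepFun_eval_sub (zero_le (a := s))
    (le_self_add (a := s) (b := t)) hX.start_zero
  have hmul := hindep.charFun_map_add_eq_mul (hX.measurable s).aemeasurable
    ((hX.measurable (s + t)).sub (hX.measurable s)).aemeasurable
  have hstat : P.map (X (s + t) - X s) = P.map (X t) := (hX.stationary_increments s t).map_eq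
  rw [add_sub_cancel, hstat] at hmul
  exact congrFun hmul ξ

theorem measurable_charFun (hX : IsLevyProcess X P) (ξ : ℝ) :
    Measurable fun t : ℝ => charFun (P.map (X t.toNNReal)) ξ := by
  simp_rw [hX.charFun_eq_integral]
  have hexp : Measurable fun y : ℝ => Complex.exp (ξ * y * Complex.I) := by fun_prop
  exact (hexp.comp hX.measurable_eval).stronglyMeasurable.integral_prod_left'.measurable

theorem continuousWithinAt_charFun (hX : IsLevyProcess X P) (ξ t : ℝ) :
    ContinuousWithinAt (fun s : ℝ => charFun (P.map (X s.toNNReal)) ξ) (Ici t) t := by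
  have hpath (ω : Ω) : ContinuousWithinAt (fun s : ℝ => X s.toNNReal ω) (Ici t) t :=
    (hX.right_continuous ω t.toNNReal).comp continuous_real_toNNReal.continuousWithinAt
      fun s hs => Real.toNNReal_le_toNNReal hs
  simp_rw [hX.charFun_eq_integral]
  refine tendsto_integral_filter_of_dominated_convergence (fun _ => 1) (.of_forall fun s => ?_)
    (.of_forall fun s => .of_forall fun ω => ?_) (integrable_const 1) (.of_forall fun ω => ?_)
  · have := hX.measurable s.toNNReal
    fun_prop
  · rw [← Complex.ofReal_mul, Complex.norm_exp_ofReal_mul_I]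
  · have hexp : Continuous fun y : ℝ => Complex.exp (ξ * y * Complex.I) := by fun_prop
    exact (hexp.tendsto _).comp (hpath ω)

theorem charFun_eq_exp (hX : IsLevyProcess X P) (ξ : ℝ) (t : ℝ≥0) :
    charFun (P.map (X t)) ξ = Complex.exp (-((t : ℝ) : ℂ) * charExponent X P ξ) := by
  refine Classical.epsilon_spec (p := fun z : ℂ =>
    ∀ t : ℝ≥0, charFun (P.map (X t)) ξ = Complex.exp (-((t : ℝ) : ℂ) * z)) ?_ t
  have := hX.isProbabilityMeasure_map
  obtain ⟨z, hz⟩ := exists_eq_exp_of_multiplicative (hX.measurable_charFun ξ)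
    (fun t => norm_charFun_le_one ξ) (by simpa using hX.charFun_time_zero ξ)
    (fun s t hs ht => by rw [Real.toNNReal_add hs ht, hX.charFun_add])
    fun t _ => hX.continuousWithinAt_charFun ξ t
  exact ⟨z, fun t => by simpa using hz t t.2⟩

theorem re_charExponent_nonneg (hX : IsLevyProcess X P) (ξ : ℝ) :
    0 ≤ (charExponent X P ξ).re := by
  have := hX.isProbabilityMeasure_map 1
  have hnorm := norm_charFun_le_one (μ := P.map (X 1)) ξ
  rw [hX.charFun_eq_exp, Complex.norm_exp, exp_le_one_iff] at hnorm
  simpa using hnorm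

end IsLevyProcess

/-- The measure `exp (-q t) dt` on `(0, ∞)`, which discounts time at rate `q`. -/
noncomputable def discountMeasure (q : ℝ) : Measure ℝ :=
  (volume.restrict (Ioi 0)).withDensity fun t => ENNReal.ofReal (exp (-q * t))

instance sFinite_discountMeasure (q : ℝ) : SFinite (discountMeasure q) := by
  unfold discountMeasure
  infer_instance

theorem isFiniteMeasure_discountMeasure {q : ℝ} (hq : 0 < q) :
    IsFiniteMeasure (discountMeasure q) :=
  isFiniteMeasure_withDensity_ofReal (integrableOn_exp_mul_Ioi (neg_neg_of_pos hq) 0).2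

theorem integral_discountMeasure {E : Type*} [NormedAddCommGroup E] [NormedSpace ℝ E]
    (q : ℝ) (g : ℝ → E) :
    ∫ t, g t ∂discountMeasure q = ∫ t in Ioi 0, exp (-q * t) • g t := by
  rw [discountMeasure, integral_withDensity_eq_integral_toReal_smul (by fun_prop) (by simp)]
  simp_rw [ENNReal.toReal_ofReal (exp_pos _).le]

/-- The resolvent measure `f ↦ E[∫_0^∞ exp (-q t) f(X_t) dt]`. -/
noncomputable def resolventMeasure {Ω : Type*} [MeasurableSpace Ω] (X : ℝ≥0 → Ω → ℝ)
    (P : Measure Ω) (q : ℝ) : Measure ℝ :=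
  (P.prod (discountMeasure q)).map fun p => X p.2.toNNReal p.1

theorem isFiniteMeasure_resolventMeasure {Ω : Type*} [MeasurableSpace Ω] (X : ℝ≥0 → Ω → ℝ)
    (P : Measure Ω) [IsFiniteMeasure P] {q : ℝ} (hq : 0 < q) :
    IsFiniteMeasure (resolventMeasure X P q) := by
  have := isFiniteMeasure_discountMeasure hq
  unfold resolventMeasure
  infer_instance

theorem ResolventFamily.measure_le_kernel_zero_mul {Ψ : ℝ → ℂ} {U : ℝ → Measure ℝ}
    (S : ResolventFamily Ψ U) {q : ℝ} (hq : 0 < q) {s : Set ℝ} (hs : MeasurableSet s) :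
    U q s ≤ ENNReal.ofReal (resolventKernel Ψ q 0) * volume s := by
  rw [← S.withDensity_kernel hq, withDensity_apply _ hs, ← setLIntegral_const]
  exact lintegral_mono fun x => ENNReal.ofReal_le_ofReal (S.kernel_le_kernel_zero hq x)

namespace IsLevyProcess

variable {Ω : Type*} [MeasurableSpace Ω] {P : Measure Ω} {X : ℝ≥0 → Ω → ℝ}

theorem lintegral_resolventMeasure (hX : IsLevyProcess X P) (q : ℝ) {f : ℝ → ℝ≥0∞}
    (hf : Measurable f) :
    ∫⁻ x, f x ∂resolventMeasure X P q =
      ∫⁻ ω, (∫⁻ t in Ioi (0 : ℝ), ENNReal.ofReal (exp (-q * t)) * f (X t.toNNReal ω)) ∂P := by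
  have hfX : Measurable fun p : Ω × ℝ => f (X p.2.toNNReal p.1) := hf.comp hX.measurable_eval
  rw [resolventMeasure, lintegral_map hf hX.measurable_eval, lintegral_prod _ hfX.aemeasurable]
  refine lintegral_congr fun ω => ?_
  exact lintegral_withDensity_eq_lintegral_mul _ (by fun_prop) (hfX.comp measurable_prodMk_left)

theorem resolventMeasure_apply (hX : IsLevyProcess X P) (q : ℝ) {s : Set ℝ}
    (hs : MeasurableSet s) :
    resolventMeasure X P q s = ∫⁻ ω, (∫⁻ t in Ioi (0 : ℝ),
      ENNReal.ofReal (exp (-q * t)) * s.indicator (fun _ => 1) (X t.toNNReal ω)) ∂P := by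
  rw [← hX.lintegral_resolventMeasure q (measurable_const.indicator hs), lintegral_indicator hs,
    setLIntegral_one]

theorem antitone_resolventMeasure (hX : IsLevyProcess X P) {s : Set ℝ} (hs : MeasurableSet s) :
    Antitone fun q => resolventMeasure X P q s := by
  intro p q hpq
  simp_rw [hX.resolventMeasure_apply _ hs]
  refine lintegral_mono fun ω => setLIntegral_mono' measurableSet_Ioi fun t (ht : 0 < t) => ?_
  gcongr

theorem tendsto_resolventMeasure_one_div (hX : IsLevyProcess X P) {s : Set ℝ}
    (hs : MeasurableSet s) :
    Tendsto (fun n : ℕ => resolventMeasure X P (1 / ((n : ℝ) + 1)) s) atTop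
      (𝓝 (∫⁻ ω, (∫⁻ t in Ioi (0 : ℝ), s.indicator (fun _ => 1) (X t.toNNReal ω)) ∂P)) := by
  set visit : Ω × ℝ → ℝ≥0∞ := fun p => s.indicator (fun _ => 1) (X p.2.toNNReal p.1)
  have hvisit : Measurable visit := (measurable_const.indicator hs).comp hX.measurable_eval
  have hpos : ∀ᵐ p ∂P.prod (volume.restrict (Ioi (0 : ℝ))), 0 < p.2 :=
    Measure.quasiMeasurePreserving_snd.ae (ae_restrict_mem measurableSet_Ioi)
  have hlim (p : Ω × ℝ) : Tendsto (fun n : ℕ =>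
      ENNReal.ofReal (exp (-(1 / ((n : ℝ) + 1)) * p.2)) * visit p) atTop (𝓝 (visit p)) := by
    have hexp : Tendsto (fun n : ℕ => ENNReal.ofReal (exp (-(1 / ((n : ℝ) + 1)) * p.2))) atTop
        (𝓝 1) := by
      simpa using ENNReal.tendsto_ofReal
        ((tendsto_one_div_add_atTop_nhds_zero_nat (𝕜 := ℝ)).neg.mul_const p.2).rexp
    simpa only [one_mul] using ENNReal.Tendsto.mul_const (b := visit p) hexp (.inl one_ne_zero)
  have hmono : ∀ᵐ p ∂P.prod (volume.restrict (Ioi (0 : ℝ))), Monotone fun n : ℕ =>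
      ENNReal.ofReal (exp (-(1 / ((n : ℝ) + 1)) * p.2)) * visit p := by
    filter_upwards [hpos] with p hp m n hmn
    beta_reduce
    gcongr
  have hconv := lintegral_tendsto_of_tendsto_of_monotone (fun n => by fun_prop) hmono
    (.of_forall hlim)
  rw [lintegral_prod _ hvisit.aemeasurable] at hconv
  refine hconv.congr fun n => ?_
  rw [hX.resolventMeasure_apply _ hs, lintegral_prod _ (by fun_prop)]

variable [IsProbabilityMeasure P]

theorem charFun_resolventMeasure (hX : IsLevyProcess X P) {q : ℝ} (hq : 0 < q) (ξ : ℝ) :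
    charFun (resolventMeasure X P q) ξ = ((q : ℂ) + charExponent X P ξ)⁻¹ := by
  have := isFiniteMeasure_discountMeasure hq
  have hXm := hX.measurable_eval
  have hre : (-((q : ℂ) + charExponent X P ξ)).re < 0 := by
    have := hX.re_charExponent_nonneg ξ
    simp only [Complex.neg_re, Complex.add_re, Complex.ofReal_re]
    linarith
  have hexp : Continuous fun y : ℝ => Complex.exp (ξ * y * Complex.I) := by fun_prop
  have hint : Integrable (fun p : Ω × ℝ => Complex.exp (ξ * X p.2.toNNReal p.1 * Complex.I))
      (P.prod (discountMeasure q)) :=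
    .of_bound (hexp.measurable.comp hXm).aestronglyMeasurable 1 (.of_forall fun p => by
      rw [← Complex.ofReal_mul, Complex.norm_exp_ofReal_mul_I])
  have hlaplace (t : ℝ) (ht : 0 < t) :
      exp (-q * t) • ∫ ω, Complex.exp (ξ * X t.toNNReal ω * Complex.I) ∂P =
        Complex.exp (-((q : ℂ) + charExponent X P ξ) * t) := by
    rw [← hX.charFun_eq_integral, hX.charFun_eq_exp, Complex.real_smul, Complex.ofReal_exp,
      ← Complex.exp_add, Real.coe_toNNReal t ht.le]
    push_cast
    ring_nf
  rw [charFun_apply_real, resolventMeasure, integral_map hXm.aemeasurable (by fun_prop),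
    integral_prod_symm _ hint, integral_discountMeasure,
    setIntegral_congr_fun measurableSet_Ioi hlaplace, integral_exp_mul_complex_Ioi hre]
  rw [Complex.ofReal_zero, mul_zero, Complex.exp_zero, neg_div_neg_eq, one_div]

theorem charExponent_zero (hX : IsLevyProcess X P) : charExponent X P 0 = 0 := by
  have hdiscount : (discountMeasure 1).real univ = 1 := by
    simpa [integral_exp_Iic_zero] using integral_discountMeasure 1 fun _ => (1 : ℝ)
  have hmass : (resolventMeasure X P 1).real univ = 1 := by
    rw [resolventMeasure, map_measureReal_apply hX.measurable_eval .univ, preimage_univ,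
      ← univ_prod_univ, measureReal_prod_prod, probReal_univ, one_mul, hdiscount]
  have hchar := hX.charFun_resolventMeasure one_pos 0
  rw [charFun_zero, hmass] at hchar
  simpa using hchar.symm

theorem integrable_inv_charExponent (hX : IsLevyProcess X P) (hA : ConditionA X P) {q : ℝ}
    (hq : 0 < q) : Integrable fun ξ => ((q : ℂ) + charExponent X P ξ)⁻¹ := by
  have := isFiniteMeasure_resolventMeasure X P hq
  simp_rw [← hX.charFun_resolventMeasure hq]
  have hmeas : AEStronglyMeasurable (charFun (resolventMeasure X P q)) :=
    continuous_charFun.aestronglyMeasurable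
  have hpos : IntegrableOn (fun ξ => ‖charFun (resolventMeasure X P q) ξ‖) (Ioi 0) := by
    refine Integrable.norm ⟨hmeas.restrict, ?_⟩
    simpa only [HasFiniteIntegral, hX.charFun_resolventMeasure hq, one_div] using hA q hq
  have hneg : IntegrableOn (fun ξ => ‖charFun (resolventMeasure X P q) ξ‖) (Iic 0) := by
    rw [integrableOn_Iic_iff_integrableOn_Iio]
    rw [← neg_zero] at hpos
    simpa only [charFun_neg, RCLike.norm_conj] using hpos.comp_neg_Iio
  rw [← integrable_norm_iff hmeas, ← integrableOn_univ, ← Iic_union_Ioi (a := (0 : ℝ))]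
  exact hneg.union hpos

theorem resolventFamily (hX : IsLevyProcess X P) (hA : ConditionA X P) :
    ResolventFamily (charExponent X P) (resolventMeasure X P) where
  re_nonneg := hX.re_charExponent_nonneg
  zero := hX.charExponent_zero
  finite _ hq := isFiniteMeasure_resolventMeasure X P hq
  charFun_eq _ hq ξ := hX.charFun_resolventMeasure hq ξ
  integrable_inv _ hq := hX.integrable_inv_charExponent hA hq

theorem isResolventDensity_kernel (hX : IsLevyProcess X P) (hA : ConditionA X P) {q : ℝ}
    (hq : 0 < q) : IsResolventDensity X P q (resolventKernel (charExponent X P) q) := by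
  have S := hX.resolventFamily hA
  refine ⟨S.continuous_kernel hq, S.kernel_nonneg hq, ⟨_, S.kernel_le_kernel_zero hq⟩,
    fun f hf => ?_⟩
  rw [← hX.lintegral_resolventMeasure q hf, ← S.withDensity_kernel hq,
    lintegral_withDensity_eq_lintegral_mul _
      (S.continuous_kernel hq).measurable.ennreal_ofReal hf]
  simp_rw [Pi.mul_apply, mul_comm]

theorem resolventDensity_eq (hX : IsLevyProcess X P) (hA : ConditionA X P) {q : ℝ}
    (hq : 0 < q) : resolventDensity X P q = resolventKernel (charExponent X P) q :=
  have hkernel := hX.isResolventDensity_kernel hA hq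
  (Classical.epsilon_spec (p := fun r => IsResolventDensity X P q r) ⟨_, hkernel⟩).unique hkernel

theorem hq_eq (hX : IsLevyProcess X P) (hA : ConditionA X P) {q : ℝ} (hq : 0 < q) (x : ℝ) :
    Levy.hq X P q x = renormKernel (charExponent X P) q x := by
  rw [Levy.hq, hX.resolventDensity_eq hA hq, renormKernel]

theorem tendsto_kernel_zero (hX : IsLevyProcess X P) (hA : ConditionA X P)
    (hrec : IsRecurrent X P) :
    Tendsto (fun q => resolventKernel (charExponent X P) q 0) (𝓝[>] 0) atTop := by
  have S := hX.resolventFamily hA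
  set s : Set ℝ := {x | |x - 0| < 1}
  have hs : MeasurableSet s := measurableSet_lt (by fun_prop) (by fun_prop)
  have hvol : volume s ≤ ENNReal.ofReal 2 := by
    have hball : s = Metric.ball 0 1 := rfl
    rw [hball, Real.volume_ball, mul_one]
  refine tendsto_atTop.2 fun K => ?_
  have hlim := hX.tendsto_resolventMeasure_one_div hs
  rw [hrec 0 1 one_pos] at hlim
  obtain ⟨n, hn⟩ := (hlim.eventually_const_lt (ENNReal.ofReal_lt_top (r := K * 2))).exists
  filter_upwards [Ioo_mem_nhdsGT (Nat.one_div_pos_of_nat (α := ℝ) (n := n))] with q hq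
  have hmass : ENNReal.ofReal (K * 2) <
      ENNReal.ofReal (resolventKernel (charExponent X P) q 0 * 2) :=
    calc ENNReal.ofReal (K * 2) < resolventMeasure X P (1 / ((n : ℝ) + 1)) s := hn
      _ ≤ resolventMeasure X P q s := hX.antitone_resolventMeasure hs hq.2.le
      _ ≤ ENNReal.ofReal (resolventKernel (charExponent X P) q 0) * volume s :=
          S.measure_le_kernel_zero_mul hq.1 hs
      _ ≤ ENNReal.ofReal (resolventKernel (charExponent X P) q 0 * 2) := by
          rw [ENNReal.ofReal_mul (S.kernel_zero_pos hq.1).le]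
          gcongr
  have hlt := (ENNReal.ofReal_lt_ofReal_iff (mul_pos (S.kernel_zero_pos hq.1) two_pos)).1 hmass
  linarith

theorem integral_resolventMeasure_eq_zero (hX : IsLevyProcess X P) (hA : ConditionA X P)
    (hrec : IsRecurrent X P) (hsq : Integrable (fun x => x ^ 2) (resolventMeasure X P 1)) :
    ∫ x, x ∂resolventMeasure X P 1 = 0 :=
  (hX.resolventFamily hA).integral_eq_zero_of_tendsto_kernel_zero
    (hX.tendsto_kernel_zero hA hrec) hsq

theorem secondMoment_eq (hX : IsLevyProcess X P) (hA : ConditionA X P)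
    (hrec : IsRecurrent X P) :
    secondMoment X P = ∫⁻ x, ENNReal.ofReal (x ^ 2) ∂resolventMeasure X P 1 := by
  have := hX.isProbabilityMeasure_map 1
  rw [← (hX.resolventFamily hA).lintegral_sq_eq (μ := P.map (X 1))
    (fun ξ => by simpa using hX.charFun_eq_exp ξ 1) (hX.integral_resolventMeasure_eq_zero hA hrec),
    lintegral_map (by fun_prop) (hX.measurable 1), secondMoment]

end IsLevyProcess

end Levy

/-- Besides the two limit assertions, the conclusion records that the objects they involve are
well defined: `m² > 0`, the resolvent densities exist, and `h_q(x) → h(x)` as `q → 0+`. -/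
theorem mainTheorem2 {Ω : Type*} [MeasurableSpace Ω] (P : Measure Ω) [IsProbabilityMeasure P]
    (X : ℝ≥0 → Ω → ℝ) (hX : Levy.IsLevyProcess X P)
    (hrec : Levy.IsRecurrent X P) (hA : Levy.ConditionA X P) :
    0 < Levy.secondMoment X P ∧
    (∀ q : ℝ, 0 < q → Levy.IsResolventDensity X P q (Levy.resolventDensity X P q)) ∧
    (∀ x : ℝ, Tendsto (fun q => Levy.hq X P q x) (𝓝[>] (0 : ℝ))
      (𝓝 (Levy.renormalizedZeroResolvent X P x))) ∧
    Tendsto (fun x : ℝ => Levy.renormalizedZeroResolvent X P x / |x|) atTop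
      (𝓝 (Levy.invSecondMoment X P)) ∧
    Tendsto (fun x : ℝ => Levy.renormalizedZeroResolvent X P x / |x|) atBot
      (𝓝 (Levy.invSecondMoment X P)) ∧
    ∀ x : ℝ,
      Tendsto (fun y : ℝ => Levy.renormalizedZeroResolvent X P (x + y) -
        Levy.renormalizedZeroResolvent X P y) atTop (𝓝 (x * Levy.invSecondMoment X P)) ∧
      Tendsto (fun y : ℝ => Levy.renormalizedZeroResolvent X P (x + y) -
        Levy.renormalizedZeroResolvent X P y) atBot (𝓝 (-(x * Levy.invSecondMoment X P))) := by
  have S := hX.resolventFamily hA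
  have hmean := hX.integral_resolventMeasure_eq_zero hA hrec
  obtain ⟨h, hh, htop, hbot⟩ := S.exists_limit_of_mean_zero hmean
  rw [← hX.secondMoment_eq hA hrec] at htop hbot
  have hlim (x : ℝ) : Tendsto (fun q => Levy.hq X P q x) (𝓝[>] (0 : ℝ)) (𝓝 (h x)) :=
    (hh x).congr' (eventually_mem_nhdsWithin.mono fun q hq => (hX.hq_eq hA hq x).symm)
  have heq : Levy.renormalizedZeroResolvent X P = h := funext fun x => (hlim x).limUnder_eq
  rw [heq, Levy.invSecondMoment]
  refine ⟨(S.lintegral_sq_pos hmean).trans_eq (hX.secondMoment_eq hA hrec).symm, fun q hq => ?_,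
    hlim, S.tendsto_limit_div_atTop hh htop, S.tendsto_limit_div_atBot hh hbot,
    fun x => ⟨S.tendsto_increment hh atTop_le_cocompact htop x, ?_⟩⟩
  · rw [hX.resolventDensity_eq hA hq]
    exact hX.isResolventDensity_kernel hA hq
  · simpa only [mul_neg] using S.tendsto_increment hh atBot_le_cocompact hbot x
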